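/- Let $k$ be a field, let $\mathcal M$ be a bicomplete $k$-linear abelian category, and let $\mathcal C$ be a $k$-linear Reedy category. Write $\mathcal M^{\mathcal C}$ for the category of $k$-linear functors $\mathcal C\to\mathcal M$. If $(\mathcal A,\mathcal W,\mathcal B)$ is a hereditary Hovey triple on $\mathcal M$, then $(\Phi(\mathcal A),\mathcal W^{\mathcal C},\Psi(\mathcal B))$ is a hereditary Hovey triple on $\mathcal M^{\mathcal C}$. Here the terms have the following meaning. **Reedy categories.** A small $k$-linear category $\mathcal C$ is $k$-linear Reedy if it is equipped with a degree function $\deg$ from its objects to the ordinals below some ordinal $\lambda$ and with two $k$-linear subcategories $\mathcal C^+,\mathcal C^-$ having the same objects as $\mathcal C$, such that: all endomorphism spaces in $\mathcal C^{\pm}$ are one-dimensional over $k$; for $c\neq d$, a non-zero morphism $c\to d$ in $\mathcal C^+$ (resp. in $\mathcal C^-$) exists only if $\deg(c)<\deg(d)$ (resp. $\deg(c)>\deg(d)$); and for all objects $c,d$ composition induces an isomorphism $\bigoplus_{e}\mathcal C^+(e,d)\otimes_k\mathcal C^-(c,e)\to\mathcal C(c,d)$, where $e$ runs over all objects of $\mathcal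 C$. **The classes.** For $X\in\mathcal M^{\mathcal C}$ and an object $c$ of degree $\alpha$, let $\mathcal C^{\pm}_{<\alpha}$ be the full subcategory of $\mathcal C^{\pm}$ on the objects of degree $<\alpha$. The latching morphism $l^X_c\colon \mathcal C^+(-,c)\otimes_{\mathcal C^+_{<\alpha}}X\to X(c)$ is the canonical map from the ($k$-linear) weighted colimit, and the matching morphism $m^X_c\colon X(c)\to\hom_{\mathcal C^-_{<\alpha}}(\mathcal C^-(c,-),X)$ is the canonical map to the weighted limit; both are induced by the action of $X$ on morphisms. For a class $\mathcal S$ of objects of $\mathcal M$, $$\Phi(\mathcal S)=\{X\in\mathcal M^{\mathcal C} : \text{for all } c,\ l^X_c \text{ is a monomorphism and } \operatorname{coker} l^X_c\in\mathcal S\},$$ $$\Psi(\mathcal S)=\{X\in\mathcal M^{\mathcal C} : \text{for all } c,\ m^X_c \text{ is an epimorphism and } \ker m^X_c\in\mathcal S\},$$ and $\mathcal S^{\mathcal C}=\{X\in\mathcal M^{\mathcal C} : X(c)\in\mathcal S \text{ for all } c\}$. **Hovey triples.** A weak factorization system $(\mathcal L,\mathcal R)$ in an abelian category is abelian if $f\in\mathcal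 L$ exactly when $f$ is a monomorphism and $0\to\operatorname{coker}f$ is in $\mathcal L$, and $g\in\mathcal R$ exactly when $g$ is an epimorphism and $\ker g\to0$ is in $\mathcal R$. A model structure on a bicomplete abelian category is abelian if its two weak factorization systems (trivial cofibrations, fibrations) and (cofibrations, trivial fibrations) are abelian. A triple $(\mathcal A,\mathcal W,\mathcal B)$ of classes of objects is a Hovey triple if there is an abelian model structure of which $\mathcal A$, $\mathcal W$, $\mathcal B$ are the classes of cofibrant, of weakly trivial (weakly equivalent to $0$) and of fibrant objects. It is hereditary if the two associated complete cotorsion pairs $(\mathcal X,\mathcal Y)=(\mathcal A,\mathcal W\cap\mathcal B)$ and $(\mathcal A\cap\mathcal W,\mathcal B)$ are hereditary, that is, $\operatorname{Ext}^i(X,Y)=0$ for all $X\in\mathcal X$, $Y\in\mathcal Y$ and $i\ge1$. -/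

import Mathlib

open CategoryTheory CategoryTheory.Limits Opposite
open scoped TensorProduct ZeroObject

universe v u

noncomputable section

namespace LinearReedy

/-! ## The category of `k`-linear functors -/

section LinearFunctors

variable (k : Type v) [Field k] (C : Type v) [SmallCategory C] [Preadditive C] [Linear k C]
  (M : Type u) [Category.{v} M] [Abelian M] [Linear k M]

/-- The `k`-linear functors `C ⥤ M`: those for which all the maps `F.map` on hom-spaces are
additive and commute with scalars. -/
def isLinear : ObjectProperty (C ⥤ M) := fun F => F.Additive ∧ F.Linear k

/-- The category `M^C` of `k`-linear functors from `C` to `M` (and all natural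
transformations). -/
abbrev LinFun : Type (max u v) := (isLinear k C M).FullSubcategory

instance isLinear_closedUnderLimits (J : Type*) [Category* J] [HasLimitsOfShape J M] :
    (isLinear k C M).IsClosedUnderLimitsOfShape J where
  limitsOfShape_le := by
    rintro X ⟨h⟩
    have hl : ∀ c : C, IsLimit (((evaluation C M).obj c).mapCone (Cone.mk _ h.π)) :=
      fun c => isLimitOfPreserves _ h.isLimit
    refine ⟨⟨?_⟩, ⟨?_⟩⟩
    · intro c d f g
      refine (hl d).hom_ext fun j => ?_
      have := (h.prop_diag_obj j).1
      have e : ∀ f : c ⟶ d, X.map f ≫ (h.π.app j).app d =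
        (h.π.app j).app c ≫ (h.diag.obj j).map f := fun f => (h.π.app j).naturality f
      change X.map (f + g) ≫ (h.π.app j).app d = (X.map f + X.map g) ≫ (h.π.app j).app d
      rw [Preadditive.add_comp, e, e, e, Functor.map_add, Preadditive.comp_add]
    · intro c d f a
      refine (hl d).hom_ext fun j => ?_
      have := (h.prop_diag_obj j).2
      have e : ∀ f : c ⟶ d, X.map f ≫ (h.π.app j).app d =
        (h.π.app j).app c ≫ (h.diag.obj j).map f := fun f => (h.π.app j).naturality f
      change X.map (a • f) ≫ (h.π.app j).app d = (a • X.map f) ≫ (h.π.app j).app d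
      rw [Linear.smul_comp, e, e, Functor.map_smul, Linear.comp_smul]

instance isLinear_closedUnderColimits (J : Type*) [Category* J] [HasColimitsOfShape J M] :
    (isLinear k C M).IsClosedUnderColimitsOfShape J where
  colimitsOfShape_le := by
    rintro X ⟨h⟩
    have hl : ∀ c : C, IsColimit (((evaluation C M).obj c).mapCocone (Cocone.mk _ h.ι)) :=
      fun c => isColimitOfPreserves _ h.isColimit
    refine ⟨⟨?_⟩, ⟨?_⟩⟩
    · intro c d f g
      refine (hl c).hom_ext fun j => ?_
      have := (h.prop_diag_obj j).1
      have e : ∀ f : c ⟶ d, (h.ι.app j).app c ≫ X.map f =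
        (h.diag.obj j).map f ≫ (h.ι.app j).app d := fun f => ((h.ι.app j).naturality f).symm
      change (h.ι.app j).app c ≫ X.map (f + g) = (h.ι.app j).app c ≫ (X.map f + X.map g)
      rw [Preadditive.comp_add, e, e, e, Functor.map_add, Preadditive.add_comp]
    · intro c d f a
      refine (hl c).hom_ext fun j => ?_
      have := (h.prop_diag_obj j).2
      have e : ∀ f : c ⟶ d, (h.ι.app j).app c ≫ X.map f =
        (h.diag.obj j).map f ≫ (h.ι.app j).app d := fun f => ((h.ι.app j).naturality f).symm
      change (h.ι.app j).app c ≫ X.map (a • f) = (h.ι.app j).app c ≫ (a • X.map f)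
      rw [Linear.comp_smul, e, e, Functor.map_smul, Linear.smul_comp]

instance isLinear_containsZero : (isLinear k C M).ContainsZero where
  exists_zero := by
    refine ⟨(Functor.const C).obj (0 : M), ?_, ⟨fun {_ _ _ _} => (isZero_zero M).eq_of_src _ _⟩,
      ⟨fun _ _ => (isZero_zero M).eq_of_src _ _⟩⟩
    exact Functor.isZero _ fun _ => isZero_zero M

instance isLinear_closedUnderKernels : (isLinear k C M).IsClosedUnderKernels where
  kernels_le := by
    rintro X ⟨f, s, hs, hf⟩
    exact ObjectProperty.prop_of_isLimit _ hs
      (by rintro (_ | _); exacts [hf.1, hf.2])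

instance isLinear_closedUnderCokernels : (isLinear k C M).IsClosedUnderCokernels where
  cokernels_le := by
    rintro X ⟨f, s, hs, hf⟩
    exact ObjectProperty.prop_of_isColimit _ hs
      (by rintro (_ | _); exacts [hf.1, hf.2])

instance isLinear_closedUnderFiniteProducts : (isLinear k C M).IsClosedUnderFiniteProducts :=
  .of_isClosedUnderLimitsOfShape.{0} fun _ => inferInstance

instance [HasLimits M] : HasLimits (LinFun k C M) where
  has_limits_of_shape _ _ := inferInstance

instance [HasColimits M] : HasColimits (LinFun k C M) where
  has_colimits_of_shape _ _ := inferInstance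

end LinearFunctors

/-! ## Weighted colimits and weighted limits -/

section Weighted

variable {k : Type v} [Field k] {J : Type v} [SmallCategory J]
  {M : Type u} [Category.{v} M] [Abelian M] [Linear k M]

/-- Index set of the relations that cut the colimit of a functor on `J` weighted by `W`
out of a coproduct: additivity and homogeneity in the weight, and balancedness over `J`. -/
inductive ColimRel (W : Jᵒᵖ ⥤ ModuleCat.{v} k) : Type v
  | add (d : J) (w w' : W.obj (op d))
  | smul (d : J) (a : k) (w : W.obj (op d))
  | nat {d d' : J} (f : d ⟶ d') (w : W.obj (op d'))

/-- The object of `J` at which a relation lives. -/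
def ColimRel.src {W : Jᵒᵖ ⥤ ModuleCat.{v} k} : ColimRel W → J
  | .add d _ _ => d
  | .smul d _ _ => d
  | .nat (d := d) _ _ => d

section Colimit

variable [HasColimits M]

/-- The coproduct of one copy of `X d` for each object `d` and each `w ∈ W d`. -/
abbrev colimGens (W : Jᵒᵖ ⥤ ModuleCat.{v} k) (X : J ⥤ M) : M :=
  ∐ fun p : Σ d : J, W.obj (op d) => X.obj p.1

/-- The inclusion `x ↦ w ⊗ x` of a summand. -/
def colimGens.ι (W : Jᵒᵖ ⥤ ModuleCat.{v} k) (X : J ⥤ M) (d : J) (w : W.obj (op d)) :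
    X.obj d ⟶ colimGens W X :=
  Sigma.ι (fun p : Σ d : J, W.obj (op d) => X.obj p.1) ⟨d, w⟩

/-- The map `X (src r) ⟶ colimGens W X` which has to vanish for the relation `r` to hold:
`(w + w') ⊗ x - w ⊗ x - w' ⊗ x`, `(a w) ⊗ x - a (w ⊗ x)`, `(w f) ⊗ x - w ⊗ (f x)`. -/
def colimRelMap (W : Jᵒᵖ ⥤ ModuleCat.{v} k) (X : J ⥤ M) :
    ∀ r : ColimRel W, X.obj r.src ⟶ colimGens W X
  | .add d w w' => colimGens.ι W X d (w + w') - colimGens.ι W X d w - colimGens.ι W X d w'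
  | .smul d a w => colimGens.ι W X d (a • w) - a • colimGens.ι W X d w
  | .nat (d := d) (d' := d') f w =>
      colimGens.ι W X d (W.map f.op w) - X.map f ≫ colimGens.ι W X d' w

/-- The `k`-linear colimit `W ⊗_J X = ∫^d W(d) ⊗ X(d)` of `X` weighted by `W`. As in the formula
`⨁ W(d) ⊗_k X(d) / (w f ⊗ x - w ⊗ f x)` for functors with values in vector spaces, it is
presented by the generators `w ⊗ x` and the relations of bilinearity and of balancedness. Its
universal property `Hom(W ⊗_J X, N) ≃ Nat(W, Hom(X -, N))` is given by `weightedColimit.desc`,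
`weightedColimit.ι_desc` and `weightedColimit.hom_ext`. -/
abbrev weightedColimit (W : Jᵒᵖ ⥤ ModuleCat.{v} k) (X : J ⥤ M) : M :=
  cokernel (Sigma.desc (colimRelMap W X))

namespace weightedColimit

variable (W : Jᵒᵖ ⥤ ModuleCat.{v} k) (X : J ⥤ M)

/-- The canonical map `X d ⟶ W ⊗_J X`, `x ↦ w ⊗ x`, for `w ∈ W d`. -/
def ι (d : J) (w : W.obj (op d)) : X.obj d ⟶ weightedColimit W X :=
  colimGens.ι W X d w ≫ cokernel.π (Sigma.desc (colimRelMap W X))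

lemma rel (r : ColimRel W) :
    colimRelMap W X r ≫ cokernel.π (Sigma.desc (colimRelMap W X)) = 0 := by
  rw [← Sigma.ι_desc (colimRelMap W X) r, Category.assoc, cokernel.condition, comp_zero]

lemma ι_add (d : J) (w w' : W.obj (op d)) : ι W X d (w + w') = ι W X d w + ι W X d w' := by
  have : (colimGens.ι W X d (w + w') - colimGens.ι W X d w - colimGens.ι W X d w') ≫
      cokernel.π (Sigma.desc (colimRelMap W X)) = 0 := rel W X (.add d w w')
  simp only [Preadditive.sub_comp] at this
  rw [sub_sub, sub_eq_zero] at this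
  exact this

lemma ι_smul (d : J) (a : k) (w : W.obj (op d)) : ι W X d (a • w) = a • ι W X d w := by
  have : (colimGens.ι W X d (a • w) - a • colimGens.ι W X d w) ≫
      cokernel.π (Sigma.desc (colimRelMap W X)) = 0 := rel W X (.smul d a w)
  simp only [Preadditive.sub_comp, Linear.smul_comp] at this
  rw [sub_eq_zero] at this
  exact this

lemma ι_map {d d' : J} (f : d ⟶ d') (w : W.obj (op d')) :
    ι W X d (W.map f.op w) = X.map f ≫ ι W X d' w := by
  have : (colimGens.ι W X d (W.map f.op w) - X.map f ≫ colimGens.ι W X d' w) ≫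
      cokernel.π (Sigma.desc (colimRelMap W X)) = 0 := rel W X (.nat f w)
  simp only [Preadditive.sub_comp, Category.assoc] at this
  rw [sub_eq_zero] at this
  exact this

variable {W X}

/-- The map out of the weighted colimit given by a natural family of `k`-linear maps
`W d → Hom(X d, N)`. -/
def desc {N : M} (l : ∀ d : J, W.obj (op d) →ₗ[k] (X.obj d ⟶ N))
    (hl : ∀ {d d' : J} (f : d ⟶ d') (w : W.obj (op d')),
      l d (W.map f.op w) = X.map f ≫ l d' w) : weightedColimit W X ⟶ N :=
  cokernel.desc _ (Sigma.desc fun p : Σ d : J, W.obj (op d) => l p.1 p.2) (by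
    refine Sigma.hom_ext _ _ fun r => ?_
    have hι : ∀ (d : J) (w : W.obj (op d)), colimGens.ι W X d w ≫
        Sigma.desc (fun p : Σ d : J, W.obj (op d) => l p.1 p.2) = l d w := fun d w =>
      Sigma.ι_desc (fun p : Σ d : J, W.obj (op d) => l p.1 p.2) ⟨d, w⟩
    rw [comp_zero, ← Category.assoc, Sigma.ι_desc]
    cases r with
    | add d w w' =>
      change (colimGens.ι W X d (w + w') - colimGens.ι W X d w - colimGens.ι W X d w') ≫ _ = 0
      rw [Preadditive.sub_comp, Preadditive.sub_comp, hι, hι, hι, map_add]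
      abel
    | smul d a w =>
      change (colimGens.ι W X d (a • w) - a • colimGens.ι W X d w) ≫ _ = 0
      rw [Preadditive.sub_comp, Linear.smul_comp, hι, hι, map_smul, sub_self]
    | @nat d d' f w =>
      change (colimGens.ι W X d (W.map f.op w) - X.map f ≫ colimGens.ι W X d' w) ≫ _ = 0
      rw [Preadditive.sub_comp, Category.assoc, hι, hι, hl, sub_self])

@[simp]
lemma ι_desc {N : M} (l : ∀ d : J, W.obj (op d) →ₗ[k] (X.obj d ⟶ N))
    (hl : ∀ {d d' : J} (f : d ⟶ d') (w : W.obj (op d')),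
      l d (W.map f.op w) = X.map f ≫ l d' w) (d : J) (w : W.obj (op d)) :
    ι W X d w ≫ desc l hl = l d w := by
  rw [ι, desc, Category.assoc, cokernel.π_desc]
  exact Sigma.ι_desc (fun p : Σ d : J, W.obj (op d) => l p.1 p.2) ⟨d, w⟩

lemma hom_ext {N : M} {f g : weightedColimit W X ⟶ N}
    (h : ∀ (d : J) (w : W.obj (op d)), ι W X d w ≫ f = ι W X d w ≫ g) : f = g := by
  refine coequalizer.hom_ext (Sigma.hom_ext _ _ fun p => ?_)
  have := h p.1 p.2
  rwa [ι, Category.assoc, Category.assoc] at this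

end weightedColimit

end Colimit

/-- Index set of the relations that cut the limit of a functor on `J` weighted by `U` out of a
product: additivity and homogeneity in the weight, and naturality over `J`. -/
inductive LimRel (U : J ⥤ ModuleCat.{v} k) : Type v
  | add (d : J) (x x' : U.obj d)
  | smul (d : J) (a : k) (x : U.obj d)
  | nat {d d' : J} (f : d ⟶ d') (x : U.obj d)

/-- The object of `J` at which a relation lives. -/
def LimRel.tgt {U : J ⥤ ModuleCat.{v} k} : LimRel U → J
  | .add d _ _ => d
  | .smul d _ _ => d
  | .nat (d' := d') _ _ => d'

section Limit

variable [HasLimits M]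

/-- The product of one copy of `X d` for each object `d` and each `x ∈ U d`. -/
abbrev limGens (U : J ⥤ ModuleCat.{v} k) (X : J ⥤ M) : M :=
  ∏ᶜ fun p : Σ d : J, U.obj d => X.obj p.1

/-- The projection `φ ↦ φ(x)` to a factor. -/
def limGens.π (U : J ⥤ ModuleCat.{v} k) (X : J ⥤ M) (d : J) (x : U.obj d) :
    limGens U X ⟶ X.obj d :=
  Pi.π (fun p : Σ d : J, U.obj d => X.obj p.1) ⟨d, x⟩

/-- The map `limGens U X ⟶ X (tgt r)` which has to vanish for the relation `r` to hold:
`φ(x + x') - φ(x) - φ(x')`, `φ(a x) - a φ(x)`, `φ(f x) - f φ(x)`. -/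
def limRelMap (U : J ⥤ ModuleCat.{v} k) (X : J ⥤ M) :
    ∀ r : LimRel U, limGens U X ⟶ X.obj r.tgt
  | .add d x x' => limGens.π U X d (x + x') - limGens.π U X d x - limGens.π U X d x'
  | .smul d a x => limGens.π U X d (a • x) - a • limGens.π U X d x
  | .nat (d := d) (d' := d') f x =>
      limGens.π U X d' (U.map f x) - limGens.π U X d x ≫ X.map f

/-- The `k`-linear limit `hom_J(U, X) = ∫_d Hom(U(d), X(d))` of `X` weighted by `U`: the subobject
of a product of copies of the `X d` indexed by the elements `x` of `U d`, cut out by linearity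
in `x` and naturality in `d`. Its universal property `Hom(N, hom_J(U, X)) ≃ Nat(U, Hom(N, X -))`
is given by `weightedLimit.lift`, `weightedLimit.lift_π` and `weightedLimit.hom_ext`. -/
abbrev weightedLimit (U : J ⥤ ModuleCat.{v} k) (X : J ⥤ M) : M :=
  kernel (Pi.lift (limRelMap U X))

namespace weightedLimit

variable (U : J ⥤ ModuleCat.{v} k) (X : J ⥤ M)

/-- The canonical map `hom_J(U, X) ⟶ X d`, `φ ↦ φ(x)`, for `x ∈ U d`. -/
def π (d : J) (x : U.obj d) : weightedLimit U X ⟶ X.obj d :=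
  kernel.ι (Pi.lift (limRelMap U X)) ≫ limGens.π U X d x

lemma rel (r : LimRel U) : kernel.ι (Pi.lift (limRelMap U X)) ≫ limRelMap U X r = 0 := by
  rw [← Pi.lift_π (limRelMap U X) r, ← Category.assoc, kernel.condition, zero_comp]

lemma π_add (d : J) (x x' : U.obj d) : π U X d (x + x') = π U X d x + π U X d x' := by
  have : kernel.ι (Pi.lift (limRelMap U X)) ≫
      (limGens.π U X d (x + x') - limGens.π U X d x - limGens.π U X d x') = 0 := rel U X (.add d x x')
  simp only [Preadditive.comp_sub] at this
  rw [sub_sub, sub_eq_zero] at this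
  exact this

lemma π_smul (d : J) (a : k) (x : U.obj d) : π U X d (a • x) = a • π U X d x := by
  have : kernel.ι (Pi.lift (limRelMap U X)) ≫
      (limGens.π U X d (a • x) - a • limGens.π U X d x) = 0 := rel U X (.smul d a x)
  simp only [Preadditive.comp_sub, Linear.comp_smul] at this
  rw [sub_eq_zero] at this
  exact this

lemma π_map {d d' : J} (f : d ⟶ d') (x : U.obj d) :
    π U X d' (U.map f x) = π U X d x ≫ X.map f := by
  have : kernel.ι (Pi.lift (limRelMap U X)) ≫
      (limGens.π U X d' (U.map f x) - limGens.π U X d x ≫ X.map f) = 0 := rel U X (.nat f x)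
  simp only [Preadditive.comp_sub] at this
  rw [sub_eq_zero, ← Category.assoc] at this
  exact this

variable {U X}

/-- The map into the weighted limit given by a natural family of `k`-linear maps
`U d → Hom(N, X d)`. -/
def lift {N : M} (m : ∀ d : J, U.obj d →ₗ[k] (N ⟶ X.obj d))
    (hm : ∀ {d d' : J} (f : d ⟶ d') (x : U.obj d), m d' (U.map f x) = m d x ≫ X.map f) :
    N ⟶ weightedLimit U X :=
  kernel.lift _ (Pi.lift fun p : Σ d : J, U.obj d => m p.1 p.2) (by
    refine Pi.hom_ext _ _ fun r => ?_
    have hπ : ∀ (d : J) (x : U.obj d),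
        Pi.lift (fun p : Σ d : J, U.obj d => m p.1 p.2) ≫ limGens.π U X d x = m d x := fun d x =>
      Pi.lift_π (fun p : Σ d : J, U.obj d => m p.1 p.2) ⟨d, x⟩
    rw [zero_comp, Category.assoc, Pi.lift_π]
    cases r with
    | add d x x' =>
      change _ ≫ (limGens.π U X d (x + x') - limGens.π U X d x - limGens.π U X d x') = 0
      rw [Preadditive.comp_sub, Preadditive.comp_sub, hπ, hπ, hπ, map_add]
      abel
    | smul d a x =>
      change _ ≫ (limGens.π U X d (a • x) - a • limGens.π U X d x) = 0
      rw [Preadditive.comp_sub, Linear.comp_smul, hπ, hπ, map_smul, sub_self]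
    | @nat d d' f x =>
      change _ ≫ (limGens.π U X d' (U.map f x) - limGens.π U X d x ≫ X.map f) = 0
      rw [Preadditive.comp_sub, ← Category.assoc, hπ, hπ, hm, sub_self])

@[simp]
lemma lift_π {N : M} (m : ∀ d : J, U.obj d →ₗ[k] (N ⟶ X.obj d))
    (hm : ∀ {d d' : J} (f : d ⟶ d') (x : U.obj d), m d' (U.map f x) = m d x ≫ X.map f)
    (d : J) (x : U.obj d) : lift m hm ≫ π U X d x = m d x := by
  rw [π, lift, kernel.lift_ι_assoc]
  exact Pi.lift_π (fun p : Σ d : J, U.obj d => m p.1 p.2) ⟨d, x⟩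

lemma hom_ext {N : M} {f g : N ⟶ weightedLimit U X}
    (h : ∀ (d : J) (x : U.obj d), f ≫ π U X d x = g ≫ π U X d x) : f = g := by
  refine equalizer.hom_ext (Pi.hom_ext _ _ fun p => ?_)
  have := h p.1 p.2
  rwa [π, ← Category.assoc, ← Category.assoc] at this

end weightedLimit

end Limit

end Weighted

/-! ## Linear Reedy categories -/

section Reedy

variable (k : Type v) [Field k] (C : Type v) [SmallCategory C] [Preadditive C] [Linear k C]

/-- A `k`-linear subcategory of `C` with the same objects as `C`. -/
structure WideLinearSubcategory where
  /-- The morphisms `c ⟶ d` that belong to the subcategory. -/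
  hom (c d : C) : Submodule k (c ⟶ d)
  id_mem (c : C) : 𝟙 c ∈ hom c c
  comp_mem {c d e : C} {f : c ⟶ d} {g : d ⟶ e} :
    f ∈ hom c d → g ∈ hom d e → f ≫ g ∈ hom c e

variable {k C}

namespace WideLinearSubcategory

variable (S : WideLinearSubcategory k C) (deg : C → Ordinal.{v})

/-- `S` is a direct `k`-linear category with respect to the degree function `deg`. -/
structure IsDirect : Prop where
  end_equiv (c : C) : Nonempty (S.hom c c ≃ₗ[k] k)
  deg_lt {c d : C} (f : c ⟶ d) : f ∈ S.hom c d → f ≠ 0 → c ≠ d → deg c < deg d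

/-- `S` is an inverse `k`-linear category with respect to the degree function `deg`. -/
structure IsInverse : Prop where
  end_equiv (c : C) : Nonempty (S.hom c c ≃ₗ[k] k)
  deg_lt {c d : C} (f : c ⟶ d) : f ∈ S.hom c d → f ≠ 0 → c ≠ d → deg d < deg c

/-- The objects of the full subcategory `S_{<α}` of `S` formed by the objects of degree `< α`. -/
structure Below (_S : WideLinearSubcategory k C) (deg : C → Ordinal.{v}) (α : Ordinal.{v}) where
  /-- the underlying object of `C` -/
  obj : C
  deg_lt : deg obj < α

variable {deg}

instance (α : Ordinal.{v}) : SmallCategory (S.Below deg α) where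
  Hom x y := S.hom x.obj y.obj
  id x := ⟨𝟙 x.obj, S.id_mem _⟩
  comp f g := ⟨f.1 ≫ g.1, S.comp_mem f.2 g.2⟩
  id_comp f := Subtype.ext (Category.id_comp f.1)
  comp_id f := Subtype.ext (Category.comp_id f.1)
  assoc f g h := Subtype.ext (Category.assoc f.1 g.1 h.1)

variable (deg)

/-- The inclusion `S_{<α} ⥤ C`. -/
def incl (α : Ordinal.{v}) : S.Below deg α ⥤ C where
  obj x := x.obj
  map f := f.1

/-- The weight `S(-, c)` on `S_{<α}`. -/
def homTo (α : Ordinal.{v}) (c : C) : (S.Below deg α)ᵒᵖ ⥤ ModuleCat.{v} k where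
  obj d := ModuleCat.of k (S.hom d.unop.obj c)
  map {_ d'} f := ModuleCat.ofHom
    { toFun := fun w => (⟨f.unop.1 ≫ w.1, S.comp_mem f.unop.2 w.2⟩ : S.hom d'.unop.obj c)
      map_add' := fun w w' => Subtype.ext (Preadditive.comp_add _ _ _ f.unop.1 w.1 w'.1)
      map_smul' := fun a w => Subtype.ext (Linear.comp_smul _ _ _ f.unop.1 a w.1) }
  map_id _ :=
    ModuleCat.hom_ext (LinearMap.ext fun w => Subtype.ext (Category.id_comp w.1))
  map_comp f g :=
    ModuleCat.hom_ext (LinearMap.ext fun w => Subtype.ext (Category.assoc g.unop.1 f.unop.1 w.1))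

/-- The weight `S(c, -)` on `S_{<α}`. -/
def homFrom (α : Ordinal.{v}) (c : C) : S.Below deg α ⥤ ModuleCat.{v} k where
  obj d := ModuleCat.of k (S.hom c d.obj)
  map {_ d'} f := ModuleCat.ofHom
    { toFun := fun x => (⟨x.1 ≫ f.1, S.comp_mem x.2 f.2⟩ : S.hom c d'.obj)
      map_add' := fun x x' => Subtype.ext (Preadditive.add_comp _ _ _ x.1 x'.1 f.1)
      map_smul' := fun a x => Subtype.ext (Linear.smul_comp _ _ _ a x.1 f.1) }
  map_id _ :=
    ModuleCat.hom_ext (LinearMap.ext fun x => Subtype.ext (Category.comp_id x.1))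
  map_comp f g :=
    ModuleCat.hom_ext (LinearMap.ext fun x => Subtype.ext (Category.assoc x.1 f.1 g.1).symm)

end WideLinearSubcategory

open Classical in
/-- The map `⨁_e P(e, d) ⊗_k N(c, e) → C(c, d)`, `p ⊗ n ↦ p ∘ n`, induced by composition. -/
def compositionMap (P N : WideLinearSubcategory k C) (c d : C) :
    (DirectSum C fun e => P.hom e d ⊗[k] N.hom c e) →ₗ[k] (c ⟶ d) :=
  DirectSum.toModule k C (c ⟶ d) fun e => TensorProduct.lift
    (((Linear.comp (S := k) c e d).flip.domRestrict (P.hom e d)).compl₂ (N.hom c e).subtype)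

variable (k C) in
/-- The structure of a `k`-linear Reedy category on `C`: a degree function with values in the
ordinals (its values are bounded by some ordinal, since `C` is small), a direct subcategory `C^+`
and an inverse subcategory `C^-` with respect to it, such that every morphism has a Reedy
factorisation, unique in the sense that composition gives isomorphisms
`⨁_e C^+(e, d) ⊗_k C^-(c, e) ≅ C(c, d)`. -/
structure ReedyStructure where
  deg : C → Ordinal.{v}
  plus : WideLinearSubcategory k C
  minus : WideLinearSubcategory k C
  plus_direct : plus.IsDirect deg
  minus_inverse : minus.IsInverse deg
  bijective_compositionMap (c d : C) : Function.Bijective (compositionMap plus minus c d)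

namespace ReedyStructure

variable (R : ReedyStructure k C) {M : Type u} [Category.{v} M] [Abelian M] [Linear k M]

section Latching

variable [HasColimits M] (X : LinFun k C M) (c : C)

/-- The latching object `L_c X = C^+(-, c) ⊗_{C^+_{<deg c}} X` of `X` at `c`. -/
def latchingObj : M :=
  weightedColimit (R.plus.homTo R.deg (R.deg c) c) (R.plus.incl R.deg (R.deg c) ⋙ X.obj)

/-- The latching morphism `L_c X ⟶ X c`, `φ ⊗ x ↦ X(φ)(x)`. -/
def latchingMap : R.latchingObj X c ⟶ X.obj.obj c :=
  weightedColimit.desc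
    (fun d =>
      { toFun := fun w : R.plus.hom d.obj c => X.obj.map w.1
        map_add' := fun w w' => by
          have := X.property.1
          exact X.obj.map_add
        map_smul' := fun a w => by
          have := X.property.2
          exact X.obj.map_smul a w.1 })
    (fun f w => X.obj.map_comp f.1 w.1)

end Latching

section Matching

variable [HasLimits M] (X : LinFun k C M) (c : C)

/-- The matching object `M_c X = hom_{C^-_{<deg c}}(C^-(c, -), X)` of `X` at `c`. -/
def matchingObj : M :=
  weightedLimit (R.minus.homFrom R.deg (R.deg c) c) (R.minus.incl R.deg (R.deg c) ⋙ X.obj)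

/-- The matching morphism `X c ⟶ M_c X`, `x ↦ (φ ↦ X(φ)(x))`. -/
def matchingMap : X.obj.obj c ⟶ R.matchingObj X c :=
  weightedLimit.lift
    (fun d =>
      { toFun := fun w : R.minus.hom c d.obj => X.obj.map w.1
        map_add' := fun w w' => by
          have := X.property.1
          exact X.obj.map_add
        map_smul' := fun a w => by
          have := X.property.2
          exact X.obj.map_smul a w.1 })
    (fun f w => X.obj.map_comp w.1 f.1)

end Matching

/-- `Φ(S)`: all latching morphisms are monomorphisms with cokernel in `S`. -/
def Phi [HasColimits M] (S : ObjectProperty M) : ObjectProperty (LinFun k C M) :=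
  fun X => ∀ c : C, Mono (R.latchingMap X c) ∧ S (cokernel (R.latchingMap X c))

/-- `Ψ(S)`: all matching morphisms are epimorphisms with kernel in `S`. -/
def Psi [HasLimits M] (S : ObjectProperty M) : ObjectProperty (LinFun k C M) :=
  fun X => ∀ c : C, Epi (R.matchingMap X c) ∧ S (kernel (R.matchingMap X c))

end ReedyStructure

variable (k C) in
/-- `S^C`: the `k`-linear functors all of whose values lie in `S`. -/
def pointwise {M : Type u} [Category.{v} M] [Abelian M] [Linear k M] (S : ObjectProperty M) :
    ObjectProperty (LinFun k C M) :=
  fun X => ∀ c : C, S (X.obj.obj c)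

end Reedy

/-! ## Cotorsion pairs, abelian model structures and Hovey triples -/

section Hovey

universe u' v'

variable {M : Type u'} [Category.{v'} M] [Abelian M]

/-- `Ext^n(X, Y) = 0`. -/
def ExtVanishes (X Y : M) (n : ℕ) : Prop :=
  haveI := HasExt.standard M
  Subsingleton (Abelian.Ext X Y n)

/-- `(X, Y)` is a cotorsion pair: each class is the `Ext^1`-orthogonal of the other. -/
structure IsCotorsionPair (X Y : ObjectProperty M) : Prop where
  left (A : M) : X A ↔ ∀ B, Y B → ExtVanishes A B 1
  right (B : M) : Y B ↔ ∀ A, X A → ExtVanishes A B 1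

/-- A complete cotorsion pair: every object has the two approximation sequences
`0 ⟶ A ⟶ Y₁ ⟶ X₁ ⟶ 0` and `0 ⟶ Y₂ ⟶ X₂ ⟶ A ⟶ 0`. -/
structure IsCompleteCotorsionPair (X Y : ObjectProperty M) : Prop extends
    IsCotorsionPair X Y where
  exists_right (A : M) : ∃ (Y₁ X₁ : M) (i : A ⟶ Y₁) (p : Y₁ ⟶ X₁) (w : i ≫ p = 0),
    (ShortComplex.mk i p w).ShortExact ∧ Y Y₁ ∧ X X₁
  exists_left (A : M) : ∃ (Y₂ X₂ : M) (i : Y₂ ⟶ X₂) (p : X₂ ⟶ A) (w : i ≫ p = 0),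
    (ShortComplex.mk i p w).ShortExact ∧ Y Y₂ ∧ X X₂

/-- A hereditary complete cotorsion pair. -/
structure IsHereditaryCompleteCotorsionPair (X Y : ObjectProperty M) : Prop extends
    IsCompleteCotorsionPair X Y where
  ext_vanishes (A B : M) : X A → Y B → ∀ n : ℕ, 1 ≤ n → ExtVanishes A B n

/-- The condition for a weak factorisation system `(L, R)` in an abelian category to be abelian. -/
structure IsAbelianWFS (L R : MorphismProperty M) : Prop where
  left {A B : M} (f : A ⟶ B) : L f ↔ Mono f ∧ L (0 : (0 : M) ⟶ cokernel f)
  right {A B : M} (g : A ⟶ B) : R g ↔ Epi g ∧ R (0 : kernel g ⟶ (0 : M))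

open HomotopicalAlgebra in
/-- `(A, W, B)` is a Hovey triple on the bicomplete abelian category `M`: there is an abelian model
structure on `M` of which `A`, `W`, `B` are the classes of cofibrant, of weakly trivial and of
fibrant objects. -/
def IsHoveyTriple [HasLimits M] [HasColimits M] (A W B : ObjectProperty M) : Prop :=
  ∃ _ : ModelCategory M,
    IsAbelianWFS (trivialCofibrations M) (fibrations M) ∧
    IsAbelianWFS (cofibrations M) (trivialFibrations M) ∧
    (∀ X : M, A X ↔ cofibrations M (0 : (0 : M) ⟶ X)) ∧
    (∀ X : M, W X ↔ weakEquivalences M (0 : (0 : M) ⟶ X)) ∧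
    (∀ X : M, B X ↔ fibrations M (0 : X ⟶ (0 : M)))

/-- A Hovey triple is hereditary if the two associated complete cotorsion pairs are hereditary. -/
structure IsHereditaryHoveyTriple [HasLimits M] [HasColimits M] (A W B : ObjectProperty M) :
    Prop where
  isHoveyTriple : IsHoveyTriple A W B
  cofibrant_pair : IsHereditaryCompleteCotorsionPair A (W ⊓ B)
  fibrant_pair : IsHereditaryCompleteCotorsionPair (A ⊓ W) B

end Hovey

end LinearReedy

end

/-!
# Hereditary Hovey triples on linear functors from a linear Reedy category

Let `(A, B)` be a complete cotorsion pair in `M`. The core of the proof is that `(Φ(A), Ψ(B))` is a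
complete cotorsion pair in the category of linear functors, hereditary if `(A, B)` is. The Hovey
triple then consists of two such pairs, glued along the pointwise weak equivalences.

*Orthogonality.* An extension of `X` in `Φ(A)` by `Y` in `Ψ(B)` is split by induction on the degree:
a splitting in lower degrees induces a lifting problem of the latching map of `X` against the
relative matching map of the extension, and the obstruction lies in the group
`Ext¹(coker l_c, ker m_c)`, which is zero (`ReedyStructure.extVanishes_of_latching_of_matching`).

*The left class.* For a direct summand `V` of `C(-, c)` made of Reedy components, the functor
`d ↦ Hom_k(V(d), N)` has split matching maps, so it lies in `Ψ(B)` if `N` is in `B`. For `V = C(-, c)`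
maps from `X` to it are maps `X c ⟶ N`; for the part `V` of the morphisms through objects of lower
degree they are maps from the latching object `L_c X` to `N`; and the kernel of the restriction from
the first to the second lies in `Ψ(B)` as well. Testing `Ext¹(X, -) = 0` on these three functors
shows that `X c` is in `A` and that maps `L_c X ⟶ N` extend to `X c`, which says that `X` lies in
`Φ(A)` (`ReedyStructure.phi_of_extVanishes`). The same adjunctions show that `Φ(A)` is closed under
kernels of epimorphisms in the hereditary case (`ReedyStructure.phi_kernel`).

*Completeness.* Given `Z` and an object `c`, factor the matching map as `Z c ⟶ N ⟶ M_c Z`, a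
monomorphism with cokernel in `A` followed by an epimorphism with kernel in `B`, and attach
`C(c, -) ⊗ N` to `Z` along `C(c, -) ⊗ Z c` and the lower part of `C(c, -) ⊗ N`. This replaces the
matching map at `c` by `N ⟶ M_c Z`, leaves the other values of degree at most `deg c` unchanged, and
has the left lifting property against the epimorphisms with kernel in `Ψ(B)`
(`ReedyStructure.exists_attach`). A transfinite iteration over the objects, well-ordered by degree,
embeds `Z` into a functor in `Ψ(B)` with cokernel in `Φ(A)` (`ReedyStructure.exists_psi`,
`ReedyStructure.exists_right`); the other approximation follows by Salce's argument
(`ReedyStructure.isCompleteCotorsionPair`).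

*The Hovey triple.* For `(A, W, B)` a Hovey triple, induction on the degree shows that the latching
objects of a functor in `Φ(A)` with values in `W` are in `A ∩ W`, whence
`Φ(A) ∩ W^C = Φ(A ∩ W)`. Applied to the cokernel of an embedding into `Ψ(W ∩ B)`, this gives
`W^C ∩ Ψ(B) = Ψ(W ∩ B)` (`ReedyStructure.phi_inf_eq`, `ReedyStructure.psi_inf_eq`).
-/

set_option linter.unusedSectionVars false

noncomputable section

namespace LinearReedy

/-! ### Effaceability of extension groups -/

section Effaceable
universe v' u' w
variable {D : Type u'} [Category.{v'} D] [Abelian D]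

open HomologicalComplex in
/-- A complex in nonpositive degrees with a map to `X[0]` that is a quasi-isomorphism in degree `0`
admits a lift of an epimorphism onto `X`: its degree `0` part maps onto its homology. -/
lemma exists_epi_lift_of_quasiIso {X : D} {K : CochainComplex D ℤ}
    (π : K ⟶ (single D (ComplexShape.up ℤ) 0).obj X) [K.IsStrictlyLE 0] (hπ : QuasiIsoAt π 0) :
    ∃ (P : D) (p : P ⟶ X) (j : (single D (ComplexShape.up ℤ) 0).obj P ⟶ K),
      Epi p ∧ j ≫ π = (single D (ComplexShape.up ℤ) 0).map p := by
  let S := single D (ComplexShape.up ℤ) 0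
  let j : S.obj (K.X 0) ⟶ K := mkHomFromSingle (𝟙 _) (by
      rintro _ rfl
      apply (K.isZero_of_isStrictlyLE 0 (0 + 1) (by simp)).eq_of_tgt)
  obtain ⟨p, hp⟩ := S.map_surjective (j ≫ π)
  refine ⟨K.X 0, p, j, ?_, hp.symm⟩
  have hi : IsIso (K.iCycles 0) := K.isIso_iCycles 0 (0 + 1) (by simp)
    ((K.isZero_of_isStrictlyLE 0 (0 + 1) (by simp)).eq_of_tgt _ _)
  have hi' : IsIso ((S.obj (K.X 0)).iCycles 0) := isIso_iCycles _ 0 (0 + 1) (by simp) (by simp [S])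
  have hj : IsIso (j.f 0) := by
    simp only [j, mkHomFromSingle_f]
    infer_instance
  have hc : IsIso (cyclesMap j 0) := by
    have : IsIso (cyclesMap j 0 ≫ K.iCycles 0) := by
      rw [cyclesMap_i]; infer_instance
    exact IsIso.of_isIso_comp_right _ (K.iCycles 0)
  have he : Epi (homologyMap j 0) := by
    have : Epi ((S.obj (K.X 0)).homologyπ 0 ≫ homologyMap j 0) := by
      rw [homologyπ_naturality]; infer_instance
    exact epi_of_epi ((S.obj (K.X 0)).homologyπ 0) _
  have h1 : Epi (homologyMap (S.map p) 0) := by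
    rw [hp, homologyMap_comp]; infer_instance
  have h2 := (homologyFunctorSingleIso D (ComplexShape.up ℤ) 0).hom.naturality p
  have h3 : Epi (((homologyFunctorSingleIso D (ComplexShape.up ℤ) 0).hom.app (K.X 0)) ≫ p) := by
    change _ = _ ≫ p at h2
    rw [← h2]
    exact epi_comp' h1 inferInstance
  exact epi_of_epi ((homologyFunctorSingleIso D (ComplexShape.up ℤ) 0).hom.app (K.X 0)) _

open DerivedCategory in
/-- Every class in a positive `Ext`-group is killed by pulling it back along some epimorphism: the
class is represented by a roof `X[0] ← K → Y[n + 1]` with `K` in nonpositive degrees, and the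
restriction of `K → Y[n + 1]` to the degree `0` part of `K` vanishes. -/
lemma exists_epi_mk₀_comp_eq_zero [HasExt.{w} D] {X Y : D} {n : ℕ} (e : Abelian.Ext X Y (n + 1)) :
    ∃ (P : D) (p : P ⟶ X), Epi p ∧ (Abelian.Ext.mk₀ p).comp e (zero_add _) = 0 := by
  let := HasDerivedCategory.standard D
  let σ := ((singleFunctors D).shiftIso (n + 1) (-(n + 1)) 0 (by lia)).hom.app Y
  obtain ⟨K, _, π, h, g, hg⟩ := right_fac_of_isStrictlyLE
    (X := (CochainComplex.singleFunctor D 0).obj X)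
    (Y := (CochainComplex.singleFunctor D (-(n + 1))).obj Y) (e.hom ≫ σ) 0
  rw [isIso_Q_map_iff_quasiIso] at h
  have h0 : QuasiIsoAt π 0 := h.quasiIsoAt 0
  obtain ⟨P, p, j, hp, hj⟩ : ∃ (P : D) (p : P ⟶ X)
      (j : (CochainComplex.singleFunctor D 0).obj P ⟶ K),
      Epi p ∧ j ≫ π = (CochainComplex.singleFunctor D 0).map p :=
    exists_epi_lift_of_quasiIso (X := X) (hπ := h0) π
  refine ⟨P, p, hp, ?_⟩
  have hz : j ≫ g = 0 := by
    apply HomologicalComplex.from_single_hom_ext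
    apply (CochainComplex.isZero_of_isStrictlyLE _ (-(n + 1) : ℤ) 0 (by lia)).eq_of_tgt
  apply Abelian.Ext.ext
  rw [Abelian.Ext.comp_hom, Abelian.Ext.mk₀_hom, ShiftedHom.mk₀_comp, Abelian.Ext.zero_hom]
  refine (cancel_mono σ).1 ?_
  rw [Category.assoc]
  refine (congr_arg _ hg).trans ?_
  have hp' : Q.map ((CochainComplex.singleFunctor D 0).map p) ≫ inv (Q.map π) ≫ Q.map g = 0 := by
    rw [← hj, Q.map_comp, Category.assoc, IsIso.hom_inv_id_assoc, ← Q.map_comp, hz, Q.map_zero]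
  exact hp'.trans zero_comp.symm

end Effaceable

/-! ### Vanishing of extension groups -/

section Ext

universe v' u'
variable {D : Type u'} [Category.{v'} D] [Abelian D]

attribute [local instance] HasExt.standard

open Abelian
open Abelian.Ext hiding comp_zero zero_comp

lemma ExtVanishes.eq_zero {X Y : D} {n : ℕ} (h : ExtVanishes X Y n) (e : Ext X Y n) : e = 0 :=
  Subsingleton.elim (h := h) _ _

lemma ExtVanishes.of_forall {X Y : D} {n : ℕ} (h : ∀ e : Ext X Y n, e = 0) : ExtVanishes X Y n :=
  subsingleton_of_forall_eq 0 h

lemma ExtVanishes.of_retract_left {X X' Y : D} {n : ℕ} (h : ExtVanishes X' Y n) (i : X ⟶ X')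
    (r : X' ⟶ X) (hir : i ≫ r = 𝟙 X) : ExtVanishes X Y n :=
  .of_forall fun e => by
    have := congr_arg (fun z => (mk₀ i).comp z (zero_add n))
      (h.eq_zero ((mk₀ r).comp e (zero_add n)))
    simpa [hir] using this

lemma ExtVanishes.of_retract_right {X Y Y' : D} {n : ℕ} (h : ExtVanishes X Y' n) (i : Y ⟶ Y')
    (r : Y' ⟶ Y) (hir : i ≫ r = 𝟙 Y) : ExtVanishes X Y n :=
  .of_forall fun e => by
    have := congr_arg (fun z => z.comp (mk₀ r) (add_zero n))
      (h.eq_zero (e.comp (mk₀ i) (add_zero n)))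
    simpa [hir] using this

variable {S : ShortComplex D}

lemma ExtVanishes.middle_left (hS : S.ShortExact) {N : D} {n : ℕ} (h₁ : ExtVanishes S.X₁ N n)
    (h₃ : ExtVanishes S.X₃ N n) : ExtVanishes S.X₂ N n :=
  .of_forall fun e => by
    obtain ⟨y, rfl⟩ := contravariant_sequence_exact₂ hS N e (h₁.eq_zero _)
    rw [h₃.eq_zero y, Ext.comp_zero]

lemma ExtVanishes.first_left (hS : S.ShortExact) {N : D} {n : ℕ} (h₂ : ExtVanishes S.X₂ N n)
    (h₃ : ExtVanishes S.X₃ N (1 + n)) : ExtVanishes S.X₁ N n :=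
  .of_forall fun e => by
    obtain ⟨y, rfl⟩ := contravariant_sequence_exact₁ hS N e rfl (h₃.eq_zero _)
    rw [h₂.eq_zero y, Ext.comp_zero]

/-- If `Ext¹(X₃, N) = 0`, then maps `X₁ ⟶ N` extend along `X₁ ⟶ X₂`. -/
lemma ExtVanishes.exists_extension (hS : S.ShortExact) {N : D} (h : ExtVanishes S.X₃ N 1)
    (φ : S.X₁ ⟶ N) : ∃ ψ : S.X₂ ⟶ N, S.f ≫ ψ = φ := by
  obtain ⟨y, hy⟩ := contravariant_sequence_exact₁ hS N (mk₀ φ) (add_zero 1) (h.eq_zero _)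
  obtain ⟨ψ, rfl⟩ := (mk₀_bijective _ _).2 y
  exact ⟨ψ, (mk₀_bijective _ _).1 (by simpa using hy)⟩

/-- If `Ext¹(N, X₁) = 0`, then maps `N ⟶ X₃` lift to `X₂`. -/
lemma ExtVanishes.exists_lift (hS : S.ShortExact) {N : D} (h : ExtVanishes N S.X₁ 1)
    (φ : N ⟶ S.X₃) : ∃ ψ : N ⟶ S.X₂, ψ ≫ S.g = φ := by
  obtain ⟨y, hy⟩ := covariant_sequence_exact₃ N hS (mk₀ φ) (zero_add 1) (h.eq_zero _)
  obtain ⟨ψ, rfl⟩ := (mk₀_bijective _ _).2 y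
  exact ⟨ψ, (mk₀_bijective _ _).1 (by simpa using hy)⟩

/-- If `Ext¹(X₂, N) = 0` and all maps `X₁ ⟶ N` extend to `X₂`, then `Ext¹(X₃, N) = 0`. -/
lemma ExtVanishes.of_extension (hS : S.ShortExact) {N : D} (h : ExtVanishes S.X₂ N 1)
    (hφ : ∀ φ : S.X₁ ⟶ N, ∃ ψ : S.X₂ ⟶ N, S.f ≫ ψ = φ) : ExtVanishes S.X₃ N 1 :=
  .of_forall fun e => by
    obtain ⟨y, rfl⟩ := contravariant_sequence_exact₃ hS N e (h.eq_zero _) (add_zero 1)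
    obtain ⟨φ, rfl⟩ := (mk₀_bijective _ _).2 y
    obtain ⟨ψ, rfl⟩ := hφ φ
    rw [← mk₀_comp_mk₀, ShortComplex.ShortExact.extClass_comp_assoc]

/-- The pushout of a short exact sequence along a map out of its first term. -/
lemma exists_pushout_shortExact (hS : S.ShortExact) {Y : D} (φ : S.X₁ ⟶ Y) :
    ∃ (E : D) (i : Y ⟶ E) (p : E ⟶ S.X₃) (u : S.X₂ ⟶ E) (w : i ≫ p = 0),
      (ShortComplex.mk i p w).ShortExact ∧ IsPushout S.f φ u i ∧ u ≫ p = S.g := by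
  have := hS.mono_f
  have := hS.epi_g
  have sq := IsPushout.of_hasPushout S.f φ
  let p : pushout S.f φ ⟶ S.X₃ := pushout.desc S.g 0 (by simp)
  have hp : pushout.inl S.f φ ≫ p = S.g := pushout.inl_desc _ _ _
  have hw : pushout.inr S.f φ ≫ p = 0 := pushout.inr_desc _ _ _
  refine ⟨_, pushout.inr _ _, p, pushout.inl _ _, hw, ?_, sq, hp⟩
  have : Epi p := epi_of_epi_fac hp
  refine { exact := ?_, mono_f := inferInstanceAs (Mono (pushout.inr _ _)), epi_g := this }
  refine ShortComplex.exact_of_g_is_cokernel _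
    (CokernelCofork.IsColimit.ofπ' _ _ fun {A} k hk => ?_)
  have hk' : pushout.inr S.f φ ≫ k = 0 := hk
  refine ⟨hS.exact.desc (pushout.inl S.f φ ≫ k) ?_, ?_⟩
  · rw [pushout.condition_assoc, hk', comp_zero]
  · refine pushout.hom_ext ?_ ?_
    · rw [← Category.assoc]
      change (_ ≫ p) ≫ _ = _
      rw [hp, hS.exact.g_desc]
    · rw [← Category.assoc]
      change (_ ≫ p) ≫ _ = _
      rw [hw, zero_comp, hk']

/-- `Ext¹(X, Y)` vanishes if and only if all the extensions of `X` by `Y` split. -/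
lemma extVanishes_one_iff {X Y : D} : ExtVanishes X Y 1 ↔
    ∀ (E : D) (i : Y ⟶ E) (p : E ⟶ X) (w : i ≫ p = 0), (ShortComplex.mk i p w).ShortExact →
      ∃ s : X ⟶ E, s ≫ p = 𝟙 X := by
  refine ⟨fun h E i p w hS => h.exists_lift hS (𝟙 X), fun h => .of_forall fun e => ?_⟩
  -- a class killed by an epimorphism `p` is the pushout of the extension `p` along a map `φ`
  obtain ⟨P, p, hp, he⟩ := exists_epi_mk₀_comp_eq_zero e
  have hT : (ShortComplex.mk (kernel.ι p) p (kernel.condition p)).ShortExact :=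
    { exact := ShortComplex.exact_of_f_is_kernel _ (kernelIsKernel p) }
  obtain ⟨y, rfl⟩ := contravariant_sequence_exact₃ hT Y e he (add_zero 1)
  obtain ⟨φ, rfl⟩ := (mk₀_bijective _ _).2 y
  obtain ⟨E, i, q, u, w, hS', sq, hu⟩ := exists_pushout_shortExact hT φ
  obtain ⟨s, hs⟩ := h E i q w hS'
  let f : ShortComplex.mk (kernel.ι p) p (kernel.condition p) ⟶ ShortComplex.mk i q w :=
    { τ₁ := φ, τ₂ := u, τ₃ := 𝟙 X, comm₁₂ := sq.w.symm, comm₂₃ := by simpa using hu }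
  have := ShortComplex.ShortExact.extClass_naturality hT hS' f
  change _ = (mk₀ (𝟙 X)).comp hS'.extClass _ at this
  refine this.trans ?_
  rw [← hs, ← mk₀_comp_mk₀, comp_assoc_of_second_deg_zero, hS'.comp_extClass, Ext.comp_zero]

lemma shortExact_cokernel {X Y : D} (f : X ⟶ Y) [Mono f] :
    (ShortComplex.mk f (cokernel.π f) (cokernel.condition f)).ShortExact where
  exact := ShortComplex.exact_of_g_is_cokernel _ (cokernelIsCokernel f)

lemma shortExact_kernel {X Y : D} (f : X ⟶ Y) [Epi f] :
    (ShortComplex.mk (kernel.ι f) f (kernel.condition f)).ShortExact where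
  exact := ShortComplex.exact_of_f_is_kernel _ (kernelIsKernel f)

/-- A monomorphism lifts against an epimorphism if `Ext¹(coker, ker)` vanishes. -/
lemma ExtVanishes.hasLiftingProperty {A B E X : D} (i : A ⟶ B) (q : E ⟶ X) [Mono i] [Epi q]
    (h : ExtVanishes (cokernel i) (kernel q) 1) : HasLiftingProperty i q where
  sq_hasLift {f g} sq := by
    have hi := shortExact_cokernel i
    have hq := shortExact_kernel q
    -- the obstruction to lifting `g` comes from `Ext¹(coker i, ker q)`
    have hz : (mk₀ g).comp hq.extClass (zero_add 1) = 0 := by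
      obtain ⟨y, hy⟩ := contravariant_sequence_exact₂ hi _
        ((mk₀ g).comp hq.extClass (zero_add 1)) (by
          change (mk₀ i).comp _ _ = _
          rw [mk₀_comp_mk₀_assoc, ← sq.w, ← mk₀_comp_mk₀, comp_assoc_of_second_deg_zero]
          erw [hq.comp_extClass]
          rw [Ext.comp_zero])
      rw [← hy, h.eq_zero y, Ext.comp_zero]
    obtain ⟨y, hy⟩ := covariant_sequence_exact₃ _ hq (mk₀ g) (zero_add 1) hz
    obtain ⟨t, rfl⟩ := (mk₀_bijective _ _).2 y
    have ht : t ≫ q = g := (mk₀_bijective _ _).1 (by simpa using hy)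
    obtain ⟨b, hb⟩ := h.exists_extension hi (kernel.lift q (i ≫ t - f) (by
      rw [Preadditive.sub_comp, Category.assoc, ht, sq.w, sub_self]))
    refine ⟨⟨⟨t - b ≫ kernel.ι q, ?_, ?_⟩⟩⟩
    · have hb' : i ≫ b = _ := hb
      rw [Preadditive.comp_sub, ← Category.assoc i b, hb', kernel.lift_ι, sub_sub_cancel]
    · rw [Preadditive.sub_comp, Category.assoc, kernel.condition, comp_zero, sub_zero, ht]

end Ext

/-! ### Cotorsion pairs and weak factorisation systems -/

section Cotorsion

universe v' u'
variable {D : Type u'} [Category.{v'} D] [Abelian D]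

/-- The monomorphisms with cokernel in `X`. -/
def monoWith (X : ObjectProperty D) : MorphismProperty D := fun _ _ f => Mono f ∧ X (cokernel f)

/-- The epimorphisms with kernel in `Y`. -/
def epiWith (Y : ObjectProperty D) : MorphismProperty D := fun _ _ f => Epi f ∧ Y (kernel f)

variable {X Y : ObjectProperty D}

namespace IsCotorsionPair

variable (h : IsCotorsionPair X Y)
include h

lemma left_of_retract {A A' : D} (hA : X A') (i : A ⟶ A') (r : A' ⟶ A) (hir : i ≫ r = 𝟙 A) :
    X A :=
  (h.left A).2 fun B hB => ((h.left A').1 hA B hB).of_retract_left i r hir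

lemma right_of_retract {B B' : D} (hB : Y B') (i : B ⟶ B') (r : B' ⟶ B) (hir : i ≫ r = 𝟙 B) :
    Y B :=
  (h.right B).2 fun A hA => ((h.right B').1 hB A hA).of_retract_right i r hir

lemma left_of_iso {A A' : D} (hA : X A') (e : A ≅ A') : X A :=
  h.left_of_retract hA e.hom e.inv e.hom_inv_id

lemma right_of_iso {B B' : D} (hB : Y B') (e : B ≅ B') : Y B :=
  h.right_of_retract hB e.hom e.inv e.hom_inv_id

lemma right_of_isZero {B : D} (hB : IsZero B) : Y B :=
  (h.right B).2 fun _ _ => extVanishes_one_iff.2 fun _ i p _ hS => by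
    have := hS.epi_g
    have : IsIso p := by
      have : Mono p := hS.exact.mono_g (hB.eq_of_src _ _)
      exact isIso_of_mono_of_epi p
    exact ⟨inv p, by simp⟩

lemma monoWith_of_shortExact {S : ShortComplex D} (hS : S.ShortExact) (h₃ : X S.X₃) :
    monoWith X S.f :=
  ⟨hS.mono_f, h.left_of_iso h₃
    ((cokernelIsCokernel S.f).coconePointUniqueUpToIso hS.gIsCokernel)⟩

lemma epiWith_of_shortExact {S : ShortComplex D} (hS : S.ShortExact) (h₁ : Y S.X₁) :
    epiWith Y S.g :=
  ⟨hS.epi_g, h.right_of_iso h₁ ((kernelIsKernel S.g).conePointUniqueUpToIso hS.fIsKernel)⟩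

lemma hasLiftingProperty {A B E Z : D} {i : A ⟶ B} {q : E ⟶ Z} (hi : monoWith X i)
    (hq : epiWith Y q) : HasLiftingProperty i q := by
  have := hi.1
  have := hq.1
  exact ((h.left _).1 hi.2 _ hq.2).hasLiftingProperty i q

lemma monoWith_zero_iff {K Z : D} (hZ : IsZero Z) (f : Z ⟶ K) : monoWith X f ↔ X K := by
  have hf : f = 0 := hZ.eq_of_src _ _
  subst hf
  refine ⟨fun hK => h.left_of_iso hK.2 cokernelZeroIsoTarget.symm, fun hK =>
    ⟨⟨fun _ _ _ => hZ.eq_of_tgt _ _⟩, h.left_of_iso hK cokernelZeroIsoTarget⟩⟩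

lemma epiWith_zero_iff {K Z : D} (hZ : IsZero Z) (f : K ⟶ Z) : epiWith Y f ↔ Y K := by
  have hf : f = 0 := hZ.eq_of_tgt _ _
  subst hf
  refine ⟨fun hK => h.right_of_iso hK.2 kernelZeroIsoSource.symm, fun hK =>
    ⟨⟨fun _ _ _ => hZ.eq_of_src _ _⟩, h.right_of_iso hK kernelZeroIsoSource⟩⟩

end IsCotorsionPair

/-- An object `K` such that `0 ⟶ K` lifts against all epimorphisms with kernel in `Y` has no
nontrivial extensions by objects of `Y`. -/
lemma extVanishes_of_llp {Z K N : D} (hZ : IsZero Z) {f : Z ⟶ K}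
    (hiso : ∀ {B B' : D}, Y B' → (B ≅ B') → Y B)
    (hf : (epiWith Y).llp f) (hN : Y N) : ExtVanishes K N 1 :=
  extVanishes_one_iff.2 fun E i p w hS => by
    have := hf p ⟨hS.epi_g, hiso hN
      ((kernelIsKernel p).conePointUniqueUpToIso hS.fIsKernel)⟩
    have sq : CommSq (0 : Z ⟶ E) f p (𝟙 K) := ⟨hZ.eq_of_src _ _⟩
    exact ⟨sq.lift, sq.fac_right⟩

/-- The zero map to the cokernel is a pushout of the map itself. -/
lemma isPushout_cokernel {A B : D} (f : A ⟶ B) :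
    IsPushout f (0 : A ⟶ (0 : D)) (cokernel.π f) (0 : (0 : D) ⟶ cokernel f) :=
  .of_isColimit (c := PushoutCocone.mk (cokernel.π f) (0 : (0 : D) ⟶ cokernel f) (by simp)) <|
    PushoutCocone.IsColimit.mk _
      (fun s => cokernel.desc f s.inl (by rw [s.condition, (isZero_zero D).eq_of_src s.inr 0,
        comp_zero]))
      (by simp) (fun s => (isZero_zero D).eq_of_src _ _)
      (fun s m hm _ => by rw [← cancel_epi (cokernel.π f)]; simpa using hm)

namespace IsCompleteCotorsionPair

variable (h : IsCompleteCotorsionPair X Y)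
include h

/-- Every object embeds into an object of the right class. -/
lemma exists_mono (A : D) : ∃ (N : D) (i : A ⟶ N), Mono i ∧ Y N := by
  obtain ⟨Y₁, X₁, i, p, w, hS, hY, -⟩ := h.exists_right A
  exact ⟨Y₁, i, hS.mono_f, hY⟩

/-- An object `K` lies in the left class if `0 ⟶ K` is a pushout of a map with the left lifting
property, and such a map is a monomorphism because its source embeds into an object of the right
class. -/
lemma llp_epiWith : (epiWith Y).llp = monoWith X := by
  ext A B f
  refine ⟨fun hf => ?_, fun hf E Z q hq => h.hasLiftingProperty hf hq⟩
  refine ⟨?_, ?_⟩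
  · obtain ⟨N, i, hi, hN⟩ := h.exists_mono A
    have := hf (0 : N ⟶ (0 : D)) ((h.epiWith_zero_iff (isZero_zero D) _).2 hN)
    have sq : CommSq i f (0 : N ⟶ (0 : D)) 0 := ⟨by simp⟩
    exact mono_of_mono_fac sq.fac_left
  · have hf' : (epiWith Y).llp (0 : (0 : D) ⟶ cokernel f) :=
      MorphismProperty.of_isPushout (isPushout_cokernel f).flip hf
    exact (h.left _).2 fun N hN => extVanishes_of_llp (isZero_zero D)
      (fun hB e => h.right_of_iso hB e) hf' hN

lemma rlp_monoWith : (monoWith X).rlp = epiWith Y := by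
  ext E Z q
  refine ⟨fun hq => ?_, fun hq A B f hf => h.hasLiftingProperty hf hq⟩
  refine ⟨?_, ?_⟩
  · obtain ⟨Y₂, X₂, i, p, w, hS, -, hX⟩ := h.exists_left Z
    have := hq (0 : (0 : D) ⟶ X₂) ((h.monoWith_zero_iff (isZero_zero D) _).2 hX)
    have sq : CommSq 0 (0 : (0 : D) ⟶ X₂) q p := ⟨by simp⟩
    have := hS.epi_g
    have hp : Epi p := this
    exact epi_of_epi_fac sq.fac_right
  · refine (h.right _).2 fun A hA => extVanishes_one_iff.2 fun F i p w hS => ?_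
    have := hq i (h.monoWith_of_shortExact hS hA)
    have sq : CommSq (kernel.ι q) i q 0 := ⟨by simp⟩
    let r : F ⟶ kernel q := kernel.lift q sq.lift sq.fac_right
    have hr : i ≫ r = 𝟙 _ := by
      rw [← cancel_mono (kernel.ι q), Category.assoc, kernel.lift_ι, sq.fac_left, Category.id_comp]
    exact ⟨(ShortComplex.Splitting.ofExactOfRetraction _ hS.exact r hr hS.epi_g).s,
      (ShortComplex.Splitting.ofExactOfRetraction _ hS.exact r hr hS.epi_g).s_g⟩

/-- The weak factorisation system attached to a complete cotorsion pair. A map `A ⟶ B` is first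
replaced by an epimorphism `A ⊞ P ⟶ B` with `P` in the left class, whose kernel is then enlarged
to an object of the right class. -/
lemma isWeakFactorizationSystem :
    MorphismProperty.IsWeakFactorizationSystem (monoWith X) (epiWith Y) where
  rlp := h.rlp_monoWith
  llp := h.llp_epiWith
  hasFactorization := ⟨fun {A B} f => by
    obtain ⟨_, P, _, p, _, hP, -, hXP⟩ := h.exists_left B
    have hp : Epi p := hP.epi_g
    let q : A ⊞ P ⟶ B := biprod.desc f p
    have : Epi q := epi_of_epi_fac (biprod.inr_desc f p)
    have hq := shortExact_kernel q
    obtain ⟨Y₁, X₁, i, r, w, hS, hY, hX⟩ := h.exists_right (kernel q)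
    obtain ⟨E, j, g, t, w', hS', sq, ht⟩ := exists_pushout_shortExact hq i
    have ht' : t ≫ g = q := ht
    refine ⟨⟨E, biprod.inl ≫ t, g, by simp [ht', q], ?_, h.epiWith_of_shortExact hS' hY⟩⟩
    rw [← h.llp_epiWith]
    refine MorphismProperty.comp_mem _ _ _ ?_ (MorphismProperty.of_isPushout sq ?_)
    · rw [h.llp_epiWith]
      exact h.monoWith_of_shortExact (S := ShortComplex.mk (biprod.inl : A ⟶ A ⊞ P) biprod.snd
        (by simp)) (ShortComplex.Splitting.ofHasBinaryBiproduct A P).shortExact hXP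
    · rw [h.llp_epiWith]
      exact h.monoWith_of_shortExact hS hX⟩

lemma exists_factorization {A B : D} (f : A ⟶ B) : ∃ (E : D) (i : A ⟶ E) (p : E ⟶ B),
    i ≫ p = f ∧ monoWith X i ∧ epiWith Y p := by
  have := h.isWeakFactorizationSystem
  let d := MorphismProperty.factorizationData (monoWith X) (epiWith Y) f
  exact ⟨d.Z, d.i, d.p, d.fac, d.hi, d.hp⟩

lemma isAbelianWFS : IsAbelianWFS (monoWith X) (epiWith Y) where
  left f := by rw [h.monoWith_zero_iff (isZero_zero D)]; rfl
  right f := by rw [h.epiWith_zero_iff (isZero_zero D)]; rfl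

/-- A complete cotorsion pair whose left class is closed under kernels of epimorphisms is
hereditary: a class in `Ext^{n+1}(A, B)` dies on an object `P` of the left class that covers `A`,
so it comes from `Ext^n` of the kernel of `P ⟶ A`. -/
lemma isHereditary (hk : ∀ S : ShortComplex D, S.ShortExact → X S.X₂ → X S.X₃ → X S.X₁) :
    IsHereditaryCompleteCotorsionPair X Y where
  toIsCompleteCotorsionPair := h
  ext_vanishes A B hA hB n hn := by
    let := HasExt.standard D
    induction n, hn using Nat.le_induction generalizing A with
    | base => exact (h.left A).1 hA B hB
    | succ n hn ih =>
      refine .of_forall fun e => ?_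
      obtain ⟨Q, q, hq, he⟩ := exists_epi_mk₀_comp_eq_zero e
      obtain ⟨_, P, _, p, _, hP, -, hXP⟩ := h.exists_left Q
      have hp : Epi p := hP.epi_g
      have hS := shortExact_kernel (p ≫ q)
      obtain ⟨y, rfl⟩ := Abelian.Ext.contravariant_sequence_exact₃ hS B e (by
        change (Abelian.Ext.mk₀ (p ≫ q)).comp e _ = 0
        rw [← Abelian.Ext.mk₀_comp_mk₀_assoc, he, Abelian.Ext.comp_zero]) (add_comm 1 n)
      rw [(ih _ (hk _ hS hXP hA)).eq_zero y, Abelian.Ext.comp_zero]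

end IsCompleteCotorsionPair

lemma IsHereditaryCompleteCotorsionPair.left_kernel (h : IsHereditaryCompleteCotorsionPair X Y)
    {S : ShortComplex D} (hS : S.ShortExact) (h₂ : X S.X₂) (h₃ : X S.X₃) : X S.X₁ :=
  (h.left _).2 fun B hB => ((h.left _).1 h₂ B hB).first_left hS
    (h.ext_vanishes _ _ h₃ hB 2 (by simp))

/-! ### Hovey triples and classes of weak equivalences -/

section Hovey

open HomotopicalAlgebra

variable [HasLimits D] [HasColimits D] {A W B : ObjectProperty D}

/-- A class `w` of weak equivalences with the two-out-of-three property turns two complete cotorsion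
pairs into an abelian model structure if, among the cofibrations and among the fibrations, it is
detected by the cokernel and by the kernel respectively. -/
lemma isHoveyTriple_of_weakEquivalences (w : MorphismProperty D) [w.HasTwoOutOfThreeProperty]
    (h₁ : IsCompleteCotorsionPair A (W ⊓ B)) (h₂ : IsCompleteCotorsionPair (A ⊓ W) B)
    (hA : ∀ {X Y : D} (f : X ⟶ Y), monoWith A f → (w f ↔ W (cokernel f)))
    (hB : ∀ {X Y : D} (f : X ⟶ Y), epiWith B f → (w f ↔ W (kernel f)))
    (hW : ∀ X : D, W X ↔ w (0 : (0 : D) ⟶ X)) : IsHoveyTriple A W B := by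
  let : CategoryWithCofibrations D := ⟨monoWith A⟩
  let : CategoryWithFibrations D := ⟨epiWith B⟩
  let : CategoryWithWeakEquivalences D := ⟨w⟩
  have : (weakEquivalences D).HasTwoOutOfThreeProperty := ‹_›
  have hc : trivialCofibrations D = monoWith (A ⊓ W) := by
    ext X Y f
    refine ⟨fun ⟨h, h'⟩ => ⟨h.1, h.2, (hA f h).1 h'⟩, fun h => ?_⟩
    have h' : monoWith A f := ⟨h.1, h.2.1⟩
    exact ⟨h', (hA f h').2 h.2.2⟩
  have hf : trivialFibrations D = epiWith (W ⊓ B) := by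
    ext X Y f
    refine ⟨fun ⟨h, h'⟩ => ⟨h.1, (hB f h).1 h', h.2⟩, fun h => ?_⟩
    have h' : epiWith B f := ⟨h.1, h.2.2⟩
    exact ⟨h', (hB f h').2 h.2.1⟩
  have i₁ : MorphismProperty.IsWeakFactorizationSystem (cofibrations D) (trivialFibrations D) := by
    rw [hf]; exact h₁.isWeakFactorizationSystem
  have i₂ : MorphismProperty.IsWeakFactorizationSystem (trivialCofibrations D) (fibrations D) := by
    rw [hc]; exact h₂.isWeakFactorizationSystem
  refine ⟨ModelCategory.mk' D, ?_, ?_, fun X => ?_, hW, fun X => ?_⟩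
  · change IsAbelianWFS (trivialCofibrations D) _
    rw [hc]; exact h₂.isAbelianWFS
  · change IsAbelianWFS _ (trivialFibrations D)
    rw [hf]; exact h₁.isAbelianWFS
  · exact (h₁.monoWith_zero_iff (isZero_zero D) _).symm
  · exact (h₂.epiWith_zero_iff (isZero_zero D) _).symm

lemma IsHoveyTriple.exists_weakEquivalences (h : IsHoveyTriple A W B) :
    ∃ w : MorphismProperty D, w.HasTwoOutOfThreeProperty ∧ w.RespectsIso ∧
      (∀ {X Y : D} (f : X ⟶ Y), monoWith A f → (w f ↔ W (cokernel f))) ∧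
      (∀ {X Y : D} (f : X ⟶ Y), epiWith B f → (w f ↔ W (kernel f))) ∧
      (∀ X : D, W X ↔ w (0 : (0 : D) ⟶ X)) := by
  obtain ⟨_, h₁, h₂, hA, hW, hB⟩ := h
  refine ⟨weakEquivalences D, inferInstance, inferInstance, fun f hf => ?_, fun f hf => ?_, hW⟩
  · have hf' : cofibrations D f := (h₂.left f).2 ⟨hf.1, (hA _).1 hf.2⟩
    constructor
    · intro hw
      rw [hW]
      exact ((h₁.left f).1 ⟨hf', hw⟩).2.2
    · intro hw
      exact ((h₁.left f).2 ⟨hf.1, (hA _).1 hf.2, (hW _).1 hw⟩).2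
  · have hf' : fibrations D f := (h₁.right f).2 ⟨hf.1, (hB _).1 hf.2⟩
    -- a map to zero and the corresponding map from zero are weak equivalences simultaneously
    have h0 : ∀ K : D, weakEquivalences D (0 : K ⟶ 0) ↔ W K := fun K => by
      rw [hW]
      have e : (0 : (0 : D) ⟶ K) ≫ (0 : K ⟶ 0) = 𝟙 0 := (isZero_zero D).eq_of_src _ _
      have hid : weakEquivalences D (𝟙 (0 : D)) := MorphismProperty.id_mem _ _
      rw [← e] at hid
      exact ⟨fun hK => MorphismProperty.of_postcomp _ _ _ hK hid,
        fun hK => MorphismProperty.of_precomp _ _ _ hK hid⟩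
    constructor
    · intro hw
      exact (h0 _).1 ((h₂.right f).1 ⟨hf', hw⟩).2.2
    · intro hw
      exact ((h₂.right f).2 ⟨hf.1, (hB _).1 hf.2, (h0 _).2 hw⟩).2

end Hovey

end Cotorsion

/-! ### Linear functors and evaluation -/

section Evaluation

variable {k : Type v} [Field k] {C : Type v} [SmallCategory C] [Preadditive C] [Linear k C]
  {M : Type u} [Category.{v} M] [Abelian M] [Linear k M]

instance (X : LinFun k C M) : X.obj.Additive := X.property.1

instance (X : LinFun k C M) : X.obj.Linear k := X.property.2

/-- A morphism of `LinFun k C M` from its components. -/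
def natMk {X Y : LinFun k C M} (app : ∀ c, X.obj.obj c ⟶ Y.obj.obj c)
    (h : ∀ {c d : C} (f : c ⟶ d), X.obj.map f ≫ app d = app c ≫ Y.obj.map f) : X ⟶ Y :=
  ObjectProperty.homMk { app := app, naturality := fun _ _ f => h f }

lemma linFun_hom_ext {X Y : LinFun k C M} {f g : X ⟶ Y} (h : ∀ c, f.hom.app c = g.hom.app c) :
    f = g := by
  ext c
  exact h c

@[simp]
lemma linFun_comp_app {X Y Z : LinFun k C M} (f : X ⟶ Y) (g : Y ⟶ Z) (c : C) :
    (f ≫ g).hom.app c = f.hom.app c ≫ g.hom.app c := rfl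

@[simp]
lemma linFun_id_app (X : LinFun k C M) (c : C) : (𝟙 X : X ⟶ X).hom.app c = 𝟙 _ := rfl

@[simp]
lemma linFun_zero_app (X Y : LinFun k C M) (c : C) : (0 : X ⟶ Y).hom.app c = 0 := rfl

lemma linFun_naturality {X Y : LinFun k C M} (f : X ⟶ Y) {c d : C} (a : c ⟶ d) :
    X.obj.map a ≫ f.hom.app d = f.hom.app c ≫ Y.obj.map a := f.hom.naturality a

variable (k M) in
/-- Evaluation at an object. -/
abbrev ev (c : C) : LinFun k C M ⥤ M := (isLinear k C M).ι ⋙ (evaluation C M).obj c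

instance {J : Type*} [Category* J] [HasLimitsOfShape J M] (c : C) :
    PreservesLimitsOfShape J (ev k M c) := inferInstance
instance {J : Type*} [Category* J] [HasColimitsOfShape J M] (c : C) :
    PreservesColimitsOfShape J (ev k M c) := inferInstance
instance (c : C) : PreservesFiniteLimits (ev k M c) := ⟨fun _ => inferInstance⟩
instance (c : C) : PreservesFiniteColimits (ev k M c) := ⟨fun _ => inferInstance⟩

lemma isZero_linFun_iff (X : LinFun k C M) : IsZero X ↔ ∀ c, IsZero (X.obj.obj c) := by
  refine ⟨fun h c => (ev k M c).map_isZero h, fun h => ?_⟩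
  rw [IsZero.iff_id_eq_zero]
  exact linFun_hom_ext fun c => (h c).eq_of_src _ _

variable {S : ShortComplex (LinFun k C M)}

lemma shortExact_ev (hS : S.ShortExact) (c : C) : (S.map (ev k M c)).ShortExact :=
  hS.map_of_exact _

lemma mono_app {X Y : LinFun k C M} (f : X ⟶ Y) [Mono f] (c : C) : Mono (f.hom.app c) :=
  inferInstanceAs (Mono ((ev k M c).map f))

lemma epi_app {X Y : LinFun k C M} (f : X ⟶ Y) [Epi f] (c : C) : Epi (f.hom.app c) :=
  inferInstanceAs (Epi ((ev k M c).map f))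

lemma mono_of_app {X Y : LinFun k C M} (f : X ⟶ Y) (h : ∀ c, Mono (f.hom.app c)) : Mono f where
  right_cancellation g g' e := linFun_hom_ext fun c => by
    have := h c
    rw [← cancel_mono (f.hom.app c)]
    exact congr_arg (fun z => z.hom.app c) e

lemma epi_of_app {X Y : LinFun k C M} (f : X ⟶ Y) (h : ∀ c, Epi (f.hom.app c)) : Epi f where
  left_cancellation g g' e := linFun_hom_ext fun c => by
    have := h c
    rw [← cancel_epi (f.hom.app c)]
    exact congr_arg (fun z => z.hom.app c) e

lemma shortExact_of_ev (h : ∀ c, (S.map (ev k M c)).ShortExact) : S.ShortExact where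
  exact := by
    rw [ShortComplex.exact_iff_isZero_homology, isZero_linFun_iff]
    intro c
    exact ((ShortComplex.exact_iff_isZero_homology _).1 (h c).exact).of_iso
      (S.mapHomologyIso (ev k M c)).symm
  mono_f := mono_of_app _ fun c => (h c).mono_f
  epi_g := epi_of_app _ fun c => (h c).epi_g

end Evaluation

/-! ### Reedy composites -/

section Combinatorics

variable {k : Type v} [Field k] {C : Type v} [SmallCategory C] [Preadditive C] [Linear k C]

namespace WideLinearSubcategory

/-- If the endomorphisms of `c` in `S` are one-dimensional, they are the multiples of `𝟙 c`. -/
lemma exists_smul_id (S : WideLinearSubcategory k C) {c : C} (e : Nonempty (S.hom c c ≃ₗ[k] k))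
    {p : c ⟶ c} (hp : p ∈ S.hom c c) : ∃ a : k, p = a • 𝟙 c := by
  obtain ⟨e⟩ := e
  have h1 : e ⟨𝟙 c, S.id_mem c⟩ ≠ 0 := fun h0 => by
    have h2 : (⟨𝟙 c, S.id_mem c⟩ : S.hom c c) = 0 := e.injective (by rw [h0, map_zero])
    have h3 : (𝟙 c : c ⟶ c) = 0 := congr_arg Subtype.val h2
    have h4 : e.symm 1 = 0 := Subtype.ext (by
      rw [← Category.comp_id (e.symm 1).1, h3, comp_zero]; rfl)
    exact one_ne_zero (e.symm.injective (h4.trans e.symm.map_zero.symm))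
  refine ⟨e ⟨p, hp⟩ / e ⟨𝟙 c, S.id_mem c⟩, ?_⟩
  have : (⟨p, hp⟩ : S.hom c c) = (e ⟨p, hp⟩ / e ⟨𝟙 c, S.id_mem c⟩) • ⟨𝟙 c, S.id_mem c⟩ :=
    e.injective (by rw [map_smul, smul_eq_mul, div_mul_cancel₀ _ h1])
  exact congr_arg Subtype.val this

end WideLinearSubcategory

namespace ReedyStructure

variable (R : ReedyStructure k C) {c d e : C}

lemma minus_deg {n : c ⟶ e} (hn : n ∈ R.minus.hom c e) (h0 : n ≠ 0) :
    e = c ∨ R.deg e < R.deg c := by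
  by_cases h : c = e
  · exact .inl h.symm
  · exact .inr (R.minus_inverse.deg_lt n hn h0 h)

lemma plus_deg {p : e ⟶ d} (hp : p ∈ R.plus.hom e d) (h0 : p ≠ 0) :
    e = d ∨ R.deg e < R.deg d := by
  by_cases h : e = d
  · exact .inl h
  · exact .inr (R.plus_direct.deg_lt p hp h0 h)

open Classical in
lemma compositionMap_of (p : R.plus.hom e d) (n : R.minus.hom c e) :
    compositionMap R.plus R.minus c d (DirectSum.lof k C _ e (p ⊗ₜ[k] n)) = n.1 ≫ p.1 := by
  rw [compositionMap, DirectSum.toModule_lof, TensorProduct.lift.tmul]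
  rfl

/-- The morphisms `c ⟶ d` are sums of Reedy composites, that is, of composites `n ≫ p` with `n` in
`C^-` and `p` in `C^+`. -/
lemma hom_induction {P : (c ⟶ d) → Prop} (h0 : P 0) (hadd : ∀ f g, P f → P g → P (f + g))
    (hcomp : ∀ (e : C) (n : c ⟶ e) (p : e ⟶ d), n ∈ R.minus.hom c e → p ∈ R.plus.hom e d →
      P (n ≫ p)) (f : c ⟶ d) : P f := by
  classical
  obtain ⟨x, rfl⟩ := (R.bijective_compositionMap c d).2 f
  induction x using DirectSum.induction_on with
  | zero => rwa [map_zero]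
  | of e t =>
    induction t using TensorProduct.induction_on with
    | zero => rwa [map_zero, map_zero]
    | tmul p n =>
      have := R.compositionMap_of p n
      rw [DirectSum.lof_eq_of] at this
      rw [this]
      exact hcomp e n.1 p.1 n.2 p.2
    | add s t hs ht => rw [map_add, map_add]; exact hadd _ _ hs ht
  | add s t hs ht => rw [map_add]; exact hadd _ _ hs ht

variable {V : Type*} [AddCommGroup V] [Module k V]

/-- The linear map on `C(c, d) ≅ ⨁_e C^+(e, d) ⊗ C^-(c, e)` given by a family of bilinear maps. -/
def homDesc (φ : ∀ e, R.plus.hom e d →ₗ[k] R.minus.hom c e →ₗ[k] V) : (c ⟶ d) →ₗ[k] V := by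
  classical
  exact (DirectSum.toModule k C V fun e => TensorProduct.lift (φ e)) ∘ₗ
    (LinearEquiv.ofBijective _ (R.bijective_compositionMap c d)).symm.toLinearMap

lemma homDesc_comp (φ : ∀ e, R.plus.hom e d →ₗ[k] R.minus.hom c e →ₗ[k] V)
    {n : c ⟶ e} {p : e ⟶ d} (hn : n ∈ R.minus.hom c e) (hp : p ∈ R.plus.hom e d) :
    R.homDesc φ (n ≫ p) = φ e ⟨p, hp⟩ ⟨n, hn⟩ := by
  classical
  have h : (LinearEquiv.ofBijective _ (R.bijective_compositionMap c d)).symm (n ≫ p) =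
      DirectSum.lof k C (fun e => R.plus.hom e d ⊗[k] R.minus.hom c e) e
        ((⟨p, hp⟩ : R.plus.hom e d) ⊗ₜ[k] (⟨n, hn⟩ : R.minus.hom c e)) := by
    rw [LinearEquiv.symm_apply_eq]
    exact (R.compositionMap_of ⟨p, hp⟩ ⟨n, hn⟩).symm
  simp only [homDesc, LinearMap.comp_apply, LinearEquiv.coe_coe]
  erw [h]
  rw [DirectSum.toModule_lof, TensorProduct.lift.tmul]

lemma homLin_ext {l l' : (c ⟶ d) →ₗ[k] V} (h : ∀ (e : C) (n : c ⟶ e) (p : e ⟶ d),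
    n ∈ R.minus.hom c e → p ∈ R.plus.hom e d → l (n ≫ p) = l' (n ≫ p)) : l = l' :=
  LinearMap.ext fun f => R.hom_induction (P := fun f => l f = l' f) (by simp)
    (fun f g hf hg => by rw [map_add, map_add, hf, hg]) h f

/-- Composition `C^+(e, d) × C^-(c, e) → C(c, d)`, as a bilinear map. -/
def compBilin (c d e : C) : R.plus.hom e d →ₗ[k] R.minus.hom c e →ₗ[k] (c ⟶ d) :=
  ((Linear.comp (S := k) c e d).flip.domRestrict (R.plus.hom e d)).compl₂
    (R.minus.hom c e).subtype

open Classical in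
/-- The projection of `C(c, d) ≅ ⨁_e C^+(e, d) ⊗ C^-(c, e)` onto the sum of the components
indexed by `e ∈ T`. -/
def proj (T : Set C) (c d : C) : (c ⟶ d) →ₗ[k] (c ⟶ d) :=
  R.homDesc fun e => if e ∈ T then R.compBilin c d e else 0

lemma proj_comp_of_mem {T : Set C} (he : e ∈ T) {n : c ⟶ e} {p : e ⟶ d}
    (hn : n ∈ R.minus.hom c e) (hp : p ∈ R.plus.hom e d) : R.proj T c d (n ≫ p) = n ≫ p := by
  rw [proj, R.homDesc_comp _ hn hp, if_pos he]
  rfl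

lemma proj_comp_of_notMem {T : Set C} (he : e ∉ T) {n : c ⟶ e} {p : e ⟶ d}
    (hn : n ∈ R.minus.hom c e) (hp : p ∈ R.plus.hom e d) : R.proj T c d (n ≫ p) = 0 := by
  rw [proj, R.homDesc_comp _ hn hp, if_neg he]
  rfl

lemma proj_univ (f : c ⟶ d) : R.proj Set.univ c d f = f :=
  LinearMap.congr_fun (R.homLin_ext (l := R.proj Set.univ c d) (l' := LinearMap.id)
    fun _ _ _ hn hp => R.proj_comp_of_mem (Set.mem_univ _) hn hp) f

lemma minus_comp_proj (T : Set C) {b : C} {x : b ⟶ c} (hx : x ∈ R.minus.hom b c) (f : c ⟶ d) :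
    x ≫ R.proj T c d f = R.proj T b d (x ≫ f) := by
  refine R.hom_induction (P := fun f => x ≫ R.proj T c d f = R.proj T b d (x ≫ f)) (by simp)
    (fun f g hf hg => by
      rw [map_add, Preadditive.comp_add, Preadditive.comp_add, map_add, hf, hg])
    (fun e n p hn hp => ?_) f
  rw [← Category.assoc]
  by_cases he : e ∈ T
  · rw [R.proj_comp_of_mem he hn hp, R.proj_comp_of_mem he (R.minus.comp_mem hx hn) hp,
      Category.assoc]
  · rw [R.proj_comp_of_notMem he hn hp, R.proj_comp_of_notMem he (R.minus.comp_mem hx hn) hp,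
      comp_zero]

lemma proj_proj (T T' : Set C) (f : c ⟶ d) :
    R.proj T c d (R.proj T' c d f) = R.proj (T ∩ T') c d f := by
  refine R.hom_induction (P := fun f => R.proj T c d (R.proj T' c d f) = R.proj (T ∩ T') c d f)
    (by simp) (fun f g hf hg => by rw [map_add, map_add, map_add, hf, hg])
    (fun e n p hn hp => ?_) f
  by_cases he' : e ∈ T'
  · rw [R.proj_comp_of_mem he' hn hp]
    by_cases he : e ∈ T
    · rw [R.proj_comp_of_mem he hn hp, R.proj_comp_of_mem (T := T ∩ T') ⟨he, he'⟩ hn hp]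
    · rw [R.proj_comp_of_notMem he hn hp, R.proj_comp_of_notMem (fun h => he h.1) hn hp]
  · rw [R.proj_comp_of_notMem he' hn hp, R.proj_comp_of_notMem (fun h => he' h.2) hn hp, map_zero]

/-- The objects of degree smaller than the degree of `c`. -/
def below (c : C) : Set C := {e | R.deg e < R.deg c}

/-- A composite `f ≫ p` with `p : e ⟶ d` in `C^+` is a sum of Reedy composites through `e` and
objects of degree smaller than that of `e`. -/
lemma proj_comp_of_deg_le (T : Set C) (hT : ∀ a ∈ T, ∀ b, R.deg b < R.deg a → b ∈ T)
    {f : c ⟶ e} {p : e ⟶ d} (he : e ∈ T) (hp : p ∈ R.plus.hom e d) :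
    R.proj T c d (f ≫ p) = f ≫ p := by
  refine R.hom_induction (P := fun f => R.proj T c d (f ≫ p) = f ≫ p) (by simp)
    (fun f g hf hg => by rw [Preadditive.add_comp, map_add, hf, hg])
    (fun e' n q hn hq => ?_) f
  by_cases hq0 : q = 0
  · simp [hq0]
  rw [Category.assoc]
  refine R.proj_comp_of_mem ?_ hn (R.plus.comp_mem hq hp)
  rcases R.plus_deg hq hq0 with rfl | h
  · exact he
  · exact hT _ he _ h

lemma minus_comp_of_deg_le (T : Set C) (hT : ∀ a ∈ T, ∀ b, R.deg b < R.deg a → b ∈ T)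
    {f : e ⟶ d} {n : c ⟶ e} (he : e ∈ T) (hn : n ∈ R.minus.hom c e) :
    R.proj T c d (n ≫ f) = n ≫ f := by
  refine R.hom_induction (P := fun f => R.proj T c d (n ≫ f) = n ≫ f) (by simp)
    (fun f g hf hg => by rw [Preadditive.comp_add, map_add, hf, hg])
    (fun e' m q hm hq => ?_) f
  by_cases hm0 : m = 0
  · simp [hm0]
  rw [← Category.assoc]
  refine R.proj_comp_of_mem ?_ (R.minus.comp_mem hn hm) hq
  rcases R.minus_deg hm hm0 with rfl | h
  · exact he
  · exact hT _ he _ h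

lemma below_closed (c : C) : ∀ a ∈ R.below c, ∀ b, R.deg b < R.deg a → b ∈ R.below c :=
  fun _ ha _ hb => lt_trans hb ha

/-- The lower morphisms `d ⟶ c`: the sums of Reedy composites through objects of degree `< deg c`.
-/
def lowerTo (c d : C) : Submodule k (d ⟶ c) := LinearMap.range (R.proj (R.below c) d c)

/-- The lower morphisms `c ⟶ d`: the sums of Reedy composites through objects of degree
`< deg c`. -/
def lowerFrom (c d : C) : Submodule k (c ⟶ d) := LinearMap.range (R.proj (R.below c) c d)

lemma mem_lowerTo {f : d ⟶ c} : f ∈ R.lowerTo c d ↔ R.proj (R.below c) d c f = f :=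
  ⟨fun ⟨g, hg⟩ => by rw [← hg, proj_proj, Set.inter_self], fun h => ⟨f, h⟩⟩

lemma mem_lowerFrom {f : c ⟶ d} : f ∈ R.lowerFrom c d ↔ R.proj (R.below c) c d f = f :=
  ⟨fun ⟨g, hg⟩ => by rw [← hg, proj_proj, Set.inter_self], fun h => ⟨f, h⟩⟩

lemma comp_mem_lowerTo {b : C} (g : b ⟶ d) {f : d ⟶ c} (hf : f ∈ R.lowerTo c d) :
    g ≫ f ∈ R.lowerTo c b := by
  rw [mem_lowerTo] at hf ⊢
  rw [← hf]
  refine R.hom_induction (P := fun f => R.proj (R.below c) b c (g ≫ R.proj (R.below c) d c f) =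
      g ≫ R.proj (R.below c) d c f) (by simp)
    (fun f g hf hg => by rw [map_add, Preadditive.comp_add, map_add, hf, hg])
    (fun e n p hn hp => ?_) f
  by_cases he : e ∈ R.below c
  · rw [R.proj_comp_of_mem he hn hp, ← Category.assoc]
    exact R.proj_comp_of_deg_le _ (R.below_closed c) he hp
  · rw [R.proj_comp_of_notMem he hn hp, comp_zero, map_zero]

lemma comp_mem_lowerFrom {b : C} (g : d ⟶ b) {f : c ⟶ d} (hf : f ∈ R.lowerFrom c d) :
    f ≫ g ∈ R.lowerFrom c b := by
  rw [mem_lowerFrom] at hf ⊢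
  rw [← hf]
  refine R.hom_induction (P := fun f => R.proj (R.below c) c b (R.proj (R.below c) c d f ≫ g) =
      R.proj (R.below c) c d f ≫ g) (by simp)
    (fun f g hf hg => by rw [map_add, Preadditive.add_comp, map_add, hf, hg])
    (fun e n p hn hp => ?_) f
  by_cases he : e ∈ R.below c
  · rw [R.proj_comp_of_mem he hn hp, Category.assoc]
    exact R.minus_comp_of_deg_le _ (R.below_closed c) he hn
  · rw [R.proj_comp_of_notMem he hn hp, zero_comp, map_zero]

lemma comp_mem_lowerTo_of_plus (n : d ⟶ e) {p : e ⟶ c} (he : R.deg e < R.deg c)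
    (hp : p ∈ R.plus.hom e c) : n ≫ p ∈ R.lowerTo c d :=
  R.mem_lowerTo.2 (R.proj_comp_of_deg_le _ (R.below_closed c) he hp)

lemma comp_mem_lowerFrom_of_minus {n : c ⟶ e} (p : e ⟶ d) (he : R.deg e < R.deg c)
    (hn : n ∈ R.minus.hom c e) : n ≫ p ∈ R.lowerFrom c d :=
  R.mem_lowerFrom.2 (R.minus_comp_of_deg_le _ (R.below_closed c) he hn)

/-- Maps from `c` to an object of degree at most `deg c` other than `c` are lower morphisms. -/
lemma mem_lowerFrom_of_deg_le (h : R.deg d ≤ R.deg c) (hdc : d ≠ c) (f : c ⟶ d) :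
    f ∈ R.lowerFrom c d := by
  refine R.hom_induction (P := fun f => f ∈ R.lowerFrom c d) (zero_mem _)
    (fun _ _ => add_mem) (fun e n p hn hp => ?_) f
  by_cases hn0 : n = 0
  · rw [hn0, zero_comp]; exact zero_mem _
  by_cases hp0 : p = 0
  · rw [hp0, comp_zero]; exact zero_mem _
  refine R.comp_mem_lowerFrom_of_minus p ?_ hn
  rcases R.minus_deg hn hn0 with rfl | h1
  · rcases R.plus_deg hp hp0 with rfl | h2
    · exact absurd rfl hdc
    · exact h2.trans_le h
  · exact h1

end ReedyStructure

end Combinatorics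

/-! ### Cotensors and tensors with vector spaces -/

section VectorSpaces

variable {k : Type v} [Field k] {M : Type u} [Category.{v} M] [Abelian M] [Linear k M]
  (V : Type v) [AddCommGroup V] [Module k V]

section Cotensor

variable [HasLimits M]

variable (k) in
/-- The cotensor `Hom_k(V, N)` of an object with a vector space, as a limit weighted by `V` over the
category with one morphism. -/
def cotensor (N : M) : M :=
  weightedLimit ((Functor.const (Discrete PUnit.{v + 1})).obj (ModuleCat.of k V))
    ((Functor.const _).obj N)

namespace cotensor

variable {V}

/-- Evaluation at a vector. -/
def π (N : M) : V →ₗ[k] (cotensor k V N ⟶ N) where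
  toFun x := weightedLimit.π ((Functor.const (Discrete PUnit.{v + 1})).obj (ModuleCat.of k V))
    ((Functor.const _).obj N) ⟨⟨⟩⟩ x
  map_add' x y := weightedLimit.π_add
    ((Functor.const (Discrete PUnit.{v + 1})).obj (ModuleCat.of k V))
    ((Functor.const _).obj N) ⟨⟨⟩⟩ x y
  map_smul' a x := weightedLimit.π_smul
    ((Functor.const (Discrete PUnit.{v + 1})).obj (ModuleCat.of k V))
    ((Functor.const _).obj N) ⟨⟨⟩⟩ a x

variable {N Z : M}

lemma hom_ext {f g : Z ⟶ cotensor k V N} (h : ∀ x, f ≫ π N x = g ≫ π N x) : f = g :=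
  weightedLimit.hom_ext (by rintro ⟨⟨⟩⟩ x; exact h x)

lemma natural (l : V →ₗ[k] (Z ⟶ N)) {d d' : Discrete PUnit.{v + 1}} (f : d ⟶ d') (x : V) :
    l (((Functor.const (Discrete PUnit.{v + 1})).obj (ModuleCat.of k V)).map f x) =
      l x ≫ ((Functor.const (Discrete PUnit.{v + 1})).obj N).map f :=
  (Category.comp_id (l x)).symm

/-- The map to the cotensor given by a linear map `V → Hom(Z, N)`. -/
def lift (l : V →ₗ[k] (Z ⟶ N)) : Z ⟶ cotensor k V N :=
  weightedLimit.lift (fun _ => l) (natural l)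

@[simp]
lemma lift_π (l : V →ₗ[k] (Z ⟶ N)) (x : V) : lift l ≫ π N x = l x :=
  weightedLimit.lift_π _ (natural l) _ _

variable (k V) in
/-- Functoriality of the cotensor in the object. -/
def map {N N' : M} (g : N ⟶ N') : cotensor k V N ⟶ cotensor k V N' :=
  lift ((Linear.rightComp k _ g) ∘ₗ π N)

@[simp]
lemma map_π {N N' : M} (g : N ⟶ N') (x : V) : map k V g ≫ π N' x = π N x ≫ g := by
  rw [map, lift_π]
  rfl

/-- Cotensoring preserves the right lifting property: the lifts are chosen on a basis. -/
lemma rlp_map (L : MorphismProperty M) {N N' : M} (g : N ⟶ N') (hg : L.rlp g) :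
    L.rlp (map k V g) := fun A B i hi => ⟨fun {f h} sq => by
  let b := Module.Basis.ofVectorSpace k V
  have hgi := hg i hi
  have sq' : ∀ x : V, CommSq (f ≫ π N x) i g (h ≫ π N' x) := fun x => ⟨by
    rw [Category.assoc, ← map_π, ← Category.assoc, sq.w, Category.assoc]⟩
  let l : V →ₗ[k] (B ⟶ N) := b.constr k fun j => (sq' (b j)).lift
  have h1 : (Linear.leftComp k N i) ∘ₗ l = (Linear.leftComp k N f) ∘ₗ π N :=
    b.ext fun j => by
      simp only [LinearMap.comp_apply, l, Module.Basis.constr_basis, Linear.leftComp_apply]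
      exact (sq' (b j)).fac_left
  have h2 : (Linear.rightComp k B g) ∘ₗ l = (Linear.leftComp k N' h) ∘ₗ π N' :=
    b.ext fun j => by
      simp only [LinearMap.comp_apply, l, Module.Basis.constr_basis, Linear.leftComp_apply,
        Linear.rightComp_apply]
      exact (sq' (b j)).fac_right
  refine ⟨⟨lift l, hom_ext fun x => ?_, hom_ext fun x => ?_⟩⟩
  · rw [Category.assoc, lift_π]
    exact LinearMap.congr_fun h1 x
  · rw [Category.assoc, map_π, reassoc_of% lift_π]
    exact LinearMap.congr_fun h2 x⟩

/-- Cotensoring with a vector space preserves the right class. -/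
lemma right_mem {A B : ObjectProperty M} (h : IsCompleteCotorsionPair A B) {N : M} (hN : B N) :
    B (cotensor k V N) := by
  have hz : IsZero (cotensor k V (0 : M)) := by
    rw [IsZero.iff_id_eq_zero]
    exact hom_ext fun x => (isZero_zero M).eq_of_tgt _ _
  rw [← h.epiWith_zero_iff hz (map k V (0 : N ⟶ 0)), ← h.rlp_monoWith]
  refine rlp_map _ _ ?_
  rw [h.rlp_monoWith]
  exact (h.epiWith_zero_iff (isZero_zero M) _).2 hN

/-- Cotensoring with a vector space preserves the short exact sequences with first term in the right
class; the lifting property replaces exactness of products, which may fail in `M`. -/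
lemma shortExact_map {A B : ObjectProperty M} (h : IsCompleteCotorsionPair A B)
    {S : ShortComplex M} (hS : S.ShortExact) (h₁ : B S.X₁) (w : map k V S.f ≫ map k V S.g = 0) :
    (ShortComplex.mk (map k V S.f) (map k V S.g) w).ShortExact := by
  have := hS.mono_f
  have hm : Mono (map k V S.f) := ⟨fun a b e => hom_ext fun x => by
    rw [← cancel_mono S.f, Category.assoc, Category.assoc, ← map_π, ← Category.assoc, e,
      Category.assoc]⟩
  have he : Epi (map k V S.g) := by
    have : (monoWith A).rlp (map k V S.g) := rlp_map _ _ (by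
      rw [h.rlp_monoWith]; exact h.epiWith_of_shortExact hS h₁)
    rw [h.rlp_monoWith] at this
    exact this.1
  suffices hex : (ShortComplex.mk (map k V S.f) (map k V S.g) w).Exact from
    { exact := hex, mono_f := hm, epi_g := he }
  refine ShortComplex.exact_of_f_is_kernel _ (KernelFork.IsLimit.ofι' _ _ fun {Z} t ht => ?_)
  have ht' : ∀ x : V, (t ≫ π S.X₂ x) ≫ S.g = 0 := fun x => by
    have ht' : t ≫ map k V S.g = 0 := ht
    rw [Category.assoc, ← map_π, ← Category.assoc, ht', zero_comp]
  let l : V →ₗ[k] (Z ⟶ S.X₁) :=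
    { toFun := fun x => hS.exact.lift _ (ht' x)
      map_add' := fun x y => by simp [← cancel_mono S.f]
      map_smul' := fun a x => by simp [← cancel_mono S.f] }
  refine ⟨lift l, hom_ext fun x => ?_⟩
  rw [Category.assoc]
  change lift l ≫ map k V S.f ≫ _ = _
  rw [map_π, reassoc_of% lift_π]
  exact hS.exact.lift_f _ (ht' x)

end cotensor

-- the universal property determines the cotensor; its construction must not be unfolded below
attribute [irreducible] cotensor cotensor.π cotensor.lift

end Cotensor

section Tensor

variable [HasColimits M]

variable (k) in
/-- The tensor `V ⊗_k N` of an object with a vector space, as a colimit weighted by `V` over the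
category with one morphism. -/
def tensor (N : M) : M :=
  weightedColimit ((Functor.const (Discrete PUnit.{v + 1})ᵒᵖ).obj (ModuleCat.of k V))
    ((Functor.const _).obj N)

namespace tensor

variable {V}

/-- The map `x ⊗ -`. -/
def ι (N : M) : V →ₗ[k] (N ⟶ tensor k V N) where
  toFun x := weightedColimit.ι
    ((Functor.const (Discrete PUnit.{v + 1})ᵒᵖ).obj (ModuleCat.of k V))
    ((Functor.const _).obj N) ⟨⟨⟩⟩ x
  map_add' x y := weightedColimit.ι_add
    ((Functor.const (Discrete PUnit.{v + 1})ᵒᵖ).obj (ModuleCat.of k V))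
    ((Functor.const _).obj N) ⟨⟨⟩⟩ x y
  map_smul' a x := weightedColimit.ι_smul
    ((Functor.const (Discrete PUnit.{v + 1})ᵒᵖ).obj (ModuleCat.of k V))
    ((Functor.const _).obj N) ⟨⟨⟩⟩ a x

variable {N Z : M}

lemma hom_ext {f g : tensor k V N ⟶ Z} (h : ∀ x, ι N x ≫ f = ι N x ≫ g) : f = g :=
  weightedColimit.hom_ext (by rintro ⟨⟨⟩⟩ x; exact h x)

lemma natural (l : V →ₗ[k] (N ⟶ Z)) {d d' : Discrete PUnit.{v + 1}} (f : d ⟶ d') (x : V) :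
    l (((Functor.const (Discrete PUnit.{v + 1})ᵒᵖ).obj (ModuleCat.of k V)).map f.op x) =
      ((Functor.const (Discrete PUnit.{v + 1})).obj N).map f ≫ l x :=
  (Category.id_comp (l x)).symm

/-- The map from the tensor given by a linear map `V → Hom(N, Z)`. -/
def desc (l : V →ₗ[k] (N ⟶ Z)) : tensor k V N ⟶ Z :=
  weightedColimit.desc (fun _ => l) (natural l)

@[simp]
lemma ι_desc (l : V →ₗ[k] (N ⟶ Z)) (x : V) : ι N x ≫ desc l = l x :=
  weightedColimit.ι_desc _ (natural l) _ _

/-- Tensoring with a vector space preserves the left class: the lifts are chosen on a basis. -/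
lemma left_mem {A B : ObjectProperty M} (h : IsCompleteCotorsionPair A B) (hN : A N) :
    A (tensor k V N) := by
  refine (h.left _).2 fun Y hY => extVanishes_one_iff.2 fun E i p w hS => ?_
  let b := Module.Basis.ofVectorSpace k V
  have hl : ∀ x : V, ∃ t : N ⟶ E, t ≫ p = ι N x := fun x =>
    ((h.left _).1 hN Y hY).exists_lift hS (ι N x)
  choose t ht using hl
  let l : V →ₗ[k] (N ⟶ E) := b.constr k fun j => t (b j)
  have h2 : (Linear.rightComp k N p) ∘ₗ l = ι N :=
    b.ext fun j => by
      simp only [LinearMap.comp_apply, l, Module.Basis.constr_basis, Linear.rightComp_apply]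
      exact ht (b j)
  refine ⟨desc l, hom_ext fun x => ?_⟩
  rw [reassoc_of% ι_desc, Category.comp_id]
  exact LinearMap.congr_fun h2 x

variable (k V) in
/-- Functoriality of the tensor in the object. -/
def map {N N' : M} (g : N ⟶ N') : tensor k V N ⟶ tensor k V N' :=
  desc ((Linear.leftComp k _ g) ∘ₗ ι N')

@[simp]
lemma ι_map {N N' : M} (g : N ⟶ N') (x : V) : ι N x ≫ map k V g = g ≫ ι N' x := by
  rw [map, ι_desc]
  rfl

/-- Tensoring with a vector space preserves the left lifting property. -/
lemma llp_map (L : MorphismProperty M) {N N' : M} (g : N ⟶ N') (hg : L.llp g) :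
    L.llp (map k V g) := fun A B q hq => ⟨fun {f h} sq => by
  let b := Module.Basis.ofVectorSpace k V
  have hgq := hg q hq
  have sq' : ∀ x : V, CommSq (ι N x ≫ f) g q (ι N' x ≫ h) := fun x => ⟨by
    rw [Category.assoc, sq.w, reassoc_of% ι_map]⟩
  let l : V →ₗ[k] (N' ⟶ A) := b.constr k fun j => (sq' (b j)).lift
  have h1 : (Linear.leftComp k A g) ∘ₗ l = (Linear.rightComp k N f) ∘ₗ ι N :=
    b.ext fun j => by
      simp only [LinearMap.comp_apply, l, Module.Basis.constr_basis, Linear.leftComp_apply,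
        Linear.rightComp_apply]
      exact (sq' (b j)).fac_left
  have h2 : (Linear.rightComp k N' q) ∘ₗ l = (Linear.rightComp k N' h) ∘ₗ ι N' :=
    b.ext fun j => by
      simp only [LinearMap.comp_apply, l, Module.Basis.constr_basis, Linear.rightComp_apply]
      exact (sq' (b j)).fac_right
  refine ⟨⟨desc l, hom_ext fun x => ?_, hom_ext fun x => ?_⟩⟩
  · rw [reassoc_of% ι_map, ι_desc]
    exact LinearMap.congr_fun h1 x
  · rw [reassoc_of% ι_desc]
    exact LinearMap.congr_fun h2 x⟩

/-- Tensoring with a vector space preserves the short exact sequences with last term in the left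
class. -/
lemma shortExact_map {A B : ObjectProperty M} (h : IsCompleteCotorsionPair A B)
    {S : ShortComplex M} (hS : S.ShortExact) (h₃ : A S.X₃) (w : map k V S.f ≫ map k V S.g = 0) :
    (ShortComplex.mk (map k V S.f) (map k V S.g) w).ShortExact := by
  have := hS.epi_g
  have he : Epi (map k V S.g) := ⟨fun a b e => hom_ext fun x => by
    rw [← cancel_epi S.g, ← reassoc_of% ι_map, e, reassoc_of% ι_map]⟩
  have hm : Mono (map k V S.f) := by
    have : (epiWith B).llp (map k V S.f) := llp_map _ _ (by
      rw [h.llp_epiWith]; exact h.monoWith_of_shortExact hS h₃)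
    rw [h.llp_epiWith] at this
    exact this.1
  suffices hex : (ShortComplex.mk (map k V S.f) (map k V S.g) w).Exact from
    { exact := hex, mono_f := hm, epi_g := he }
  refine ShortComplex.exact_of_g_is_cokernel _
    (CokernelCofork.IsColimit.ofπ' _ _ fun {Z} t ht => ?_)
  have ht' : ∀ x : V, S.f ≫ ι S.X₂ x ≫ t = 0 := fun x => by
    have ht' : map k V S.f ≫ t = 0 := ht
    rw [← reassoc_of% ι_map, ht', comp_zero]
  let l : V →ₗ[k] (S.X₃ ⟶ Z) :=
    { toFun := fun x => hS.exact.desc _ (ht' x)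
      map_add' := fun x y => by simp [← cancel_epi S.g]
      map_smul' := fun a x => by simp [← cancel_epi S.g] }
  refine ⟨desc l, hom_ext fun x => ?_⟩
  change _ ≫ map k V S.g ≫ _ = _
  rw [reassoc_of% ι_map, ι_desc]
  exact hS.exact.g_desc _ (ht' x)

end tensor

-- the universal property determines the tensor; its construction must not be unfolded below
attribute [irreducible] tensor tensor.ι tensor.desc

end Tensor

end VectorSpaces

/-! ### Matching objects and coinduced functors -/

section Coinduced

variable {k : Type v} [Field k] {C : Type v} [SmallCategory C] [Preadditive C] [Linear k C]
  {M : Type u} [Category.{v} M] [Abelian M] [Linear k M] [HasLimits M]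

/-- A `k`-linear subfunctor of the contravariant functor `C(-, c)`. -/
structure SubTo (k : Type v) [Field k] {C : Type v} [SmallCategory C] [Preadditive C] [Linear k C]
    (c : C) where
  /-- The morphisms in the subfunctor. -/
  hom (d : C) : Submodule k (d ⟶ c)
  comp_mem {d e : C} (g : d ⟶ e) {f : e ⟶ c} : f ∈ hom e → g ≫ f ∈ hom d

namespace SubTo

variable {c : C} (V : SubTo k c)

/-- Precomposition with a morphism, as a linear map. -/
def precomp {d e : C} (g : d ⟶ e) : V.hom e →ₗ[k] V.hom d :=
  (Linear.leftComp k c g).restrict fun _ hf => V.comp_mem g hf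

lemma precomp_id (d : C) (f : V.hom d) : V.precomp (𝟙 d) f = f :=
  Subtype.ext (Category.id_comp f.1)

lemma precomp_comp {d e b : C} (g : d ⟶ e) (g' : e ⟶ b) (f : V.hom b) :
    V.precomp (g ≫ g') f = V.precomp g (V.precomp g' f) :=
  Subtype.ext (Category.assoc g g' f.1)

lemma precomp_add {d e : C} (g g' : d ⟶ e) (f : V.hom e) :
    V.precomp (g + g') f = V.precomp g f + V.precomp g' f :=
  Subtype.ext (Preadditive.add_comp _ _ _ g g' f.1)

lemma precomp_smul {d e : C} (a : k) (g : d ⟶ e) (f : V.hom e) :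
    V.precomp (a • g) f = a • V.precomp g f :=
  Subtype.ext (Linear.smul_comp _ _ _ a g f.1)

/-- The action of a morphism on `Hom_k(V(-), N)`. -/
def coindAct (N : M) {d e : C} (g : d ⟶ e) : cotensor k (V.hom d) N ⟶ cotensor k (V.hom e) N :=
  cotensor.lift (cotensor.π N ∘ₗ V.precomp g)

lemma coindAct_π (N : M) {d e : C} (g : d ⟶ e) (f : V.hom e) :
    V.coindAct N g ≫ cotensor.π N f = cotensor.π N (V.precomp g f) :=
  cotensor.lift_π _ _

lemma coindAct_id (N : M) (d : C) : V.coindAct N (𝟙 d) = 𝟙 _ :=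
  cotensor.hom_ext fun x => by rw [coindAct_π, precomp_id, Category.id_comp]

lemma coindAct_comp (N : M) {d e b : C} (g : d ⟶ e) (g' : e ⟶ b) :
    V.coindAct N (g ≫ g') = V.coindAct N g ≫ V.coindAct N g' :=
  cotensor.hom_ext fun x => by
    rw [coindAct_π, Category.assoc, coindAct_π, coindAct_π, precomp_comp]

lemma coindAct_add (N : M) {d e : C} (g g' : d ⟶ e) :
    V.coindAct N (g + g') = V.coindAct N g + V.coindAct N g' :=
  cotensor.hom_ext fun x => by
    rw [Preadditive.add_comp, coindAct_π, coindAct_π, coindAct_π, precomp_add, map_add]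

lemma coindAct_smul (N : M) {d e : C} (g : d ⟶ e) (a : k) :
    V.coindAct N (a • g) = a • V.coindAct N g :=
  cotensor.hom_ext fun x => by
    rw [Linear.smul_comp, coindAct_π, coindAct_π, precomp_smul, map_smul]

/-- The underlying functor of `coind`. -/
def coindFunctor (N : M) : C ⥤ M where
  obj d := cotensor k (V.hom d) N
  map g := V.coindAct N g
  map_id d := V.coindAct_id N d
  map_comp g g' := V.coindAct_comp N g g'

/-- The functor `d ↦ Hom_k(V(d), N)`. -/
def coind (N : M) : LinFun k C M :=
  ⟨V.coindFunctor N, ⟨⟨V.coindAct_add N _ _⟩, ⟨fun g a => V.coindAct_smul N g a⟩⟩⟩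

/-- Evaluation at an element of `V(d)`. -/
def coindπ (N : M) (d : C) : V.hom d →ₗ[k] ((V.coind N).obj.obj d ⟶ N) := cotensor.π N

variable {V}

lemma coind_map_π (N : M) {d e : C} (g : d ⟶ e) (f : V.hom e) :
    (V.coind N).obj.map g ≫ V.coindπ N e f = V.coindπ N d (V.precomp g f) :=
  V.coindAct_π N g f

lemma coind_hom_ext {N Z : M} {d : C} {f g : Z ⟶ (V.coind N).obj.obj d}
    (h : ∀ x, f ≫ V.coindπ N d x = g ≫ V.coindπ N d x) : f = g :=
  cotensor.hom_ext h

/-- The map to a value of a coinduced functor given by a linear map. -/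
def coindLiftApp {N Z : M} {d : C} (θ : V.hom d →ₗ[k] (Z ⟶ N)) : Z ⟶ (V.coind N).obj.obj d :=
  cotensor.lift θ

lemma coindLiftApp_π {N Z : M} {d : C} (θ : V.hom d →ₗ[k] (Z ⟶ N)) (f : V.hom d) :
    coindLiftApp θ ≫ V.coindπ N d f = θ f :=
  cotensor.lift_π _ _

/-- The morphism to a coinduced functor given by a natural family of linear maps. -/
def coindLift {X : LinFun k C M} {N : M} (θ : ∀ d, V.hom d →ₗ[k] (X.obj.obj d ⟶ N))
    (hθ : ∀ {d e : C} (g : d ⟶ e) (f : V.hom e), X.obj.map g ≫ θ e f = θ d (V.precomp g f)) :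
    X ⟶ V.coind N :=
  natMk (fun d => coindLiftApp (θ d)) fun g => coind_hom_ext fun f => by
    rw [Category.assoc, Category.assoc, coind_map_π, coindLiftApp_π, coindLiftApp_π, hθ]

variable (V) in
/-- Functoriality of the coinduced functor in the object of `M`. -/
def coindMap {N N' : M} (g : N ⟶ N') : V.coind N ⟶ V.coind N' :=
  coindLift (fun d => Linear.rightComp k _ g ∘ₗ V.coindπ N d) fun a f => by
    simp only [LinearMap.comp_apply, Linear.rightComp_apply]
    rw [reassoc_of% coind_map_π]

lemma coindMap_π {N N' : M} (g : N ⟶ N') (d : C) (f : V.hom d) :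
    (V.coindMap g).hom.app d ≫ V.coindπ N' d f = V.coindπ N d f ≫ g :=
  coindLiftApp_π _ _

lemma coindMap_comp_eq_zero {N N' N'' : M} (f : N ⟶ N') (g : N' ⟶ N'') (w : f ≫ g = 0) :
    V.coindMap f ≫ V.coindMap g = 0 :=
  linFun_hom_ext fun d => coind_hom_ext fun x => by
    rw [linFun_comp_app, Category.assoc, coindMap_π, reassoc_of% coindMap_π, w, comp_zero,
      linFun_zero_app, zero_comp]

lemma shortExact_coindMap {A B : ObjectProperty M} (h : IsCompleteCotorsionPair A B)
    {S : ShortComplex M} (hS : S.ShortExact) (h₁ : B S.X₁) :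
    (ShortComplex.mk (V.coindMap S.f) (V.coindMap S.g)
      (coindMap_comp_eq_zero _ _ S.zero)).ShortExact :=
  shortExact_of_ev fun d => cotensor.shortExact_map h hS h₁
    (congr_arg (fun z => z.hom.app d) (coindMap_comp_eq_zero (V := V) _ _ S.zero))

end SubTo

namespace ReedyStructure

variable (R : ReedyStructure k C)

/-- The projections of a matching object. -/
def matchingπ (X : LinFun k C M) (d : C) {e : C} (he : R.deg e < R.deg d) :
    R.minus.hom d e →ₗ[k] (R.matchingObj X d ⟶ X.obj.obj e) where
  toFun x := weightedLimit.π (R.minus.homFrom R.deg (R.deg d) d)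
      (R.minus.incl R.deg (R.deg d) ⋙ X.obj) ⟨e, he⟩ x
  map_add' x y := weightedLimit.π_add (R.minus.homFrom R.deg (R.deg d) d)
      (R.minus.incl R.deg (R.deg d) ⋙ X.obj) ⟨e, he⟩ x y
  map_smul' a x := weightedLimit.π_smul (R.minus.homFrom R.deg (R.deg d) d)
      (R.minus.incl R.deg (R.deg d) ⋙ X.obj) ⟨e, he⟩ a x

lemma matchingMap_π (X : LinFun k C M) {d e : C} (he : R.deg e < R.deg d) (x : R.minus.hom d e) :
    R.matchingMap X d ≫ R.matchingπ X d he x = X.obj.map x.1 :=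
  weightedLimit.lift_π (U := R.minus.homFrom R.deg (R.deg d) d)
    (X := R.minus.incl R.deg (R.deg d) ⋙ X.obj) _ (fun f w => X.obj.map_comp w.1 f.1)
    ⟨e, he⟩ x

lemma matchingπ_map (X : LinFun k C M) {d e e' : C} (he : R.deg e < R.deg d)
    (he' : R.deg e' < R.deg d) (x : R.minus.hom d e) {y : e ⟶ e'} (hy : y ∈ R.minus.hom e e') :
    R.matchingπ X d he x ≫ X.obj.map y =
      R.matchingπ X d he' ⟨x.1 ≫ y, R.minus.comp_mem x.2 hy⟩ :=
  (weightedLimit.π_map (R.minus.homFrom R.deg (R.deg d) d)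
    (R.minus.incl R.deg (R.deg d) ⋙ X.obj) (d := ⟨e, he⟩) (d' := ⟨e', he'⟩) ⟨y, hy⟩ x).symm

lemma matching_hom_ext {X : LinFun k C M} {d : C} {Z : M} {f g : Z ⟶ R.matchingObj X d}
    (h : ∀ (e : C) (he : R.deg e < R.deg d) (x : R.minus.hom d e),
      f ≫ R.matchingπ X d he x = g ≫ R.matchingπ X d he x) : f = g :=
  weightedLimit.hom_ext fun e x => h e.1 e.2 x

lemma exists_matchingLift (X : LinFun k C M) (d : C) {Z : M}
    (θ : ∀ (e : C), R.deg e < R.deg d → (R.minus.hom d e →ₗ[k] (Z ⟶ X.obj.obj e)))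
    (hθ : ∀ (e e' : C) (he : R.deg e < R.deg d) (he' : R.deg e' < R.deg d) (x : R.minus.hom d e)
      (y : e ⟶ e') (hy : y ∈ R.minus.hom e e'),
      θ e he x ≫ X.obj.map y = θ e' he' ⟨x.1 ≫ y, R.minus.comp_mem x.2 hy⟩) :
    ∃ t : Z ⟶ R.matchingObj X d, ∀ (e : C) (he : R.deg e < R.deg d) (x : R.minus.hom d e),
      t ≫ R.matchingπ X d he x = θ e he x :=
  have h : ∀ {e e' : R.minus.Below R.deg (R.deg d)} (f : e ⟶ e') (x : R.minus.hom d e.obj),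
      θ e'.obj e'.deg_lt ((R.minus.homFrom R.deg (R.deg d) d).map f x) =
        θ e.obj e.deg_lt x ≫ (R.minus.incl R.deg (R.deg d) ⋙ X.obj).map f := fun {e e'} f x =>
    (hθ e.obj e'.obj e.deg_lt e'.deg_lt x f.1 f.2).symm
  ⟨weightedLimit.lift (U := R.minus.homFrom R.deg (R.deg d) d)
      (X := R.minus.incl R.deg (R.deg d) ⋙ X.obj) (fun e => θ e.obj e.deg_lt) h,
    fun e he x => weightedLimit.lift_π (U := R.minus.homFrom R.deg (R.deg d) d)
      (X := R.minus.incl R.deg (R.deg d) ⋙ X.obj) (fun e => θ e.obj e.deg_lt) h ⟨e, he⟩ x⟩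

attribute [irreducible] matchingπ

/-- The data which identify the restriction of `X` to `C^-` with the functor of linear maps from
`⨁_{e ∈ T} C^+(e, c) ⊗ C^-(-, e)`, a direct summand of `C(-, c)`, to `N`. -/
structure CoindData (T : Set C) (c : C) (N : M) (X : LinFun k C M) where
  /-- The evaluations. -/
  π (d : C) : (d ⟶ c) →ₗ[k] (X.obj.obj d ⟶ N)
  map_π {d e : C} {x : d ⟶ e} (hx : x ∈ R.minus.hom d e) (f : e ⟶ c) :
    X.obj.map x ≫ π e f = π d (x ≫ f)
  π_eq_zero {d e : C} (he : e ∉ T) {n : d ⟶ e} {p : e ⟶ c} (hn : n ∈ R.minus.hom d e)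
    (hp : p ∈ R.plus.hom e c) : π d (n ≫ p) = 0
  hom_ext {d : C} {Z : M} {f g : Z ⟶ X.obj.obj d} : (∀ x, f ≫ π d x = g ≫ π d x) → f = g
  exists_lift {d : C} {Z : M} (l : (d ⟶ c) →ₗ[k] (Z ⟶ N)) :
    (∀ (e : C) (n : d ⟶ e) (p : e ⟶ c), e ∉ T → n ∈ R.minus.hom d e → p ∈ R.plus.hom e c →
      l (n ≫ p) = 0) → ∃ t : Z ⟶ X.obj.obj d, ∀ x, t ≫ π d x = l x

namespace CoindData

variable {R} {T : Set C} {c : C} {N : M} {X : LinFun k C M} (D : R.CoindData T c N X)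
include D

/-- Two maps to a value of `X` agree if they agree on the Reedy composites through `T`. -/
lemma hom_ext' {d : C} {Z : M} {f g : Z ⟶ X.obj.obj d}
    (h : ∀ (e : C) (n : d ⟶ e) (p : e ⟶ c), e ∈ T → n ∈ R.minus.hom d e → p ∈ R.plus.hom e c →
      f ≫ D.π d (n ≫ p) = g ≫ D.π d (n ≫ p)) : f = g := by
  refine D.hom_ext fun x => ?_
  refine R.hom_induction (P := fun x => f ≫ D.π d x = g ≫ D.π d x) (by simp)
    (fun a b ha hb => by rw [map_add, Preadditive.comp_add, Preadditive.comp_add, ha, hb])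
    (fun e n p hn hp => ?_) x
  by_cases he : e ∈ T
  · exact h e n p he hn hp
  · rw [D.π_eq_zero he hn hp, comp_zero, comp_zero]

open Classical in
/-- The matching map is a split epimorphism: `n ≫ p` is sent to the projection at `n` followed by
the evaluation at `p`, if the degree of the middle object is smaller than that of `d`, and to `0`
otherwise. -/
lemma exists_section (d : C) : ∃ s, s ≫ R.matchingMap X d = 𝟙 _ := by
  let φ : ∀ e, R.plus.hom e c →ₗ[k] R.minus.hom d e →ₗ[k] (R.matchingObj X d ⟶ N) := fun e =>
    if h : R.deg e < R.deg d ∧ e ∈ T then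
      ((Linear.comp (S := k) (R.matchingObj X d) (X.obj.obj e) N).compl₁₂ (R.matchingπ X d h.1)
        (D.π e ∘ₗ (R.plus.hom e c).subtype)).flip
    else 0
  have hφ : ∀ (e : C) (he : R.deg e < R.deg d) (n : d ⟶ e) (p : e ⟶ c) (hn : n ∈ R.minus.hom d e),
      p ∈ R.plus.hom e c → R.homDesc φ (n ≫ p) = R.matchingπ X d he ⟨n, hn⟩ ≫ D.π e p := by
    intro e he n p hn hp
    rw [R.homDesc_comp _ hn hp]
    by_cases hT : e ∈ T
    · simp only [φ, dif_pos (And.intro he hT)]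
      rfl
    · simp only [φ, dif_neg (fun h : R.deg e < R.deg d ∧ e ∈ T => hT h.2)]
      have : D.π e p = 0 := by
        have := D.π_eq_zero hT (R.minus.id_mem e) hp
        rwa [Category.id_comp] at this
      rw [this, comp_zero]
      rfl
  obtain ⟨s, hs⟩ := D.exists_lift (R.homDesc φ) (fun e n p he hn hp => by
    rw [R.homDesc_comp _ hn hp]
    simp only [φ, dif_neg (fun h : R.deg e < R.deg d ∧ e ∈ T => he h.2)]
    rfl)
  refine ⟨s, R.matching_hom_ext fun e he x => ?_⟩
  rw [Category.assoc, R.matchingMap_π, Category.id_comp]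
  refine D.hom_ext' fun e' n p he' hn hp => ?_
  rw [Category.assoc, D.map_π x.2, hs]
  by_cases hn0 : n = 0
  · simp [hn0]
  have hlt : R.deg e' < R.deg d := by
    rcases R.minus_deg hn hn0 with rfl | h
    · exact he
    · exact h.trans he
  rw [← Category.assoc, hφ e' hlt _ p (R.minus.comp_mem x.2 hn) hp,
    ← R.matchingπ_map X he hlt x hn, Category.assoc, ← D.map_π hn]

/-- At an object outside `T`, the Reedy composites through `T` start with a morphism that lowers the
degree, so that the matching object determines their values. -/
lemma mono_matchingMap {d : C} (hd : d ∉ T) : Mono (R.matchingMap X d) where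
  right_cancellation f g h := D.hom_ext' fun e n p he hn hp => by
    by_cases hn0 : n = 0
    · simp [hn0]
    have hlt : R.deg e < R.deg d := by
      rcases R.minus_deg hn hn0 with rfl | h
      · exact absurd he hd
      · exact h
    have h1 : D.π d (n ≫ p) = R.matchingMap X d ≫ R.matchingπ X d hlt ⟨n, hn⟩ ≫ D.π e p := by
      rw [reassoc_of% R.matchingMap_π, D.map_π hn]
    rw [h1, ← Category.assoc, h, Category.assoc]

variable {A B : ObjectProperty M} (h : IsCompleteCotorsionPair A B)
include h

/-- The values of `X` are retracts of cotensors of `N`. -/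
lemma right_obj (hN : B N) (d : C) : B (X.obj.obj d) := by
  obtain ⟨r, hr⟩ := D.exists_lift (d := d) (Z := cotensor k (d ⟶ c) N)
    (cotensor.π N ∘ₗ R.proj T d c) (fun e n p he hn hp => by
      rw [LinearMap.comp_apply, R.proj_comp_of_notMem he hn hp, map_zero])
  refine h.right_of_retract (cotensor.right_mem h hN) (cotensor.lift (D.π d)) r
    (D.hom_ext' fun e n p he hn hp => ?_)
  rw [Category.assoc, hr, LinearMap.comp_apply, R.proj_comp_of_mem he hn hp, cotensor.lift_π,
    Category.id_comp]

/-- The matching maps are split epimorphisms, so that their kernels are retracts of the values of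
`X`. -/
lemma epi_and_kernel (hN : B N) (d : C) :
    Epi (R.matchingMap X d) ∧ B (kernel (R.matchingMap X d)) := by
  obtain ⟨s, hs⟩ := D.exists_section d
  refine ⟨epi_of_epi_fac hs, ?_⟩
  refine h.right_of_retract (D.right_obj h hN d) (kernel.ι _)
    (kernel.lift _ (𝟙 _ - R.matchingMap X d ≫ s) ?_) ?_
  · rw [Preadditive.sub_comp, Category.assoc, hs, Category.id_comp, Category.comp_id, sub_self]
  · rw [← cancel_mono (kernel.ι _), Category.assoc, kernel.lift_ι, Preadditive.comp_sub,
      kernel.condition_assoc, zero_comp, sub_zero, Category.comp_id, Category.id_comp]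

lemma psi (hN : B N) : R.Psi B X := D.epi_and_kernel h hN

end CoindData

end ReedyStructure

end Coinduced

/-! ### Latching objects -/

section Latching

variable {k : Type v} [Field k] {C : Type v} [SmallCategory C] [Preadditive C] [Linear k C]
  {M : Type u} [Category.{v} M] [Abelian M] [Linear k M] [HasColimits M]

namespace ReedyStructure

variable (R : ReedyStructure k C)

/-- The canonical maps to a latching object. -/
def latchingι (X : LinFun k C M) (d : C) {e : C} (he : R.deg e < R.deg d) :
    R.plus.hom e d →ₗ[k] (X.obj.obj e ⟶ R.latchingObj X d) where
  toFun x := weightedColimit.ι (R.plus.homTo R.deg (R.deg d) d)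
      (R.plus.incl R.deg (R.deg d) ⋙ X.obj) ⟨e, he⟩ x
  map_add' x y := weightedColimit.ι_add (R.plus.homTo R.deg (R.deg d) d)
      (R.plus.incl R.deg (R.deg d) ⋙ X.obj) ⟨e, he⟩ x y
  map_smul' a x := weightedColimit.ι_smul (R.plus.homTo R.deg (R.deg d) d)
      (R.plus.incl R.deg (R.deg d) ⋙ X.obj) ⟨e, he⟩ a x

lemma latchingι_latchingMap (X : LinFun k C M) {d e : C} (he : R.deg e < R.deg d)
    (x : R.plus.hom e d) : R.latchingι X d he x ≫ R.latchingMap X d = X.obj.map x.1 :=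
  weightedColimit.ι_desc (W := R.plus.homTo R.deg (R.deg d) d)
    (X := R.plus.incl R.deg (R.deg d) ⋙ X.obj) _ (fun f w => X.obj.map_comp f.1 w.1)
    ⟨e, he⟩ x

lemma map_latchingι (X : LinFun k C M) {d e e' : C} (he : R.deg e < R.deg d)
    (he' : R.deg e' < R.deg d) (x : R.plus.hom e d) {y : e' ⟶ e} (hy : y ∈ R.plus.hom e' e) :
    X.obj.map y ≫ R.latchingι X d he x =
      R.latchingι X d he' ⟨y ≫ x.1, R.plus.comp_mem hy x.2⟩ :=
  (weightedColimit.ι_map (R.plus.homTo R.deg (R.deg d) d)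
    (R.plus.incl R.deg (R.deg d) ⋙ X.obj) (d := ⟨e', he'⟩) (d' := ⟨e, he⟩) ⟨y, hy⟩ x).symm

lemma latching_hom_ext {X : LinFun k C M} {d : C} {Z : M} {f g : R.latchingObj X d ⟶ Z}
    (h : ∀ (e : C) (he : R.deg e < R.deg d) (x : R.plus.hom e d),
      R.latchingι X d he x ≫ f = R.latchingι X d he x ≫ g) : f = g :=
  weightedColimit.hom_ext fun e x => h e.1 e.2 x

lemma exists_latchingDesc (X : LinFun k C M) (d : C) {Z : M}
    (θ : ∀ (e : C), R.deg e < R.deg d → (R.plus.hom e d →ₗ[k] (X.obj.obj e ⟶ Z)))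
    (hθ : ∀ (e e' : C) (he : R.deg e < R.deg d) (he' : R.deg e' < R.deg d) (x : R.plus.hom e d)
      (y : e' ⟶ e) (hy : y ∈ R.plus.hom e' e),
      X.obj.map y ≫ θ e he x = θ e' he' ⟨y ≫ x.1, R.plus.comp_mem hy x.2⟩) :
    ∃ t : R.latchingObj X d ⟶ Z, ∀ (e : C) (he : R.deg e < R.deg d) (x : R.plus.hom e d),
      R.latchingι X d he x ≫ t = θ e he x :=
  have h : ∀ {e' e : R.plus.Below R.deg (R.deg d)} (f : e' ⟶ e) (x : R.plus.hom e.obj d),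
      θ e'.obj e'.deg_lt ((R.plus.homTo R.deg (R.deg d) d).map f.op x) =
        (R.plus.incl R.deg (R.deg d) ⋙ X.obj).map f ≫ θ e.obj e.deg_lt x := fun {e' e} f x =>
    (hθ e.obj e'.obj e.deg_lt e'.deg_lt x f.1 f.2).symm
  ⟨weightedColimit.desc (W := R.plus.homTo R.deg (R.deg d) d)
      (X := R.plus.incl R.deg (R.deg d) ⋙ X.obj) (fun e => θ e.obj e.deg_lt) h,
    fun e he x => weightedColimit.ι_desc (W := R.plus.homTo R.deg (R.deg d) d)
      (X := R.plus.incl R.deg (R.deg d) ⋙ X.obj) (fun e => θ e.obj e.deg_lt) h ⟨e, he⟩ x⟩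

attribute [irreducible] latchingι

end ReedyStructure

end Latching

/-! ### Functors of linear maps in the right class -/

section Coinduced

variable {k : Type v} [Field k] {C : Type v} [SmallCategory C] [Preadditive C] [Linear k C]
  {M : Type u} [Category.{v} M] [Abelian M] [Linear k M] [HasLimits M]

variable (k) in
/-- The functor `C(-, c)` itself. -/
def SubTo.top (c : C) : SubTo k c := ⟨fun _ => ⊤, fun _ _ _ => Submodule.mem_top⟩

lemma SubTo.mem_top {c d : C} (f : d ⟶ c) : f ∈ (SubTo.top k c).hom d := Submodule.mem_top

namespace ReedyStructure

variable (R : ReedyStructure k C)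

/-- The subfunctor of `C(-, c)` of the morphisms that factor through objects of degree smaller than
that of `c`. -/
def lowerSubTo (c : C) : SubTo k c := ⟨R.lowerTo c, fun g _ hf => R.comp_mem_lowerTo g hf⟩

/-- The coinduction data of `Hom_k(V(-), N)`, if `V` is the sum of the components of
`C(-, c)` indexed by `T`. -/
def coindData {c : C} (V : SubTo k c) (T : Set C)
    (hV : ∀ (d : C) (f : d ⟶ c), f ∈ V.hom d ↔ R.proj T d c f = f) (N : M) :
    R.CoindData T c N (V.coind N) where
  π d := V.coindπ N d ∘ₗ (R.proj T d c).codRestrict (V.hom d) fun f => by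
    rw [hV, R.proj_proj, Set.inter_self]
  map_π hx f := by
    rw [LinearMap.comp_apply, SubTo.coind_map_π, LinearMap.comp_apply]
    exact congr_arg _ (Subtype.ext (R.minus_comp_proj T hx f))
  π_eq_zero {d e} he {n p} hn hp := by
    rw [LinearMap.comp_apply]
    convert map_zero (V.coindπ N d)
    exact Subtype.ext (R.proj_comp_of_notMem he hn hp)
  hom_ext {d Z f g} h := SubTo.coind_hom_ext fun x => by
    have := h x.1
    rw [LinearMap.comp_apply] at this
    convert this using 3 <;> exact Subtype.ext ((hV d x.1).1 x.2).symm
  exists_lift {d Z} l hl := by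
    refine ⟨SubTo.coindLiftApp (l ∘ₗ (V.hom d).subtype), fun x => ?_⟩
    rw [LinearMap.comp_apply, SubTo.coindLiftApp_π]
    change l (R.proj T d c x) = l x
    refine LinearMap.congr_fun (R.homLin_ext (l := l ∘ₗ R.proj T d c) (l' := l)
      fun e n p hn hp => ?_) x
    rw [LinearMap.comp_apply]
    by_cases he : e ∈ T
    · rw [R.proj_comp_of_mem he hn hp]
    · rw [R.proj_comp_of_notMem he hn hp, map_zero, hl e n p he hn hp]

/-- `C(-, c)` is the sum of all its components. -/
def topData (c : C) (N : M) : R.CoindData Set.univ c N ((SubTo.top k c).coind N) :=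
  R.coindData (SubTo.top k c) Set.univ
    (fun _ f => ⟨fun _ => R.proj_univ f, fun _ => Submodule.mem_top⟩) N

/-- The lower part of `C(-, c)` is the sum of the components indexed by the objects below `c`. -/
def lowerData (c : C) (N : M) : R.CoindData (R.below c) c N ((R.lowerSubTo c).coind N) :=
  R.coindData _ _ (fun _ _ => R.mem_lowerTo) N

/-- Restriction from `Hom_k(C(-, c), N)` to the lower morphisms. -/
def coindRes (c : C) (N : M) : (SubTo.top k c).coind N ⟶ (R.lowerSubTo c).coind N :=
  SubTo.coindLift (fun d => (SubTo.top k c).coindπ N d ∘ₗ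
    Submodule.inclusion (le_top : R.lowerTo c d ≤ ⊤)) fun _ _ => SubTo.coind_map_π _ _ _

lemma coindRes_π (c : C) (N : M) (d : C) (f : (R.lowerSubTo c).hom d) :
    (R.coindRes c N).hom.app d ≫ (R.lowerSubTo c).coindπ N d f =
      (SubTo.top k c).coindπ N d ⟨f.1, SubTo.mem_top _⟩ :=
  SubTo.coindLiftApp_π _ _

lemma epi_coindRes (c : C) (N : M) : Epi (R.coindRes c N) := by
  refine epi_of_app _ fun d => ?_
  have hp : ∀ f : (SubTo.top k c).hom d, R.proj (R.below c) d c f.1 ∈ R.lowerTo c d :=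
    fun f => ⟨_, rfl⟩
  let s : ((R.lowerSubTo c).coind N).obj.obj d ⟶ ((SubTo.top k c).coind N).obj.obj d :=
    SubTo.coindLiftApp ((R.lowerSubTo c).coindπ N d ∘ₗ
      ((R.proj (R.below c) d c) ∘ₗ ((SubTo.top k c).hom d).subtype).codRestrict _ hp)
  refine epi_of_epi_fac (f := s) (h := 𝟙 _) (SubTo.coind_hom_ext fun f => ?_)
  rw [Category.assoc, R.coindRes_π, SubTo.coindLiftApp_π, Category.id_comp]
  have hf : (⟨R.proj (R.below c) d c f.1, hp ⟨f.1, SubTo.mem_top _⟩⟩ :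
      (R.lowerSubTo c).hom d) = f := Subtype.ext (R.mem_lowerTo.1 f.2)
  exact congr_arg _ hf

/-- The functor of linear maps from `C(-, c)` modulo the lower morphisms to `N`. -/
def nabla (c : C) (N : M) : LinFun k C M := kernel (R.coindRes c N)

/-- The inclusion of `nabla c N` into the functor of linear maps from `C(-, c)` to `N`. -/
def nablaι (c : C) (N : M) : R.nabla c N ⟶ (SubTo.top k c).coind N := kernel.ι (R.coindRes c N)

lemma nablaι_coindRes (c : C) (N : M) : R.nablaι c N ≫ R.coindRes c N = 0 := kernel.condition _

lemma shortExact_nabla (c : C) (N : M) : (ShortComplex.mk (R.nablaι c N)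
    (R.coindRes c N) (R.nablaι_coindRes c N)).ShortExact := by
  have := R.epi_coindRes c N
  exact shortExact_kernel _

lemma nablaι_π_lower (c : C) (N : M) (d : C) {f : d ⟶ c} (hf : f ∈ R.lowerTo c d) :
    (R.nablaι c N).hom.app d ≫ (SubTo.top k c).coindπ N d ⟨f, SubTo.mem_top _⟩ = 0 := by
  have h1 := R.coindRes_π c N d ⟨f, hf⟩
  have h2 := congr_arg (fun z => z.hom.app d) (R.nablaι_coindRes c N)
  simp only [linFun_comp_app, linFun_zero_app] at h2
  rw [← h1, ← Category.assoc, h2, zero_comp]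

/-- Every morphism to `c` is the sum of a lower morphism and a morphism of `C^-`. -/
lemma proj_below_add_proj_singleton (c d : C) (f : d ⟶ c) :
    R.proj (R.below c) d c f + R.proj {c} d c f = f := by
  refine R.hom_induction (P := fun f => R.proj (R.below c) d c f + R.proj {c} d c f = f)
    (by simp) (fun f g hf hg => ?_) (fun e n p hn hp => ?_) f
  · conv_rhs => rw [← hf, ← hg]
    rw [map_add, map_add]
    abel
  · by_cases hp0 : p = 0
    · simp [hp0]
    rcases R.plus_deg hp hp0 with rfl | hlt
    · rw [R.proj_comp_of_notMem (T := R.below e) (lt_irrefl (R.deg e)) hn hp,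
        R.proj_comp_of_mem (T := {e}) rfl hn hp, zero_add]
    · rw [R.proj_comp_of_mem (T := R.below c) hlt hn hp, R.proj_comp_of_notMem (T := {c})
        (by rintro rfl; exact lt_irrefl _ hlt) hn hp, add_zero]

/-- The functor of linear maps from `C(-, c)` modulo the lower morphisms, restricted to `C^-`,
consists of the linear maps from `C^-(-, c)`. -/
def nablaData (c : C) (N : M) : R.CoindData {c} c N (R.nabla c N) where
  π d :=
    { toFun := fun f => (R.nablaι c N).hom.app d ≫
        (SubTo.top k c).coindπ N d ⟨R.proj {c} d c f, SubTo.mem_top _⟩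
      map_add' := fun f g => by
        rw [← Preadditive.comp_add, ← map_add]
        exact congr_arg (fun z => _ ≫ (SubTo.top k c).coindπ N d z)
          (Subtype.ext (map_add (R.proj {c} d c) f g))
      map_smul' := fun a f => by
        rw [RingHom.id_apply, ← Linear.comp_smul, ← map_smul]
        exact congr_arg (fun z => _ ≫ (SubTo.top k c).coindπ N d z)
          (Subtype.ext (map_smul (R.proj {c} d c) a f)) }
  map_π {d e x} hx f := by
    change (R.nabla c N).obj.map x ≫ (R.nablaι c N).hom.app e ≫ _ =
      (R.nablaι c N).hom.app d ≫ _
    rw [reassoc_of% linFun_naturality, SubTo.coind_map_π]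
    refine congr_arg (fun z => _ ≫ (SubTo.top k c).coindπ N d z) (Subtype.ext ?_)
    exact R.minus_comp_proj _ hx f
  π_eq_zero {d e} he {n p} hn hp := by
    change (R.nablaι c N).hom.app d ≫ _ = 0
    refine (congr_arg (fun z => _ ≫ (SubTo.top k c).coindπ N d z)
      (Subtype.ext (R.proj_comp_of_notMem he hn hp) :
        _ = (0 : (SubTo.top k c).hom d))).trans ?_
    rw [map_zero, comp_zero]
  hom_ext {d Z f g} h := by
    have := (R.shortExact_nabla c N).mono_f
    have := mono_app (R.nablaι c N) d
    refine (cancel_mono ((R.nablaι c N).hom.app d)).1 ?_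
    refine SubTo.coind_hom_ext fun x => ?_
    have hx : x = ⟨R.proj (R.below c) d c x.1, SubTo.mem_top _⟩ +
        ⟨R.proj {c} d c x.1, SubTo.mem_top _⟩ :=
      Subtype.ext (R.proj_below_add_proj_singleton c d x.1).symm
    rw [hx, map_add, Category.assoc, Category.assoc, Preadditive.comp_add,
      R.nablaι_π_lower c N d ⟨_, rfl⟩, zero_add]
    exact h x.1
  exists_lift {d Z} l hl := by
    have hS := shortExact_ev (R.shortExact_nabla c N) d
    let t : Z ⟶ ((SubTo.top k c).coind N).obj.obj d :=
      SubTo.coindLiftApp (l ∘ₗ ((SubTo.top k c).hom d).subtype)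
    have hlow : l ∘ₗ R.proj (R.below c) d c = 0 := R.homLin_ext fun e n p hn hp => by
      rw [LinearMap.comp_apply, LinearMap.zero_apply]
      by_cases he : e ∈ R.below c
      · rw [R.proj_comp_of_mem he hn hp]
        exact hl e n p (by rintro rfl; exact lt_irrefl (R.deg e) he) hn hp
      · rw [R.proj_comp_of_notMem he hn hp, map_zero]
    have ht : t ≫ (R.coindRes c N).hom.app d = 0 := SubTo.coind_hom_ext fun f => by
      rw [Category.assoc, R.coindRes_π, SubTo.coindLiftApp_π, zero_comp]
      have := LinearMap.congr_fun hlow f.1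
      rw [LinearMap.comp_apply, R.mem_lowerTo.1 f.2] at this
      exact this
    have := hS.mono_f
    let s : Z ⟶ (R.nabla c N).obj.obj d := hS.exact.lift t ht
    refine ⟨s, fun x => ?_⟩
    have h1 : s ≫ (R.nablaι c N).hom.app d = t := hS.exact.lift_f t ht
    change s ≫ (R.nablaι c N).hom.app d ≫ _ = _
    rw [← Category.assoc, h1, SubTo.coindLiftApp_π]
    change l (R.proj {c} d c x) = l x
    conv_rhs => rw [← R.proj_below_add_proj_singleton c d x, map_add]
    have := LinearMap.congr_fun hlow x
    rw [LinearMap.comp_apply] at this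
    rw [this, LinearMap.zero_apply, zero_add]

variable {A B : ObjectProperty M} (h : IsCompleteCotorsionPair A B) {N : M} (hN : B N)
include h hN

lemma psi_top (c : C) : R.Psi B ((SubTo.top k c).coind N) := (R.topData c N).psi h hN

lemma psi_lower (c : C) : R.Psi B ((R.lowerSubTo c).coind N) := (R.lowerData c N).psi h hN

lemma psi_nabla (c : C) : R.Psi B (R.nabla c N) := (R.nablaData c N).psi h hN

end ReedyStructure

end Coinduced

/-! ### Functors without extensions by the right class -/

section LeftClass

variable {k : Type v} [Field k] {C : Type v} [SmallCategory C] [Preadditive C] [Linear k C]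
  {M : Type u} [Category.{v} M] [Abelian M] [Linear k M] [HasLimits M] [HasColimits M]

/-- The morphism `X ⟶ Hom_k(C(-, c), N)` adjoint to `a : X c ⟶ N`. -/
def topLift {X : LinFun k C M} {c : C} {N : M} (a : X.obj.obj c ⟶ N) :
    X ⟶ (SubTo.top k c).coind N :=
  SubTo.coindLift (fun d =>
    { toFun := fun f => X.obj.map f.1 ≫ a
      map_add' := fun f g => by
        rw [← Preadditive.add_comp]
        exact congr_arg (fun z => z ≫ a) X.obj.map_add
      map_smul' := fun r f => by
        rw [RingHom.id_apply, ← Linear.smul_comp]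
        exact congr_arg (fun z => z ≫ a) (X.obj.map_smul r f.1) }) fun g f => by
    change X.obj.map g ≫ X.obj.map f.1 ≫ a = X.obj.map (g ≫ f.1) ≫ a
    rw [X.obj.map_comp, Category.assoc]

lemma topLift_π {X : LinFun k C M} {c : C} {N : M} (a : X.obj.obj c ⟶ N) (d : C)
    (f : (SubTo.top k c).hom d) :
    (topLift a).hom.app d ≫ (SubTo.top k c).coindπ N d f = X.obj.map f.1 ≫ a :=
  SubTo.coindLiftApp_π _ _

lemma topLift_π_id {X : LinFun k C M} {c : C} {N : M} (a : X.obj.obj c ⟶ N) :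
    (topLift a).hom.app c ≫ (SubTo.top k c).coindπ N c ⟨𝟙 c, SubTo.mem_top _⟩ = a := by
  rw [topLift_π, X.obj.map_id, Category.id_comp]

/-- By Yoneda, a morphism to the functor of linear maps from `C(-, c)` to `N` is determined by its
evaluation at `𝟙 c`. -/
lemma app_topπ {X : LinFun k C M} {c : C} {N : M} (ψ : X ⟶ (SubTo.top k c).coind N) {d : C}
    (f : d ⟶ c) :
    ψ.hom.app d ≫ (SubTo.top k c).coindπ N d ⟨f, SubTo.mem_top _⟩ =
      X.obj.map f ≫ ψ.hom.app c ≫ (SubTo.top k c).coindπ N c ⟨𝟙 c, SubTo.mem_top _⟩ := by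
  rw [reassoc_of% linFun_naturality, SubTo.coind_map_π]
  exact congr_arg (fun z => _ ≫ (SubTo.top k c).coindπ N d z)
    (Subtype.ext (Category.comp_id f).symm)

namespace ReedyStructure

variable (R : ReedyStructure k C)

lemma plus_mem_lower {c e : C} (he : R.deg e < R.deg c) {p : e ⟶ c} (hp : p ∈ R.plus.hom e c) :
    p ∈ (R.lowerSubTo c).hom e := by
  have := R.comp_mem_lowerTo_of_plus (𝟙 e) he hp
  rwa [Category.id_comp] at this

section LowerLift

variable {X : LinFun k C M} {c : C} {N : M} (l : R.latchingObj X c ⟶ N)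

open Classical in
/-- The linear map `C(d, c) → Hom(X d, N)` which sends `g ≫ p`, for `p : e ⟶ c` in `C^+` with
`deg e < deg c`, to `X g` followed by the latching inclusion at `p` and `l`, and which vanishes on
the other Reedy composites. -/
def lowerHom (d : C) : (d ⟶ c) →ₗ[k] (X.obj.obj d ⟶ N) :=
  R.homDesc fun e => if he : R.deg e < R.deg c then
      (Linear.comp (S := k) (X.obj.obj d) (X.obj.obj e) N).flip.compl₁₂
        (Linear.rightComp k _ l ∘ₗ R.latchingι X c he)
        ((X.obj.mapLinearMap k (X := d) (Y := e)) ∘ₗ (R.minus.hom d e).subtype)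
    else 0

lemma lowerHom_comp {d e : C} (he : R.deg e < R.deg c) (g : d ⟶ e) {p : e ⟶ c}
    (hp : p ∈ R.plus.hom e c) :
    R.lowerHom l d (g ≫ p) = X.obj.map g ≫ R.latchingι X c he ⟨p, hp⟩ ≫ l := by
  refine R.hom_induction (P := fun g => R.lowerHom l d (g ≫ p) =
      X.obj.map g ≫ R.latchingι X c he ⟨p, hp⟩ ≫ l) (by simp)
    (fun g g' hg hg' => by
      rw [Preadditive.add_comp, map_add, hg, hg', X.obj.map_add, Preadditive.add_comp])
    (fun b n q hn hq => ?_) g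
  by_cases hq0 : q = 0
  · simp [hq0]
  have hb : R.deg b < R.deg c := by
    rcases R.plus_deg hq hq0 with rfl | hlt
    · exact he
    · exact hlt.trans he
  rw [Category.assoc, lowerHom, R.homDesc_comp _ hn (R.plus.comp_mem hq hp), dif_pos hb,
    X.obj.map_comp, Category.assoc, ← Category.assoc (X.obj.map q),
    R.map_latchingι X he hb ⟨p, hp⟩ hq]
  rfl

lemma map_lowerHom_proj {d e : C} (g : d ⟶ e) (f : e ⟶ c) :
    X.obj.map g ≫ R.lowerHom l e (R.proj (R.below c) e c f) =
      R.lowerHom l d (g ≫ R.proj (R.below c) e c f) := by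
  refine R.hom_induction (P := fun f => X.obj.map g ≫ R.lowerHom l e (R.proj (R.below c) e c f) =
      R.lowerHom l d (g ≫ R.proj (R.below c) e c f)) (by simp)
    (fun f f' hf hf' => by
      rw [map_add, map_add, Preadditive.comp_add, hf, hf', Preadditive.comp_add, map_add])
    (fun b n p hn hp => ?_) f
  by_cases hb : b ∈ R.below c
  · rw [R.proj_comp_of_mem hb hn hp, R.lowerHom_comp l hb n hp, ← Category.assoc g,
      R.lowerHom_comp l hb (g ≫ n) hp, X.obj.map_comp, Category.assoc]
  · rw [R.proj_comp_of_notMem hb hn hp, map_zero, comp_zero, comp_zero, map_zero]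

/-- The morphism from `X` to the functor of linear maps from the lower part of `C(-, c)` to `N`
adjoint to `l : L_c X ⟶ N`. -/
def lowerLift : X ⟶ (R.lowerSubTo c).coind N :=
  SubTo.coindLift (fun d => R.lowerHom l d ∘ₗ ((R.lowerSubTo c).hom d).subtype) fun {d e} g f => by
    have h1 := R.map_lowerHom_proj l g f.1
    rw [R.mem_lowerTo.1 f.2] at h1
    exact h1

lemma lowerLift_π {e : C} (he : R.deg e < R.deg c) (p : R.plus.hom e c) :
    (R.lowerLift l).hom.app e ≫ (R.lowerSubTo c).coindπ N e ⟨p.1, R.plus_mem_lower he p.2⟩ =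
      R.latchingι X c he p ≫ l := by
  refine (SubTo.coindLiftApp_π _ _).trans ?_
  have := R.lowerHom_comp l he (𝟙 e) p.2
  rw [Category.id_comp, X.obj.map_id, Category.id_comp] at this
  exact this

end LowerLift

/-- A morphism to the functor of linear maps from the lower part of `C(-, c)` to `N` gives a map
from the latching object at `c` to `N`. -/
lemma exists_latchingDesc_of_lower {X : LinFun k C M} {c : C} {N : M}
    (ψ : X ⟶ (R.lowerSubTo c).coind N) :
    ∃ t : R.latchingObj X c ⟶ N, ∀ (e : C) (he : R.deg e < R.deg c) (p : R.plus.hom e c),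
      R.latchingι X c he p ≫ t =
        ψ.hom.app e ≫ (R.lowerSubTo c).coindπ N e ⟨p.1, R.plus_mem_lower he p.2⟩ := by
  obtain ⟨t, ht⟩ := R.exists_latchingDesc X c (Z := N)
    (fun e he => Linear.leftComp k N (ψ.hom.app e) ∘ₗ (R.lowerSubTo c).coindπ N e ∘ₗ
      Submodule.inclusion (fun p hp => R.plus_mem_lower he hp :
        R.plus.hom e c ≤ (R.lowerSubTo c).hom e)) (fun e e' he he' x y hy => by
      change X.obj.map y ≫ ψ.hom.app e ≫ _ = ψ.hom.app e' ≫ _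
      rw [reassoc_of% linFun_naturality]
      exact congr_arg (fun z => _ ≫ z) (SubTo.coind_map_π _ _ _))
  exact ⟨t, ht⟩

lemma coindRes_app_π {X : LinFun k C M} {c e : C} {N : M} (ψ : X ⟶ (SubTo.top k c).coind N)
    (f : (R.lowerSubTo c).hom e) :
    (ψ ≫ R.coindRes c N).hom.app e ≫ (R.lowerSubTo c).coindπ N e f =
      ψ.hom.app e ≫ (SubTo.top k c).coindπ N e ⟨f.1, SubTo.mem_top _⟩ := by
  rw [linFun_comp_app, Category.assoc, coindRes_π]

/-- A map out of the latching object extends along the latching map as soon as the adjoint map to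
the lower coinduced functor lifts to the coinduced functor. -/
lemma extends_of_lift {X : LinFun k C M} {c : C} {N : M} {φ : R.latchingObj X c ⟶ N}
    (ψ : X ⟶ (SubTo.top k c).coind N) (hψ : ψ ≫ R.coindRes c N = R.lowerLift φ) :
    ∃ a, R.latchingMap X c ≫ a = φ := by
  refine ⟨ψ.hom.app c ≫ (SubTo.top k c).coindπ N c ⟨𝟙 c, SubTo.mem_top _⟩,
    R.latching_hom_ext fun e he p => ?_⟩
  rw [reassoc_of% R.latchingι_latchingMap, ← app_topπ, ← R.lowerLift_π φ he p, ← hψ,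
    R.coindRes_app_π]

variable {A B : ObjectProperty M} (h : IsCompleteCotorsionPair A B) {X : LinFun k C M}
include h

/-- By adjunction, extensions of `X c` by `N` split if extensions of `X` by the functor of linear
maps from `C(-, c)` to `N` do. -/
lemma left_obj_of_extVanishes {c : C}
    (hX : ∀ N, B N → ExtVanishes X ((SubTo.top k c).coind N) 1) : A (X.obj.obj c) := by
  refine (h.left _).2 fun N hN => extVanishes_one_iff.2 fun E i p w hS => ?_
  obtain ⟨ψ, hψ⟩ := (hX N hN).exists_lift
    (SubTo.shortExact_coindMap (V := SubTo.top k c) h hS hN) (topLift (𝟙 (X.obj.obj c)))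
  refine ⟨ψ.hom.app c ≫ (SubTo.top k c).coindπ E c ⟨𝟙 c, SubTo.mem_top _⟩, ?_⟩
  have h1 := congr_arg (fun z => z.hom.app c ≫
    (SubTo.top k c).coindπ (X.obj.obj c) c ⟨𝟙 c, SubTo.mem_top _⟩) hψ
  simp only [linFun_comp_app] at h1
  rw [topLift_π_id, Category.assoc, SubTo.coindMap_π] at h1
  rw [Category.assoc]
  exact h1

/-- By adjunction, extensions of the latching object by `N` split if extensions of `X` by the
functor of linear maps from the lower part of `C(-, c)` to `N` do. -/
lemma left_latchingObj_of_extVanishes {c : C}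
    (hX : ∀ N, B N → ExtVanishes X ((R.lowerSubTo c).coind N) 1) : A (R.latchingObj X c) := by
  refine (h.left _).2 fun N hN => extVanishes_one_iff.2 fun E i p w hS => ?_
  obtain ⟨ψ, hψ⟩ := (hX N hN).exists_lift
    (SubTo.shortExact_coindMap (V := R.lowerSubTo c) h hS hN)
    (R.lowerLift (𝟙 (R.latchingObj X c)))
  obtain ⟨t, ht⟩ := R.exists_latchingDesc_of_lower ψ
  refine ⟨t, R.latching_hom_ext fun e he x => ?_⟩
  have h1 := congr_arg (fun z => z.hom.app e ≫
    (R.lowerSubTo c).coindπ (R.latchingObj X c) e ⟨x.1, R.plus_mem_lower he x.2⟩) hψ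
  simp only [linFun_comp_app] at h1
  rw [R.lowerLift_π, Category.assoc, SubTo.coindMap_π] at h1
  rw [reassoc_of% ht]
  exact h1

/-- The latching map at `c` is a monomorphism with cokernel in the left class if `X c` lies in the
left class and all maps from the latching object to the right class extend to `X c`. -/
lemma phi_of_extends {c : C} (hc : A (X.obj.obj c))
    (hext : ∀ N, B N → ∀ φ : R.latchingObj X c ⟶ N, ∃ ψ, R.latchingMap X c ≫ ψ = φ) :
    Mono (R.latchingMap X c) ∧ A (cokernel (R.latchingMap X c)) := by
  have hm : Mono (R.latchingMap X c) := by
    obtain ⟨N, i, hi, hN⟩ := h.exists_mono (R.latchingObj X c)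
    obtain ⟨ψ, hψ⟩ := hext N hN i
    exact mono_of_mono_fac hψ
  exact ⟨hm, (h.left _).2 fun N hN => .of_extension (shortExact_cokernel _)
    ((h.left _).1 hc N hN) (hext N hN)⟩

/-- The left orthogonal of `Ψ(B)` is contained in `Φ(A)`: maps from latching objects to `N` extend
because `nabla c N`, the kernel of the restriction to the lower morphisms, lies in `Ψ(B)`. -/
lemma phi_of_extVanishes (hX : ∀ Y, R.Psi B Y → ExtVanishes X Y 1) : R.Phi A X := fun c =>
  R.phi_of_extends h (left_obj_of_extVanishes h fun N hN => hX _ (R.psi_top h hN c))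
    fun N hN φ => by
      obtain ⟨ψ, hψ⟩ := (hX _ (R.psi_nabla h hN c)).exists_lift (R.shortExact_nabla c N)
        (R.lowerLift φ)
      exact R.extends_of_lift ψ hψ

end ReedyStructure

end LeftClass

/-! ### Relative matching maps and the splitting of extensions -/

/-- Well-founded recursion for choices subject to a condition `Q` that involves the choices made
before: the choices can be made for all indices if each can be made whenever the previous ones
satisfy the condition. -/
lemma exists_coherent_choice {ι : Type*} {r : ι → ι → Prop} (hr : WellFounded r)
    (ht : ∀ {a b c}, r a b → r b c → r a c) {T : ι → Type*} [∀ i, Nonempty (T i)]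
    (Q : ∀ i, T i → (∀ j, r j i → T j) → Prop)
    (step : ∀ (i : ι) (prev : ∀ j, r j i → T j),
      (∀ j (hj : r j i), Q j (prev j hj) fun l hl => prev l (ht hl hj)) → ∃ x, Q i x prev) :
    ∃ s : ∀ i, T i, ∀ i, Q i (s i) fun j _ => s j := by
  classical
  let F : ∀ i, (∀ j, r j i → T j) → T i := fun i prev =>
    if h : ∃ x, Q i x prev then h.choose else Classical.arbitrary _
  refine ⟨hr.fix F, fun i => ?_⟩
  induction i using hr.induction with
  | _ i ih =>
    have h := step i (fun j _ => hr.fix F j) ih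
    rw [hr.fix_eq F i]
    have : F i (fun j _ => hr.fix F j) = h.choose := dif_pos h
    rw [this]
    exact h.choose_spec

section Splitting

variable {k : Type v} [Field k] {C : Type v} [SmallCategory C] [Preadditive C] [Linear k C]
  {M : Type u} [Category.{v} M] [Abelian M] [Linear k M] [HasLimits M]

lemma linFun_app_zero (S : ShortComplex (LinFun k C M)) (c : C) :
    S.f.hom.app c ≫ S.g.hom.app c = 0 := (S.map (ev k M c)).zero

lemma linFun_app_exists_lift {S : ShortComplex (LinFun k C M)} (hS : S.ShortExact) {c : C} {Z : M}
    (g : Z ⟶ S.X₂.obj.obj c) (hg : g ≫ S.g.hom.app c = 0) :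
    ∃ t : Z ⟶ S.X₁.obj.obj c, t ≫ S.f.hom.app c = g := by
  have := (shortExact_ev hS c).mono_f
  exact ⟨(shortExact_ev hS c).exact.lift g hg, (shortExact_ev hS c).exact.lift_f g hg⟩

namespace ReedyStructure

variable (R : ReedyStructure k C)

lemma exists_matchingObjMap {X Y : LinFun k C M} (f : X ⟶ Y) (c : C) :
    ∃ t : R.matchingObj X c ⟶ R.matchingObj Y c,
      ∀ (e : C) (he : R.deg e < R.deg c) (x : R.minus.hom c e),
        t ≫ R.matchingπ Y c he x = R.matchingπ X c he x ≫ f.hom.app e :=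
  R.exists_matchingLift Y c
    (fun e he => Linear.rightComp k _ (f.hom.app e) ∘ₗ R.matchingπ X c he)
    fun e e' he he' x y hy => by
      change (R.matchingπ X c he x ≫ f.hom.app e) ≫ _ = R.matchingπ X c he' _ ≫ f.hom.app e'
      rw [Category.assoc, ← linFun_naturality, ← R.matchingπ_map X he he' x hy, Category.assoc]

/-- Functoriality of the matching object. -/
def matchingObjMap {X Y : LinFun k C M} (f : X ⟶ Y) (c : C) :
    R.matchingObj X c ⟶ R.matchingObj Y c := (R.exists_matchingObjMap f c).choose

lemma matchingObjMap_π {X Y : LinFun k C M} (f : X ⟶ Y) {c e : C} (he : R.deg e < R.deg c)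
    (x : R.minus.hom c e) :
    R.matchingObjMap f c ≫ R.matchingπ Y c he x = R.matchingπ X c he x ≫ f.hom.app e :=
  (R.exists_matchingObjMap f c).choose_spec e he x

lemma matchingMap_naturality {X Y : LinFun k C M} (f : X ⟶ Y) (c : C) :
    R.matchingMap X c ≫ R.matchingObjMap f c = f.hom.app c ≫ R.matchingMap Y c :=
  R.matching_hom_ext fun e he x => by
    rw [Category.assoc, Category.assoc, R.matchingObjMap_π, R.matchingMap_π,
      reassoc_of% R.matchingMap_π, linFun_naturality]

lemma matchingObjMap_comp {X Y Z : LinFun k C M} (f : X ⟶ Y) (g : Y ⟶ Z) (c : C) :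
    R.matchingObjMap (f ≫ g) c = R.matchingObjMap f c ≫ R.matchingObjMap g c :=
  R.matching_hom_ext fun e he x => by
    rw [Category.assoc, R.matchingObjMap_π, R.matchingObjMap_π, reassoc_of% R.matchingObjMap_π,
      linFun_comp_app]

lemma matchingObjMap_id (X : LinFun k C M) (c : C) : R.matchingObjMap (𝟙 X) c = 𝟙 _ :=
  R.matching_hom_ext fun e he x => by
    rw [R.matchingObjMap_π, linFun_id_app, Category.comp_id, Category.id_comp]

lemma mono_matchingObjMap {X Y : LinFun k C M} (f : X ⟶ Y) [Mono f] (c : C) :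
    Mono (R.matchingObjMap f c) where
  right_cancellation g g' hg := R.matching_hom_ext fun e he x => by
    have := mono_app f e
    rw [← cancel_mono (f.hom.app e), Category.assoc, Category.assoc, ← R.matchingObjMap_π,
      ← Category.assoc, hg, Category.assoc]

/-- Matching objects preserve kernels. -/
lemma exists_lift_matchingObjMap {S : ShortComplex (LinFun k C M)} (hS : S.ShortExact) {c : C}
    {Z : M} (g : Z ⟶ R.matchingObj S.X₂ c) (hg : g ≫ R.matchingObjMap S.g c = 0) :
    ∃ t, t ≫ R.matchingObjMap S.f c = g := by
  have := hS.mono_f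
  have hm : ∀ e, Mono (S.f.hom.app e) := fun e => mono_app _ e
  have hl : ∀ (e : C) (he : R.deg e < R.deg c) (x : R.minus.hom c e),
      ∃ t : Z ⟶ S.X₁.obj.obj e, t ≫ S.f.hom.app e = g ≫ R.matchingπ S.X₂ c he x :=
    fun e he x => linFun_app_exists_lift hS _ (by
      rw [Category.assoc, ← R.matchingObjMap_π, reassoc_of% hg, zero_comp])
  choose τ hτ using hl
  obtain ⟨t, ht⟩ := R.exists_matchingLift S.X₁ c (Z := Z) (fun e he =>
    { toFun := τ e he
      map_add' := fun x y => by
        rw [← cancel_mono (S.f.hom.app e), Preadditive.add_comp, hτ, hτ, hτ, map_add,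
          Preadditive.comp_add]
      map_smul' := fun a x => by
        rw [← cancel_mono (S.f.hom.app e), RingHom.id_apply, Linear.smul_comp, hτ, hτ, map_smul,
          Linear.comp_smul] }) (fun e e' he he' x y hy => by
      change τ e he x ≫ S.X₁.obj.map y = τ e' he' _
      rw [← cancel_mono (S.f.hom.app e'), Category.assoc, linFun_naturality, reassoc_of% hτ, hτ,
        R.matchingπ_map S.X₂ he he' x hy])
  refine ⟨t, R.matching_hom_ext fun e he x => ?_⟩
  rw [Category.assoc, R.matchingObjMap_π, reassoc_of% ht]
  exact hτ e he x

section Relative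

variable {S : ShortComplex (LinFun k C M)} (hS : S.ShortExact) (c : C)

/-- The relative matching map of an epimorphism `p : E ⟶ X`, from `E c` to the fibre product of the
matching object of `E` and `X c` over the matching object of `X`. -/
def relMatchingMap {E X : LinFun k C M} (p : E ⟶ X) (c : C) :
    E.obj.obj c ⟶ pullback (R.matchingObjMap p c) (R.matchingMap X c) :=
  pullback.lift (R.matchingMap E c) (p.hom.app c) (R.matchingMap_naturality p c)

lemma relMatchingMap_fst {E X : LinFun k C M} (p : E ⟶ X) (c : C) :
    R.relMatchingMap p c ≫ pullback.fst _ _ = R.matchingMap E c := pullback.lift_fst _ _ _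

lemma relMatchingMap_snd {E X : LinFun k C M} (p : E ⟶ X) (c : C) :
    R.relMatchingMap p c ≫ pullback.snd _ _ = p.hom.app c := pullback.lift_snd _ _ _

include hS

/-- The relative matching map of an epimorphism is an epimorphism if the matching map of its kernel
is. Since matching objects need not preserve epimorphisms, the cokernel is shown to vanish by hand.
-/
lemma epi_relMatchingMap (hm : Epi (R.matchingMap S.X₁ c)) : Epi (R.relMatchingMap S.g c) := by
  have := hS.epi_g
  have := hS.mono_f
  have hp := epi_app S.g c
  have hz : S.f.hom.app c ≫ S.g.hom.app c = 0 := linFun_app_zero S c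
  refine Preadditive.epi_of_cancel_zero _ fun {T} g hg => ?_
  have hw : R.matchingObjMap S.f c ≫ R.matchingObjMap S.g c =
      0 ≫ R.matchingMap S.X₃ c := R.matching_hom_ext fun e he x => by
    rw [Category.assoc, R.matchingObjMap_π, reassoc_of% R.matchingObjMap_π, ← linFun_comp_app,
      S.zero, zero_comp, zero_comp, linFun_zero_app, comp_zero]
  let j : R.matchingObj S.X₁ c ⟶ pullback (R.matchingObjMap S.g c) (R.matchingMap S.X₃ c) :=
    pullback.lift _ _ hw
  have hj : R.matchingMap S.X₁ c ≫ j = S.f.hom.app c ≫ R.relMatchingMap S.g c := by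
    apply pullback.hom_ext
    · rw [Category.assoc, Category.assoc, R.relMatchingMap_fst, pullback.lift_fst,
        R.matchingMap_naturality]
    · rw [Category.assoc, Category.assoc, R.relMatchingMap_snd, pullback.lift_snd, comp_zero, hz]
  have hjg : j ≫ g = 0 := by
    rw [← cancel_epi (R.matchingMap S.X₁ c), reassoc_of% hj, hg, comp_zero, comp_zero]
  have hsnd : Epi (pullback.snd (R.matchingObjMap S.g c) (R.matchingMap S.X₃ c)) :=
    epi_of_epi_fac (R.relMatchingMap_snd S.g c)
  -- the kernel of the second projection is the matching object of `S.X₁`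
  have hk : kernel.ι (pullback.snd (R.matchingObjMap S.g c) (R.matchingMap S.X₃ c)) ≫ g = 0 := by
    obtain ⟨t, ht⟩ := R.exists_lift_matchingObjMap hS (kernel.ι (pullback.snd
      (R.matchingObjMap S.g c) (R.matchingMap S.X₃ c)) ≫ pullback.fst _ _) (by
        rw [Category.assoc, pullback.condition, kernel.condition_assoc, zero_comp])
    have : kernel.ι (pullback.snd (R.matchingObjMap S.g c) (R.matchingMap S.X₃ c)) = t ≫ j := by
      apply pullback.hom_ext
      · rw [Category.assoc, pullback.lift_fst, ht]
      · rw [Category.assoc, pullback.lift_snd, comp_zero, kernel.condition]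
    rw [this, Category.assoc, hjg, comp_zero]
  have hK := shortExact_kernel (pullback.snd (R.matchingObjMap S.g c) (R.matchingMap S.X₃ c))
  have hg' : pullback.snd _ _ ≫ hK.exact.desc g hk = g := hK.exact.g_desc g hk
  have : hK.exact.desc g hk = 0 := by
    rw [← cancel_epi (S.g.hom.app c), comp_zero, ← R.relMatchingMap_snd, Category.assoc]
    exact (congr_arg _ hg').trans hg
  rw [← hg', this, comp_zero]

/-- The kernel of the relative matching map of an epimorphism is a retract of the kernel of the
matching map of its kernel. -/
lemma exists_retract_kernel_relMatchingMap : ∃ (i : kernel (R.relMatchingMap S.g c) ⟶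
    kernel (R.matchingMap S.X₁ c)) (r : kernel (R.matchingMap S.X₁ c) ⟶
    kernel (R.relMatchingMap S.g c)), i ≫ r = 𝟙 _ := by
  have := hS.mono_f
  have := mono_app S.f c
  have := R.mono_matchingObjMap S.f c
  obtain ⟨t, ht⟩ := linFun_app_exists_lift hS (kernel.ι (R.relMatchingMap S.g c)) (by
    rw [← R.relMatchingMap_snd, kernel.condition_assoc, zero_comp])
  refine ⟨kernel.lift _ t ?_, kernel.lift _ (kernel.ι _ ≫ S.f.hom.app c) ?_, ?_⟩
  · rw [← cancel_mono (R.matchingObjMap S.f c), Category.assoc, R.matchingMap_naturality,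
      reassoc_of% ht, ← R.relMatchingMap_fst S.g, kernel.condition_assoc, zero_comp, zero_comp]
  · apply pullback.hom_ext
    · rw [Category.assoc, Category.assoc, R.relMatchingMap_fst, ← R.matchingMap_naturality,
        kernel.condition_assoc, zero_comp, zero_comp]
    · rw [Category.assoc, Category.assoc, R.relMatchingMap_snd, linFun_app_zero, comp_zero,
        zero_comp]
  · rw [← cancel_mono (kernel.ι _), Category.assoc, kernel.lift_ι, kernel.lift_ι_assoc, ht,
      Category.id_comp]

end Relative

/-- Naturality on a set of objects closed under passage to lower degrees may be checked on the
morphisms of `C^+` and of `C^-` that change the degree. -/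
lemma naturality_of_plus_of_minus {X E : LinFun k C M} (T : Set C)
    (hT : ∀ a ∈ T, ∀ b, R.deg b < R.deg a → b ∈ T) (σ : ∀ d, d ∈ T → (X.obj.obj d ⟶ E.obj.obj d))
    (hm : ∀ (d e : C) (hd : d ∈ T) (he : e ∈ T) (n : d ⟶ e), n ∈ R.minus.hom d e →
      R.deg e < R.deg d → X.obj.map n ≫ σ e he = σ d hd ≫ E.obj.map n)
    (hp : ∀ (d e : C) (hd : d ∈ T) (he : e ∈ T) (p : d ⟶ e), p ∈ R.plus.hom d e →
      R.deg d < R.deg e → X.obj.map p ≫ σ e he = σ d hd ≫ E.obj.map p)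
    (d e : C) (hd : d ∈ T) (he : e ∈ T) (f : d ⟶ e) :
    X.obj.map f ≫ σ e he = σ d hd ≫ E.obj.map f := by
  have hsmul : ∀ (d : C) (hd : d ∈ T) (a : k),
      X.obj.map (a • 𝟙 d) ≫ σ d hd = σ d hd ≫ E.obj.map (a • 𝟙 d) := fun d hd a => by
    rw [X.obj.map_smul, E.obj.map_smul, X.obj.map_id, E.obj.map_id, Linear.smul_comp,
      Linear.comp_smul, Category.id_comp, Category.comp_id]
  refine R.hom_induction (P := fun f => X.obj.map f ≫ σ e he = σ d hd ≫ E.obj.map f) (by simp)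
    (fun f g hf hg => by rw [X.obj.map_add, E.obj.map_add, Preadditive.add_comp,
      Preadditive.comp_add, hf, hg]) (fun b n p hn hq => ?_) f
  by_cases hn0 : n = 0
  · simp [hn0]
  by_cases hq0 : p = 0
  · simp [hq0]
  have hb : b ∈ T := by
    rcases R.minus_deg hn hn0 with rfl | h
    · exact hd
    · exact hT d hd b h
  have h1 : X.obj.map n ≫ σ b hb = σ d hd ≫ E.obj.map n := by
    rcases R.minus_deg hn hn0 with rfl | h
    · obtain ⟨a, rfl⟩ := R.minus.exists_smul_id (R.minus_inverse.end_equiv b) hn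
      exact hsmul b hb a
    · exact hm d b hd hb n hn h
  have h2 : X.obj.map p ≫ σ e he = σ b hb ≫ E.obj.map p := by
    rcases R.plus_deg hq hq0 with rfl | h
    · obtain ⟨a, rfl⟩ := R.plus.exists_smul_id (R.plus_direct.end_equiv b) hq
      exact hsmul b hb a
    · exact hp b e hb he p hq h
  rw [X.obj.map_comp, E.obj.map_comp, Category.assoc, h2, reassoc_of% h1]

variable [HasColimits M]

/-- The `Ext¹`-group of two functors vanishes if the cokernels of the latching maps of the first
are orthogonal to the kernels of the matching maps of the second: an extension is split by
induction on the degree, where a splitting in the lower degrees is extended to `c` by a lift of the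
latching map of the first functor along the relative matching map of the extension. -/
lemma extVanishes_of_latching_of_matching {X Y : LinFun k C M}
    (hX : ∀ c, Mono (R.latchingMap X c)) (hY : ∀ c, Epi (R.matchingMap Y c))
    (hXY : ∀ c, ExtVanishes (cokernel (R.latchingMap X c)) (kernel (R.matchingMap Y c)) 1) :
    ExtVanishes X Y 1 := by
  refine extVanishes_one_iff.2 fun E i p w hS => ?_
  let Q : ∀ c, (X.obj.obj c ⟶ E.obj.obj c) →
      (∀ d, R.deg d < R.deg c → (X.obj.obj d ⟶ E.obj.obj d)) → Prop := fun c x prev =>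
    x ≫ p.hom.app c = 𝟙 _ ∧
      (∀ (d : C) (hd : R.deg d < R.deg c) (n : c ⟶ d), n ∈ R.minus.hom c d →
        X.obj.map n ≫ prev d hd = x ≫ E.obj.map n) ∧
      (∀ (d : C) (hd : R.deg d < R.deg c) (m : d ⟶ c), m ∈ R.plus.hom d c →
        X.obj.map m ≫ x = prev d hd ≫ E.obj.map m)
  suffices hstep : ∀ c prev, (∀ d hd, Q d (prev d hd) fun e he => prev e (he.trans hd)) →
      ∃ x, Q c x prev by
    have : ∀ c, Nonempty (X.obj.obj c ⟶ E.obj.obj c) := fun _ => ⟨0⟩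
    obtain ⟨s, hs⟩ := exists_coherent_choice (r := fun a b => R.deg a < R.deg b)
      (InvImage.wf R.deg Ordinal.lt_wf) lt_trans Q hstep
    refine ⟨natMk s fun {c d} f => ?_, linFun_hom_ext fun c => (hs c).1⟩
    exact R.naturality_of_plus_of_minus Set.univ (fun _ _ _ _ => Set.mem_univ _) (fun d _ => s d)
      (fun d e _ _ n hn hlt => (hs d).2.1 e hlt n hn)
      (fun d e _ _ m hm hlt => (hs e).2.2 d hlt m hm) c d (Set.mem_univ _) (Set.mem_univ _) f
  intro c prev hprev
  -- the sections in lower degrees induce `a` on the latching object and `b` to the matching object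
  have hnat := R.naturality_of_plus_of_minus (R.below c) (R.below_closed c) prev
    (fun d e hd _ n hn hlt => (hprev d hd).2.1 e hlt n hn)
    (fun d e _ he m hm hlt => (hprev e he).2.2 d hlt m hm)
  obtain ⟨a, ha⟩ := R.exists_latchingDesc X c
    (fun e he => (Linear.leftComp k _ (prev e he)) ∘ₗ
      (E.obj.mapLinearMap k (X := e) (Y := c)) ∘ₗ (R.plus.hom e c).subtype)
    (fun e e' he he' x y hy => by
      change X.obj.map y ≫ prev e he ≫ E.obj.map x.1 = prev e' he' ≫ E.obj.map (y ≫ x.1)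
      rw [reassoc_of% hnat e' e he' he y, E.obj.map_comp])
  obtain ⟨b, hb⟩ := R.exists_matchingLift E c
    (fun e he => (Linear.rightComp k _ (prev e he)) ∘ₗ
      (X.obj.mapLinearMap k (X := c) (Y := e)) ∘ₗ (R.minus.hom c e).subtype)
    (fun e e' he he' x y hy => by
      change (X.obj.map x.1 ≫ prev e he) ≫ E.obj.map y = X.obj.map (x.1 ≫ y) ≫ prev e' he'
      rw [Category.assoc, ← hnat e e' he he' y, X.obj.map_comp, Category.assoc])
  have ha' : ∀ (e : C) (he : R.deg e < R.deg c) (x : R.plus.hom e c),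
    R.latchingι X c he x ≫ a = prev e he ≫ E.obj.map x.1 := ha
  have hb' : ∀ (e : C) (he : R.deg e < R.deg c) (x : R.minus.hom c e),
    b ≫ R.matchingπ E c he x = X.obj.map x.1 ≫ prev e he := hb
  have hbX : b ≫ R.matchingObjMap p c = 𝟙 _ ≫ R.matchingMap X c :=
    R.matching_hom_ext fun e he x => by
      rw [Category.assoc, R.matchingObjMap_π, reassoc_of% hb', (hprev e he).1, Category.comp_id,
        Category.id_comp, R.matchingMap_π]
  have hsq : CommSq a (R.latchingMap X c) (R.relMatchingMap p c) (pullback.lift b (𝟙 _) hbX) :=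
    ⟨by
      apply pullback.hom_ext
      · rw [Category.assoc, Category.assoc, R.relMatchingMap_fst, pullback.lift_fst]
        refine R.latching_hom_ext fun e he x => R.matching_hom_ext fun e' he' y => ?_
        rw [Category.assoc, Category.assoc, R.matchingMap_π, Category.assoc, Category.assoc, hb',
          reassoc_of% ha', reassoc_of% R.latchingι_latchingMap, ← E.obj.map_comp,
          ← X.obj.map_comp_assoc]
        exact (hnat e e' he he' _).symm
      · rw [Category.assoc, Category.assoc, R.relMatchingMap_snd, pullback.lift_snd,
          Category.comp_id]
        refine R.latching_hom_ext fun e he x => ?_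
        rw [reassoc_of% ha', R.latchingι_latchingMap, linFun_naturality,
          reassoc_of% (hprev e he).1]⟩
  have := hX c
  have : Epi (R.relMatchingMap p c) := R.epi_relMatchingMap hS c (hY c)
  obtain ⟨i', r, hir⟩ := R.exists_retract_kernel_relMatchingMap hS c
  have hl := ((hXY c).of_retract_right i' r hir).hasLiftingProperty (R.latchingMap X c)
    (R.relMatchingMap p c)
  refine ⟨hsq.lift, ?_, fun d hd n hn => ?_, fun d hd m hm => ?_⟩
  · rw [← R.relMatchingMap_snd, hsq.fac_right_assoc, pullback.lift_snd]
  · rw [← hb' d hd ⟨n, hn⟩, ← R.matchingMap_π E hd ⟨n, hn⟩, ← R.relMatchingMap_fst p,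
      Category.assoc, hsq.fac_right_assoc, pullback.lift_fst_assoc]
  · rw [← ha' d hd ⟨m, hm⟩, ← R.latchingι_latchingMap X hd ⟨m, hm⟩, Category.assoc, hsq.fac_left]

lemma extVanishes_of_phi_of_psi {A B : ObjectProperty M} (hAB : ∀ X Y, A X → B Y →
    ExtVanishes X Y 1) {X Y : LinFun k C M} (hX : R.Phi A X) (hY : R.Psi B Y) :
    ExtVanishes X Y 1 :=
  R.extVanishes_of_latching_of_matching (fun c => (hX c).1) (fun c => (hY c).1)
    fun c => hAB _ _ (hX c).2 (hY c).2

end ReedyStructure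

end Splitting

/-! ### Induced functors -/

section Induced

variable {k : Type v} [Field k] {C : Type v} [SmallCategory C] [Preadditive C] [Linear k C]
  {M : Type u} [Category.{v} M] [Abelian M] [Linear k M]

/-- A `k`-linear subfunctor of the covariant functor `C(c, -)`. -/
structure SubFrom (k : Type v) [Field k] {C : Type v} [SmallCategory C] [Preadditive C]
    [Linear k C] (c : C) where
  /-- The morphisms in the subfunctor. -/
  hom (d : C) : Submodule k (c ⟶ d)
  comp_mem {d e : C} {f : c ⟶ d} (g : d ⟶ e) : f ∈ hom d → f ≫ g ∈ hom e

variable (k) in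
/-- The functor `C(c, -)` itself. -/
def SubFrom.top (c : C) : SubFrom k c := ⟨fun _ => ⊤, fun _ _ => Submodule.mem_top⟩

lemma SubFrom.mem_top {c d : C} (f : c ⟶ d) : f ∈ (SubFrom.top k c).hom d := Submodule.mem_top

namespace SubFrom

variable {c : C} (V : SubFrom k c)

/-- Postcomposition with a morphism, as a linear map. -/
def postcomp {d e : C} (g : d ⟶ e) : V.hom d →ₗ[k] V.hom e :=
  (Linear.rightComp k c g).restrict fun _ hf => V.comp_mem g hf

lemma postcomp_id (d : C) (f : V.hom d) : V.postcomp (𝟙 d) f = f :=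
  Subtype.ext (Category.comp_id f.1)

lemma postcomp_comp {d e b : C} (g : d ⟶ e) (g' : e ⟶ b) (f : V.hom d) :
    V.postcomp (g ≫ g') f = V.postcomp g' (V.postcomp g f) :=
  Subtype.ext (Category.assoc f.1 g g').symm

lemma postcomp_add {d e : C} (g g' : d ⟶ e) (f : V.hom d) :
    V.postcomp (g + g') f = V.postcomp g f + V.postcomp g' f :=
  Subtype.ext (Preadditive.comp_add _ _ _ f.1 g g')

lemma postcomp_smul {d e : C} (a : k) (g : d ⟶ e) (f : V.hom d) :
    V.postcomp (a • g) f = a • V.postcomp g f :=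
  Subtype.ext (Linear.comp_smul _ _ _ f.1 a g)

variable [HasColimits M]

/-- The action of a morphism on `V(-) ⊗ N`. -/
def indAct (N : M) {d e : C} (g : d ⟶ e) : tensor k (V.hom d) N ⟶ tensor k (V.hom e) N :=
  tensor.desc (tensor.ι N ∘ₗ V.postcomp g)

lemma ι_indAct (N : M) {d e : C} (g : d ⟶ e) (f : V.hom d) :
    tensor.ι N f ≫ V.indAct N g = tensor.ι N (V.postcomp g f) :=
  tensor.ι_desc _ _

lemma indAct_id (N : M) (d : C) : V.indAct N (𝟙 d) = 𝟙 _ :=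
  tensor.hom_ext fun x => by rw [ι_indAct, postcomp_id, Category.comp_id]

lemma indAct_comp (N : M) {d e b : C} (g : d ⟶ e) (g' : e ⟶ b) :
    V.indAct N (g ≫ g') = V.indAct N g ≫ V.indAct N g' :=
  tensor.hom_ext fun x => by
    rw [ι_indAct, ← Category.assoc, ι_indAct, ι_indAct, postcomp_comp]

lemma indAct_add (N : M) {d e : C} (g g' : d ⟶ e) :
    V.indAct N (g + g') = V.indAct N g + V.indAct N g' :=
  tensor.hom_ext fun x => by
    rw [Preadditive.comp_add, ι_indAct, ι_indAct, ι_indAct, postcomp_add, map_add]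

lemma indAct_smul (N : M) {d e : C} (g : d ⟶ e) (a : k) :
    V.indAct N (a • g) = a • V.indAct N g :=
  tensor.hom_ext fun x => by
    rw [Linear.comp_smul, ι_indAct, ι_indAct, postcomp_smul, map_smul]

/-- The underlying functor of `ind`. -/
def indFunctor (N : M) : C ⥤ M where
  obj d := tensor k (V.hom d) N
  map g := V.indAct N g
  map_id d := V.indAct_id N d
  map_comp g g' := V.indAct_comp N g g'

/-- The functor `d ↦ V(d) ⊗ N`. -/
def ind (N : M) : LinFun k C M :=
  ⟨V.indFunctor N, ⟨⟨V.indAct_add N _ _⟩, ⟨fun g a => V.indAct_smul N g a⟩⟩⟩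

/-- The canonical map at an element of `V(d)`. -/
def indι (N : M) (d : C) : V.hom d →ₗ[k] (N ⟶ (V.ind N).obj.obj d) := tensor.ι N

variable {V}

lemma indι_map (N : M) {d e : C} (g : d ⟶ e) (f : V.hom d) :
    V.indι N d f ≫ (V.ind N).obj.map g = V.indι N e (V.postcomp g f) :=
  V.ι_indAct N g f

lemma ind_hom_ext {N Z : M} {d : C} {f g : (V.ind N).obj.obj d ⟶ Z}
    (h : ∀ x, V.indι N d x ≫ f = V.indι N d x ≫ g) : f = g :=
  tensor.hom_ext h

/-- The map from a value of an induced functor given by a linear map. -/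
def indDescApp {N Z : M} {d : C} (θ : V.hom d →ₗ[k] (N ⟶ Z)) : (V.ind N).obj.obj d ⟶ Z :=
  tensor.desc θ

lemma ι_indDescApp {N Z : M} {d : C} (θ : V.hom d →ₗ[k] (N ⟶ Z)) (f : V.hom d) :
    V.indι N d f ≫ indDescApp θ = θ f :=
  tensor.ι_desc _ _

/-- The morphism from an induced functor given by a natural family of linear maps. -/
def indDesc {Y : LinFun k C M} {N : M} (θ : ∀ d, V.hom d →ₗ[k] (N ⟶ Y.obj.obj d))
    (hθ : ∀ {d e : C} (g : d ⟶ e) (f : V.hom d), θ d f ≫ Y.obj.map g = θ e (V.postcomp g f)) :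
    V.ind N ⟶ Y :=
  natMk (fun d => indDescApp (θ d)) fun g => ind_hom_ext fun f => by
    rw [← Category.assoc, ← Category.assoc, indι_map, ι_indDescApp, ι_indDescApp, hθ]

variable (V) in
/-- Functoriality of the induced functor in the object of `M`. -/
def indMap {N N' : M} (g : N ⟶ N') : V.ind N ⟶ V.ind N' :=
  indDesc (fun d => Linear.leftComp k _ g ∘ₗ V.indι N' d) fun a f => by
    simp only [LinearMap.comp_apply, Linear.leftComp_apply]
    rw [Category.assoc, indι_map]

lemma ι_indMap {N N' : M} (g : N ⟶ N') (d : C) (f : V.hom d) :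
    V.indι N d f ≫ (V.indMap g).hom.app d = g ≫ V.indι N' d f :=
  ι_indDescApp _ _

lemma indMap_comp_eq_zero {N N' N'' : M} (f : N ⟶ N') (g : N' ⟶ N'') (w : f ≫ g = 0) :
    V.indMap f ≫ V.indMap g = 0 :=
  linFun_hom_ext fun d => ind_hom_ext fun x => by
    rw [linFun_comp_app, reassoc_of% ι_indMap, ι_indMap, reassoc_of% w, zero_comp,
      linFun_zero_app, comp_zero]

lemma shortExact_indMap {A B : ObjectProperty M} (h : IsCompleteCotorsionPair A B)
    {S : ShortComplex M} (hS : S.ShortExact) (h₃ : A S.X₃) :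
    (ShortComplex.mk (V.indMap S.f) (V.indMap S.g)
      (indMap_comp_eq_zero _ _ S.zero)).ShortExact :=
  shortExact_of_ev fun d => tensor.shortExact_map h hS h₃
    (congr_arg (fun z => z.hom.app d) (indMap_comp_eq_zero (V := V) _ _ S.zero))

lemma left_ind {A B : ObjectProperty M} (h : IsCompleteCotorsionPair A B) {N : M} (hN : A N)
    (d : C) : A ((V.ind N).obj.obj d) := tensor.left_mem h hN

end SubFrom

variable [HasColimits M]

/-- The morphism `C(c, -) ⊗ N ⟶ Y` adjoint to `a : N ⟶ Y c`. -/
def topDesc {Y : LinFun k C M} {c : C} {N : M} (a : N ⟶ Y.obj.obj c) :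
    (SubFrom.top k c).ind N ⟶ Y :=
  SubFrom.indDesc (fun d => Linear.leftComp k _ a ∘ₗ (Y.obj.mapLinearMap k (X := c) (Y := d)) ∘ₗ
      ((SubFrom.top k c).hom d).subtype) fun g f => by
    change (a ≫ Y.obj.map f.1) ≫ Y.obj.map g = a ≫ Y.obj.map (f.1 ≫ g)
    rw [Y.obj.map_comp, Category.assoc]

lemma ι_topDesc {Y : LinFun k C M} {c : C} {N : M} (a : N ⟶ Y.obj.obj c) (d : C)
    (f : (SubFrom.top k c).hom d) :
    (SubFrom.top k c).indι N d f ≫ (topDesc a).hom.app d = a ≫ Y.obj.map f.1 :=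
  SubFrom.ι_indDescApp _ _

/-- By Yoneda, a morphism out of `C(c, -) ⊗ N` is determined by its restriction to `𝟙 c`. -/
lemma ι_top_app {Y : LinFun k C M} {c : C} {N : M} (ψ : (SubFrom.top k c).ind N ⟶ Y) {d : C}
    (f : c ⟶ d) :
    (SubFrom.top k c).indι N d ⟨f, SubFrom.mem_top _⟩ ≫ ψ.hom.app d =
      ((SubFrom.top k c).indι N c ⟨𝟙 c, SubFrom.mem_top _⟩ ≫ ψ.hom.app c) ≫ Y.obj.map f := by
  rw [Category.assoc, ← linFun_naturality, ← Category.assoc _ _ (ψ.hom.app d), SubFrom.indι_map]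
  exact congr_arg (fun z => (SubFrom.top k c).indι N d z ≫ _)
    (Subtype.ext (Category.id_comp f).symm)

lemma top_hom_ext {Y : LinFun k C M} {c : C} {N : M} {ψ ψ' : (SubFrom.top k c).ind N ⟶ Y}
    (h : (SubFrom.top k c).indι N c ⟨𝟙 c, SubFrom.mem_top _⟩ ≫ ψ.hom.app c =
      (SubFrom.top k c).indι N c ⟨𝟙 c, SubFrom.mem_top _⟩ ≫ ψ'.hom.app c) : ψ = ψ' :=
  linFun_hom_ext fun d => SubFrom.ind_hom_ext fun f => by
    have h1 := ι_top_app ψ f.1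
    rw [h, ← ι_top_app] at h1
    exact h1

lemma ι_id_topDesc {Y : LinFun k C M} {c : C} {N : M} (a : N ⟶ Y.obj.obj c) :
    (SubFrom.top k c).indι N c ⟨𝟙 c, SubFrom.mem_top _⟩ ≫ (topDesc a).hom.app c = a := by
  rw [ι_topDesc, Y.obj.map_id, Category.comp_id]

namespace ReedyStructure

variable (R : ReedyStructure k C)

open Classical in
/-- The latching maps of `C(c, -) ⊗ N` are split monomorphisms. -/
lemma exists_retraction_ind (c d : C) (N : M) :
    ∃ r, R.latchingMap ((SubFrom.top k c).ind N) d ≫ r = 𝟙 _ := by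
  let F := (SubFrom.top k c).ind N
  let φ : ∀ e, R.plus.hom e d →ₗ[k] R.minus.hom c e →ₗ[k] (N ⟶ R.latchingObj F d) := fun e =>
    if h : R.deg e < R.deg d then
      ((Linear.comp (S := k) N (F.obj.obj e) (R.latchingObj F d)).compl₁₂
        ((SubFrom.top k c).indι N e ∘ₗ Submodule.inclusion le_top) (R.latchingι F d h)).flip
    else 0
  have hφ : ∀ (e : C) (he : R.deg e < R.deg d) (n : c ⟶ e) (p : e ⟶ d), n ∈ R.minus.hom c e →
      ∀ hp : p ∈ R.plus.hom e d, R.homDesc φ (n ≫ p) =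
        (SubFrom.top k c).indι N e ⟨n, SubFrom.mem_top _⟩ ≫ R.latchingι F d he ⟨p, hp⟩ := by
    intro e he n p hn hp
    rw [R.homDesc_comp _ hn hp]
    simp only [φ, dif_pos he]
    rfl
  refine ⟨SubFrom.indDescApp (R.homDesc φ ∘ₗ ((SubFrom.top k c).hom d).subtype),
    R.latching_hom_ext fun e he p => ?_⟩
  rw [reassoc_of% R.latchingι_latchingMap, Category.comp_id]
  refine SubFrom.ind_hom_ext fun f => ?_
  rw [← Category.assoc, SubFrom.indι_map, SubFrom.ι_indDescApp]
  change R.homDesc φ (f.1 ≫ p.1) = _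
  obtain ⟨f, hf⟩ := f
  refine R.hom_induction (P := fun f => R.homDesc φ (f ≫ p.1) =
    (SubFrom.top k c).indι N e ⟨f, SubFrom.mem_top _⟩ ≫ R.latchingι F d he p) ?_
    (fun f g hf hg => ?_) (fun b n q hn hq => ?_) f
  · have : (⟨0, SubFrom.mem_top _⟩ : (SubFrom.top k c).hom e) = 0 := rfl
    rw [zero_comp, map_zero, this, map_zero, zero_comp]
  · have : (⟨f + g, SubFrom.mem_top _⟩ : (SubFrom.top k c).hom e) =
      ⟨f, SubFrom.mem_top _⟩ + ⟨g, SubFrom.mem_top _⟩ := rfl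
    rw [Preadditive.add_comp, map_add, hf, hg, this, map_add, Preadditive.add_comp]
  · by_cases hq0 : q = 0
    · have : (⟨n ≫ q, SubFrom.mem_top _⟩ : (SubFrom.top k c).hom e) = 0 :=
        Subtype.ext (by rw [hq0, comp_zero]; rfl)
      rw [this, hq0, comp_zero, zero_comp, map_zero, map_zero, zero_comp]
    have hb : R.deg b < R.deg d := by
      rcases R.plus_deg hq hq0 with rfl | h
      · exact he
      · exact h.trans he
    rw [Category.assoc, hφ b hb n _ hn (R.plus.comp_mem hq p.2), ← R.map_latchingι F he hb p hq,
      ← Category.assoc, SubFrom.indι_map]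
    rfl

lemma phi_top {A B : ObjectProperty M} (h : IsCompleteCotorsionPair A B) {N : M} (hN : A N)
    (c : C) : R.Phi A ((SubFrom.top k c).ind N) := fun d => by
  obtain ⟨r, hr⟩ := R.exists_retraction_ind c d N
  refine ⟨mono_of_mono_fac hr, h.left_of_retract (SubFrom.left_ind h hN d)
    (cokernel.desc _ (𝟙 _ - r ≫ R.latchingMap _ d) ?_) (cokernel.π _) ?_⟩
  · rw [Preadditive.comp_sub, reassoc_of% hr, Category.comp_id, sub_self]
  · rw [← cancel_epi (cokernel.π _), cokernel.π_desc_assoc, Preadditive.sub_comp, Category.assoc,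
      cokernel.condition, comp_zero, sub_zero, Category.id_comp, Category.comp_id]

/-- By adjunction, extensions of `N` by `Y c` split if extensions of `C(c, -) ⊗ N` by `Y` do. -/
lemma right_obj_of_extVanishes {A B : ObjectProperty M} (h : IsCompleteCotorsionPair A B)
    {Y : LinFun k C M} {c : C} (hY : ∀ N, A N → ExtVanishes ((SubFrom.top k c).ind N) Y 1) :
    B (Y.obj.obj c) := by
  refine (h.right _).2 fun N hN => extVanishes_one_iff.2 fun E i p w hS => ?_
  obtain ⟨ψ, hψ⟩ := (hY N hN).exists_extension
    (SubFrom.shortExact_indMap (V := SubFrom.top k c) h hS hN) (topDesc (𝟙 (Y.obj.obj c)))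
  have hr : i ≫ (SubFrom.top k c).indι E c ⟨𝟙 c, SubFrom.mem_top _⟩ ≫ ψ.hom.app c = 𝟙 _ := by
    have h1 := congr_arg (fun z => (SubFrom.top k c).indι (Y.obj.obj c) c
      ⟨𝟙 c, SubFrom.mem_top _⟩ ≫ z.hom.app c) hψ
    simp only [linFun_comp_app] at h1
    rw [ι_id_topDesc, ← Category.assoc, SubFrom.ι_indMap, Category.assoc] at h1
    exact h1
  exact ⟨(ShortComplex.Splitting.ofExactOfRetraction _ hS.exact _ hr hS.epi_g).s,
    (ShortComplex.Splitting.ofExactOfRetraction _ hS.exact _ hr hS.epi_g).s_g⟩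

end ReedyStructure

end Induced

/-! ### Lower morphisms out of an object -/

section Attachment

variable {k : Type v} [Field k] {C : Type v} [SmallCategory C] [Preadditive C] [Linear k C]
  {M : Type u} [Category.{v} M] [Abelian M] [Linear k M] [HasLimits M] [HasColimits M]

lemma linFun_biprod_hom_ext {P Q : LinFun k C M} {d : C} {Z : M}
    {g g' : (P ⊞ Q : LinFun k C M).obj.obj d ⟶ Z}
    (h₁ : (biprod.inl : P ⟶ P ⊞ Q).hom.app d ≫ g = (biprod.inl : P ⟶ P ⊞ Q).hom.app d ≫ g')
    (h₂ : (biprod.inr : Q ⟶ P ⊞ Q).hom.app d ≫ g = (biprod.inr : Q ⟶ P ⊞ Q).hom.app d ≫ g') :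
    g = g' := by
  have h : (biprod.fst : P ⊞ Q ⟶ P).hom.app d ≫ (biprod.inl : P ⟶ P ⊞ Q).hom.app d +
      (biprod.snd : P ⊞ Q ⟶ Q).hom.app d ≫ (biprod.inr : Q ⟶ P ⊞ Q).hom.app d = 𝟙 _ :=
    congr_arg (fun z => z.hom.app d) (biprod.total (X := P) (Y := Q))
  rw [← Category.id_comp g, ← Category.id_comp g', ← h, Preadditive.add_comp,
    Preadditive.add_comp, Category.assoc, Category.assoc, h₁, h₂, Category.assoc, Category.assoc]

namespace ReedyStructure

variable (R : ReedyStructure k C)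

/-- The coefficient of the identity: an endomorphism of `c` is the sum of a lower morphism and a
multiple of the identity. -/
lemma exists_idCoeff (c : C) : ∃ χ : (c ⟶ c) →ₗ[k] k, χ (𝟙 c) = 1 ∧
    ∀ f, R.proj (R.below c) c c f + χ f • 𝟙 c = f := by
  have h1 : (𝟙 c : c ⟶ c) ≠ 0 := fun h => by
    obtain ⟨e⟩ := R.plus_direct.end_equiv c
    have h2 : e.symm 1 = 0 := Subtype.ext (by
      rw [← Category.comp_id (e.symm 1).1, h, comp_zero]; rfl)
    exact one_ne_zero (e.symm.injective (h2.trans (map_zero _).symm))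
  obtain ⟨χ₀, hχ₀⟩ := Module.Projective.exists_dual_ne_zero k h1
  let χ : (c ⟶ c) →ₗ[k] k := (χ₀ (𝟙 c))⁻¹ • χ₀ ∘ₗ R.proj {c} c c
  have hχ : ∀ f, χ f • 𝟙 c = R.proj {c} c c f := fun f => by
    refine R.hom_induction (P := fun f => χ f • 𝟙 c = R.proj {c} c c f) (by simp)
      (fun f g hf hg => by rw [map_add, add_smul, hf, hg, map_add]) (fun e n p hn hp => ?_) f
    by_cases he : e ∈ ({c} : Set C)
    · obtain rfl : e = c := he
      obtain ⟨a, rfl⟩ := R.minus.exists_smul_id (R.minus_inverse.end_equiv e) hn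
      obtain ⟨b, rfl⟩ := R.plus.exists_smul_id (R.plus_direct.end_equiv e) hp
      have : χ ((a • 𝟙 e) ≫ (b • 𝟙 e)) = a * b := by
        simp only [χ, LinearMap.smul_apply, LinearMap.comp_apply]
        rw [R.proj_comp_of_mem (T := {e}) rfl hn hp]
        simp only [Linear.comp_smul, Category.comp_id, map_smul, smul_eq_mul]
        field_simp
      rw [this, R.proj_comp_of_mem (T := {e}) rfl hn hp]
      simpa [mul_smul] using smul_comm a b (𝟙 e)
    · have : χ (n ≫ p) = 0 := by
        simp only [χ, LinearMap.smul_apply, LinearMap.comp_apply,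
          R.proj_comp_of_notMem he hn hp, map_zero, smul_zero]
      rw [this, zero_smul, R.proj_comp_of_notMem he hn hp]
  refine ⟨χ, ?_, fun f => by rw [hχ, R.proj_below_add_proj_singleton]⟩
  have h2 := R.proj_comp_of_mem (T := {c}) rfl (R.minus.id_mem c) (R.plus.id_mem c)
  rw [Category.comp_id] at h2
  simp only [χ, LinearMap.smul_apply, LinearMap.comp_apply, h2, smul_eq_mul]
  exact inv_mul_cancel₀ hχ₀

/-- The subfunctor of `C(c, -)` of the morphisms that factor through objects of degree smaller than
that of `c`. -/
def lowerSubFrom (c : C) : SubFrom k c := ⟨R.lowerFrom c, fun g hf => R.comp_mem_lowerFrom g hf⟩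

lemma minus_mem_lower {c e : C} (he : R.deg e < R.deg c) {n : c ⟶ e} (hn : n ∈ R.minus.hom c e) :
    n ∈ (R.lowerSubFrom c).hom e := by
  have := R.comp_mem_lowerFrom_of_minus (𝟙 e) he hn
  rwa [Category.comp_id] at this

lemma proj_mem_lower {c e : C} (f : c ⟶ e) :
    R.proj (R.below c) c e f ∈ (R.lowerSubFrom c).hom e := ⟨f, rfl⟩

/-- Morphisms out of the tensor product of the lower part of `C(c, -)` with `N` are determined on
the morphisms of `C^-` that start at `c`. -/
lemma lower_ind_hom_ext {c : C} {N : M} {Y : LinFun k C M}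
    {ψ ψ' : (R.lowerSubFrom c).ind N ⟶ Y}
    (h : ∀ (e : C) (he : R.deg e < R.deg c) (n : c ⟶ e) (hn : n ∈ R.minus.hom c e),
      (R.lowerSubFrom c).indι N e ⟨n, R.minus_mem_lower he hn⟩ ≫ ψ.hom.app e =
        (R.lowerSubFrom c).indι N e ⟨n, R.minus_mem_lower he hn⟩ ≫ ψ'.hom.app e) : ψ = ψ' := by
  refine linFun_hom_ext fun d => SubFrom.ind_hom_ext ?_
  suffices h' : ∀ f : c ⟶ d, (R.lowerSubFrom c).indι N d ⟨_, R.proj_mem_lower f⟩ ≫ ψ.hom.app d =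
      (R.lowerSubFrom c).indι N d ⟨_, R.proj_mem_lower f⟩ ≫ ψ'.hom.app d by
    intro x
    have hx : x = ⟨_, R.proj_mem_lower x.1⟩ := Subtype.ext (R.mem_lowerFrom.1 x.2).symm
    rw [hx]
    exact h' x.1
  intro f
  refine R.hom_induction (P := fun f =>
    (R.lowerSubFrom c).indι N d ⟨_, R.proj_mem_lower f⟩ ≫ ψ.hom.app d =
      (R.lowerSubFrom c).indι N d ⟨_, R.proj_mem_lower f⟩ ≫ ψ'.hom.app d) ?_
    (fun f g hf hg => ?_) (fun e n p hn hp => ?_) f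
  · have : (⟨_, R.proj_mem_lower (0 : c ⟶ d)⟩ : (R.lowerSubFrom c).hom d) = 0 :=
      Subtype.ext (map_zero _)
    rw [this, map_zero, zero_comp, zero_comp]
  · have : (⟨_, R.proj_mem_lower (f + g)⟩ : (R.lowerSubFrom c).hom d) =
      ⟨_, R.proj_mem_lower f⟩ + ⟨_, R.proj_mem_lower g⟩ := Subtype.ext (map_add _ _ _)
    rw [this, map_add, Preadditive.add_comp, hf, hg, Preadditive.add_comp]
  · by_cases he : e ∈ R.below c
    · have : (⟨_, R.proj_mem_lower (n ≫ p)⟩ : (R.lowerSubFrom c).hom d) =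
          (R.lowerSubFrom c).postcomp p ⟨n, R.minus_mem_lower he hn⟩ :=
        Subtype.ext (R.proj_comp_of_mem he hn hp)
      rw [this, ← SubFrom.indι_map, Category.assoc, Category.assoc, linFun_naturality,
        linFun_naturality, reassoc_of% h e he n hn]
    · have : (⟨_, R.proj_mem_lower (n ≫ p)⟩ : (R.lowerSubFrom c).hom d) = 0 :=
        Subtype.ext (R.proj_comp_of_notMem he hn hp)
      rw [this, map_zero, zero_comp, zero_comp]

section LowerDesc

variable {Y : LinFun k C M} {c : C} {N : M} (l : N ⟶ R.matchingObj Y c)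

open Classical in
/-- The linear map `C(c, d) → Hom(N, Y d)` which sends `n ≫ g`, for `n : c ⟶ e` in `C^-` with
`deg e < deg c`, to `l` followed by the matching projection at `n` and by `Y g`, and which vanishes
on the other Reedy composites. -/
def lowerFromHom (d : C) : (c ⟶ d) →ₗ[k] (N ⟶ Y.obj.obj d) :=
  R.homDesc fun e => if he : R.deg e < R.deg c then
      ((Linear.comp (S := k) N (Y.obj.obj e) (Y.obj.obj d)).compl₁₂
        (Linear.leftComp k _ l ∘ₗ R.matchingπ Y c he)
        ((Y.obj.mapLinearMap k (X := e) (Y := d)) ∘ₗ (R.plus.hom e d).subtype)).flip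
    else 0

lemma lowerFromHom_comp {d e : C} (he : R.deg e < R.deg c) {n : c ⟶ e}
    (hn : n ∈ R.minus.hom c e) (g : e ⟶ d) :
    R.lowerFromHom l d (n ≫ g) = l ≫ R.matchingπ Y c he ⟨n, hn⟩ ≫ Y.obj.map g := by
  refine R.hom_induction (P := fun g => R.lowerFromHom l d (n ≫ g) =
      l ≫ R.matchingπ Y c he ⟨n, hn⟩ ≫ Y.obj.map g) (by simp)
    (fun g g' hg hg' => by
      rw [Preadditive.comp_add, map_add, hg, hg', Y.obj.map_add, Preadditive.comp_add,
        Preadditive.comp_add])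
    (fun b m q hm hq => ?_) g
  by_cases hm0 : m = 0
  · simp [hm0]
  have hb : R.deg b < R.deg c := by
    rcases R.minus_deg hm hm0 with rfl | hlt
    · exact he
    · exact hlt.trans he
  rw [← Category.assoc, lowerFromHom, R.homDesc_comp _ (R.minus.comp_mem hn hm) hq, dif_pos hb,
    Y.obj.map_comp, ← Category.assoc (R.matchingπ Y c he ⟨n, hn⟩),
    R.matchingπ_map Y he hb ⟨n, hn⟩ hm]
  exact Category.assoc _ _ _

lemma lowerFromHom_proj_map {d e : C} (f : c ⟶ d) (g : d ⟶ e) :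
    R.lowerFromHom l d (R.proj (R.below c) c d f) ≫ Y.obj.map g =
      R.lowerFromHom l e (R.proj (R.below c) c d f ≫ g) := by
  refine R.hom_induction (P := fun f => R.lowerFromHom l d (R.proj (R.below c) c d f) ≫
      Y.obj.map g = R.lowerFromHom l e (R.proj (R.below c) c d f ≫ g)) (by simp)
    (fun f f' hf hf' => by
      rw [map_add, map_add, Preadditive.add_comp, hf, hf', Preadditive.add_comp, map_add])
    (fun b n p hn hp => ?_) f
  by_cases hb : b ∈ R.below c
  · rw [R.proj_comp_of_mem hb hn hp, R.lowerFromHom_comp l hb hn p, Category.assoc n,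
      R.lowerFromHom_comp l hb hn (p ≫ g), Y.obj.map_comp, Category.assoc, Category.assoc]
  · rw [R.proj_comp_of_notMem hb hn hp, map_zero, zero_comp, zero_comp, map_zero]

/-- The morphism from the tensor product of the lower part of `C(c, -)` with `N` to `Y` adjoint to
`l : N ⟶ M_c Y`. -/
def lowerDesc : (R.lowerSubFrom c).ind N ⟶ Y :=
  SubFrom.indDesc (fun d => R.lowerFromHom l d ∘ₗ ((R.lowerSubFrom c).hom d).subtype)
    fun {d e} g f => by
      have h1 := R.lowerFromHom_proj_map l f.1 g
      rw [R.mem_lowerFrom.1 f.2] at h1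
      exact h1

lemma ι_lowerDesc {e : C} (he : R.deg e < R.deg c) {n : c ⟶ e} (hn : n ∈ R.minus.hom c e) :
    (R.lowerSubFrom c).indι N e ⟨n, R.minus_mem_lower he hn⟩ ≫ (R.lowerDesc l).hom.app e =
      l ≫ R.matchingπ Y c he ⟨n, hn⟩ := by
  refine (SubFrom.ι_indDescApp _ _).trans ?_
  have := R.lowerFromHom_comp l he hn (𝟙 e)
  rw [Category.comp_id, Y.obj.map_id, Category.comp_id] at this
  exact this

end LowerDesc

/-- The inclusion of the lower part of `C(c, -)` tensored with `N`. -/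
def lowerIncl (c : C) (N : M) : (R.lowerSubFrom c).ind N ⟶ (SubFrom.top k c).ind N :=
  SubFrom.indDesc (fun d => (SubFrom.top k c).indι N d ∘ₗ
    Submodule.inclusion (le_top : R.lowerFrom c d ≤ ⊤)) fun _ _ => SubFrom.indι_map _ _ _

lemma ι_lowerIncl (c : C) (N : M) (d : C) (f : (R.lowerSubFrom c).hom d) :
    (R.lowerSubFrom c).indι N d f ≫ (R.lowerIncl c N).hom.app d =
      (SubFrom.top k c).indι N d ⟨f.1, SubFrom.mem_top _⟩ :=
  SubFrom.ι_indDescApp _ _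

/-- At an object of degree at most `deg c` other than `c`, all morphisms from `c` are lower. -/
lemma isIso_lowerIncl_app (c : C) (N : M) {d : C} (hd : R.deg d ≤ R.deg c) (hdc : d ≠ c) :
    IsIso ((R.lowerIncl c N).hom.app d) := by
  have hf : ∀ f : (SubFrom.top k c).hom d, f.1 ∈ (R.lowerSubFrom c).hom d :=
    fun f => R.mem_lowerFrom_of_deg_le hd hdc f.1
  refine ⟨SubFrom.indDescApp ((R.lowerSubFrom c).indι N d ∘ₗ
    ((SubFrom.top k c).hom d).subtype.codRestrict _ hf), SubFrom.ind_hom_ext fun x => ?_,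
    SubFrom.ind_hom_ext fun x => ?_⟩
  · rw [reassoc_of% R.ι_lowerIncl, SubFrom.ι_indDescApp, Category.comp_id]
    rfl
  · rw [reassoc_of% SubFrom.ι_indDescApp, Category.comp_id]
    exact R.ι_lowerIncl c N d ⟨x.1, hf x⟩

end ReedyStructure

end Attachment

/-! ### Attaching one object -/

section AttachmentStep

variable {k : Type v} [Field k] {C : Type v} [SmallCategory C] [Preadditive C] [Linear k C]
  {M : Type u} [Category.{v} M] [Abelian M] [Linear k M] [HasLimits M] [HasColimits M]

namespace ReedyStructure

variable (R : ReedyStructure k C)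

/-- The matching object at `c` only depends on the values in lower degrees. -/
lemma isIso_matchingObjMap {X Y : LinFun k C M} (f : X ⟶ Y) {c : C}
    (hf : ∀ e, R.deg e < R.deg c → IsIso (f.hom.app e)) : IsIso (R.matchingObjMap f c) := by
  obtain ⟨t, ht⟩ := R.exists_matchingLift X c (Z := R.matchingObj Y c)
    (fun e he => have := hf e he
      Linear.rightComp k _ (inv (f.hom.app e)) ∘ₗ R.matchingπ Y c he)
    (fun e e' he he' x y hy => by
      have := hf e he
      have := hf e' he'
      change (R.matchingπ Y c he x ≫ inv (f.hom.app e)) ≫ X.obj.map y =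
        R.matchingπ Y c he' _ ≫ inv (f.hom.app e')
      rw [← cancel_mono (f.hom.app e'), Category.assoc, Category.assoc, Category.assoc,
        linFun_naturality, IsIso.inv_hom_id_assoc, IsIso.inv_hom_id, Category.comp_id,
        R.matchingπ_map Y he he' x hy])
  have ht' : ∀ (e : C) (he : R.deg e < R.deg c) (x : R.minus.hom c e),
      t ≫ R.matchingπ X c he x ≫ f.hom.app e = R.matchingπ Y c he x := fun e he x => by
    have := hf e he
    rw [reassoc_of% ht]
    change (R.matchingπ Y c he x ≫ inv (f.hom.app e)) ≫ _ = _
    rw [Category.assoc, IsIso.inv_hom_id, Category.comp_id]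
  refine ⟨t, R.matching_hom_ext fun e he x => ?_, R.matching_hom_ext fun e he x => ?_⟩
  · have := hf e he
    rw [← cancel_mono (f.hom.app e), Category.assoc, Category.assoc, ht', R.matchingObjMap_π,
      Category.id_comp]
  · rw [Category.assoc, R.matchingObjMap_π, ht', Category.id_comp]

section Attach

variable {Z : LinFun k C M} {c : C} {N : M} (i : Z.obj.obj c ⟶ N) (p : N ⟶ R.matchingObj Z c)

/-- The attaching map: `C(c, -) ⊗ Z c` maps to `Z` by the action of `Z`, and the lower part of
`C(c, -) ⊗ N` by the adjoint of `p`, a map from `N` to the matching object of `Z` at `c`. -/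
def attachLeft : (SubFrom.top k c).ind (Z.obj.obj c) ⊞ (R.lowerSubFrom c).ind N ⟶ Z :=
  biprod.desc (topDesc (𝟙 _)) (R.lowerDesc p)

/-- The map along which `C(c, -) ⊗ N` is attached to `Z`. Its pushout along `attachLeft` replaces
`Z c` by `N` and the matching map by `p`. -/
def attachRight : ((SubFrom.top k c).ind (Z.obj.obj c) ⊞ (R.lowerSubFrom c).ind N : LinFun k C M) ⟶
    (SubFrom.top k c).ind N :=
  biprod.desc ((SubFrom.top k c).indMap i) (R.lowerIncl c N)

variable {i p} (hip : i ≫ p = R.matchingMap Z c) {Z' : LinFun k C M} {u : Z ⟶ Z'}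
  {v : (SubFrom.top k c).ind N ⟶ Z'} (hpo : IsPushout (R.attachLeft p) (R.attachRight i) u v)

include hip in
lemma lower_compat : (R.lowerSubFrom c).indMap i ≫ R.lowerDesc p =
    R.lowerIncl c (Z.obj.obj c) ≫ topDesc (𝟙 _) := R.lower_ind_hom_ext fun e he n hn => by
  rw [linFun_comp_app, linFun_comp_app, reassoc_of% SubFrom.ι_indMap, R.ι_lowerDesc p he hn,
    reassoc_of% R.ι_lowerIncl, reassoc_of% hip, R.matchingMap_π, ι_topDesc, Category.id_comp]

include hip in
/-- `i` followed by the attaching map at a lower morphism `f` is `Z f`. -/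
lemma lower_compat_app {d : C} (f : (R.lowerSubFrom c).hom d) :
    i ≫ (R.lowerSubFrom c).indι N d f ≫ (R.lowerDesc p).hom.app d = Z.obj.map f.1 := by
  have h1 := congr_arg (fun z => (R.lowerSubFrom c).indι _ d f ≫ z.hom.app d) (R.lower_compat hip)
  simp only [linFun_comp_app] at h1
  rw [reassoc_of% SubFrom.ι_indMap, reassoc_of% R.ι_lowerIncl, ι_topDesc, Category.id_comp] at h1
  exact h1

include hpo

lemma attach_w_left : topDesc (𝟙 _) ≫ u = (SubFrom.top k c).indMap i ≫ v := by
  have := congr_arg (fun z => biprod.inl ≫ z) hpo.w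
  simpa [attachLeft, attachRight] using this

lemma attach_w_right : R.lowerDesc p ≫ u = R.lowerIncl c N ≫ v := by
  have := congr_arg (fun z => biprod.inr ≫ z) hpo.w
  simpa [attachLeft, attachRight] using this

lemma attach_exists_desc {d : C} {T : M} (g : Z.obj.obj d ⟶ T)
    (g' : ((SubFrom.top k c).ind N).obj.obj d ⟶ T)
    (h₁ : (topDesc (𝟙 (Z.obj.obj c))).hom.app d ≫ g =
      ((SubFrom.top k c).indMap i).hom.app d ≫ g')
    (h₂ : (R.lowerDesc p).hom.app d ≫ g = (R.lowerIncl c N).hom.app d ≫ g') :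
    ∃ t : Z'.obj.obj d ⟶ T, u.hom.app d ≫ t = g ∧ v.hom.app d ≫ t = g' := by
  have hd : IsPushout ((R.attachLeft p).hom.app d) ((R.attachRight i).hom.app d) (u.hom.app d)
    (v.hom.app d) := hpo.map (ev k M d)
  have h1 : (R.attachLeft p).hom.app d ≫ g = (R.attachRight i).hom.app d ≫ g' := by
    refine linFun_biprod_hom_ext ?_ ?_
    · rw [← Category.assoc, ← Category.assoc, ← linFun_comp_app, ← linFun_comp_app, attachLeft,
        attachRight, biprod.inl_desc, biprod.inl_desc, h₁]
    · rw [← Category.assoc, ← Category.assoc, ← linFun_comp_app, ← linFun_comp_app, attachLeft,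
        attachRight, biprod.inr_desc, biprod.inr_desc, h₂]
  exact ⟨hd.desc g g' h1, hd.inl_desc _ _ _, hd.inr_desc _ _ _⟩

lemma attach_hom_ext {d : C} {T : M} {g g' : Z'.obj.obj d ⟶ T}
    (h₁ : u.hom.app d ≫ g = u.hom.app d ≫ g') (h₂ : v.hom.app d ≫ g = v.hom.app d ≫ g') :
    g = g' := by
  have hd : IsPushout ((R.attachLeft p).hom.app d) ((R.attachRight i).hom.app d) (u.hom.app d)
    (v.hom.app d) := hpo.map (ev k M d)
  exact hd.hom_ext h₁ h₂

lemma attach_map_minus {e : C} (he : R.deg e < R.deg c) {n : c ⟶ e} (hn : n ∈ R.minus.hom c e) :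
    ((SubFrom.top k c).indι N c ⟨𝟙 c, SubFrom.mem_top _⟩ ≫ v.hom.app c) ≫ Z'.obj.map n =
      p ≫ R.matchingπ Z c he ⟨n, hn⟩ ≫ u.hom.app e := by
  rw [← ι_top_app, ← Category.assoc, ← R.ι_lowerDesc p he hn, Category.assoc, ← linFun_comp_app,
    R.attach_w_right hpo, linFun_comp_app, reassoc_of% R.ι_lowerIncl]

lemma attach_fac :
    i ≫ (SubFrom.top k c).indι N c ⟨𝟙 c, SubFrom.mem_top _⟩ ≫ v.hom.app c = u.hom.app c := by
  have h1 := congr_arg (fun z => (SubFrom.top k c).indι _ c ⟨𝟙 c, SubFrom.mem_top _⟩ ≫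
    z.hom.app c) (R.attach_w_left hpo)
  simp only [linFun_comp_app] at h1
  rw [reassoc_of% ι_id_topDesc, reassoc_of% SubFrom.ι_indMap,
    Category.id_comp] at h1
  exact h1.symm

lemma matchingMap_attach :
    ((SubFrom.top k c).indι N c ⟨𝟙 c, SubFrom.mem_top _⟩ ≫ v.hom.app c) ≫ R.matchingMap Z' c =
      p ≫ R.matchingObjMap u c := R.matching_hom_ext fun e he n => by
  rw [Category.assoc, R.matchingMap_π, R.attach_map_minus hpo he n.2, Category.assoc,
    R.matchingObjMap_π]

include hip

/-- Attaching at `c` does not change the values at the other objects of degree at most that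
of `c`. -/
lemma isIso_attach {d : C} (hd : R.deg d ≤ R.deg c) (hdc : d ≠ c) : IsIso (u.hom.app d) := by
  have := R.isIso_lowerIncl_app c N hd hdc
  have := R.isIso_lowerIncl_app c (Z.obj.obj c) hd hdc
  have h1 := congr_arg (fun z => z.hom.app d) (R.lower_compat hip)
  have h2 : (R.lowerSubFrom c).indMap i ≫ R.lowerIncl c N =
      R.lowerIncl c (Z.obj.obj c) ≫ (SubFrom.top k c).indMap i :=
    R.lower_ind_hom_ext fun e he n hn => by
      rw [linFun_comp_app, linFun_comp_app, reassoc_of% SubFrom.ι_indMap,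
        reassoc_of% R.ι_lowerIncl, R.ι_lowerIncl, SubFrom.ι_indMap]
  have h3 := congr_arg (fun z => z.hom.app d) h2
  simp only [linFun_comp_app] at h1 h3
  obtain ⟨t, ht, ht'⟩ := R.attach_exists_desc hpo (d := d) (𝟙 _)
    (inv ((R.lowerIncl c N).hom.app d) ≫ (R.lowerDesc p).hom.app d) (by
      rw [← cancel_epi ((R.lowerIncl c (Z.obj.obj c)).hom.app d), Category.comp_id, ← h1,
        ← Category.assoc, ← h3, Category.assoc, IsIso.hom_inv_id_assoc])
    (by rw [IsIso.hom_inv_id_assoc, Category.comp_id])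
  refine ⟨t, ht, R.attach_hom_ext hpo ?_ ?_⟩
  · rw [reassoc_of% ht, Category.comp_id]
  · have h4 := congr_arg (fun z => z.hom.app d) (R.attach_w_right hpo)
    simp only [linFun_comp_app] at h4
    rw [reassoc_of% ht', h4, IsIso.inv_hom_id_assoc, Category.comp_id]

/-- The value at `c` after attaching `C(c, -) ⊗ N` is `N`. The inverse is induced by `i` on `Z c`
and, on `C(c, c) ⊗ N`, by the decomposition of an endomorphism of `c` into a multiple of the
identity and a lower morphism. -/
lemma isIso_attach_self :
    IsIso ((SubFrom.top k c).indι N c ⟨𝟙 c, SubFrom.mem_top _⟩ ≫ v.hom.app c) := by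
  obtain ⟨χ, hχ1, hχ⟩ := R.exists_idCoeff c
  have hχ0 : ∀ f, f ∈ R.lowerFrom c c → χ f = 0 := fun f hf => by
    have h1 := hχ f
    rw [R.mem_lowerFrom.1 hf, add_eq_left] at h1
    have h2 := congr_arg χ h1
    rwa [map_smul, hχ1, map_zero, smul_eq_mul, mul_one] at h2
  let pr : (c ⟶ c) →ₗ[k] (R.lowerSubFrom c).hom c := (R.proj (R.below c) c c).rangeRestrict
  let low : (c ⟶ c) →ₗ[k] (N ⟶ Z.obj.obj c) :=
    Linear.rightComp k _ ((R.lowerDesc p).hom.app c) ∘ₗ (R.lowerSubFrom c).indι N c ∘ₗ pr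
  have hlow : ∀ f, low f = (R.lowerSubFrom c).indι N c ⟨_, R.proj_mem_lower f⟩ ≫
    (R.lowerDesc p).hom.app c := fun _ => rfl
  have hilow : ∀ f, i ≫ low f = Z.obj.map (R.proj (R.below c) c c f) := fun f => by
    rw [hlow, R.lower_compat_app hip]
  let θ : (c ⟶ c) →ₗ[k] (N ⟶ N) := χ.smulRight (𝟙 N) + Linear.rightComp k _ i ∘ₗ low
  have hθ : ∀ f, θ f = χ f • 𝟙 N + low f ≫ i := fun _ => rfl
  let y : ((SubFrom.top k c).ind N).obj.obj c ⟶ N :=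
    SubFrom.indDescApp (θ ∘ₗ ((SubFrom.top k c).hom c).subtype)
  have hy : ∀ f, (SubFrom.top k c).indι N c f ≫ y = χ f.1 • 𝟙 N + low f.1 ≫ i :=
    fun f => SubFrom.ι_indDescApp _ _
  obtain ⟨t, ht, ht'⟩ := R.attach_exists_desc hpo (d := c) i y
    (SubFrom.ind_hom_ext fun f => by
      rw [reassoc_of% SubFrom.ι_indMap, hy, reassoc_of% ι_topDesc, Preadditive.comp_add,
        reassoc_of% hilow, Linear.comp_smul, Category.comp_id, Category.id_comp]
      conv_lhs => rw [← hχ f.1, Z.obj.map_add, Z.obj.map_smul, Z.obj.map_id, Preadditive.add_comp,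
        Linear.smul_comp, Category.id_comp]
      exact add_comm _ _)
    (SubFrom.ind_hom_ext fun f => by
      rw [reassoc_of% R.ι_lowerIncl, hy, hχ0 _ f.2, zero_smul, zero_add, hlow, Category.assoc]
      have : (⟨_, R.proj_mem_lower f.1⟩ : (R.lowerSubFrom c).hom c) = f :=
        Subtype.ext (R.mem_lowerFrom.1 f.2)
      rw [this])
  have hid : R.proj (R.below c) c c (𝟙 c) = 0 := by
    have := hχ (𝟙 c)
    rwa [hχ1, one_smul, add_eq_right] at this
  have hlow0 : low (𝟙 c) = 0 := by
    rw [hlow]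
    have : (⟨_, R.proj_mem_lower (𝟙 c)⟩ : (R.lowerSubFrom c).hom c) = 0 := Subtype.ext hid
    rw [this, map_zero, zero_comp]
  have h4 := congr_arg (fun z => z.hom.app c) (R.attach_w_right hpo)
  simp only [linFun_comp_app] at h4
  refine ⟨t, ?_, R.attach_hom_ext hpo ?_ (SubFrom.ind_hom_ext fun f => ?_)⟩
  · rw [Category.assoc, ht', hy, hχ1, hlow0, zero_comp, add_zero, one_smul]
  · rw [reassoc_of% ht, R.attach_fac hpo, Category.comp_id]
  · rw [reassoc_of% ht', reassoc_of% hy, Category.comp_id, Preadditive.add_comp, Category.assoc,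
      R.attach_fac hpo, hlow, Category.assoc, h4, reassoc_of% R.ι_lowerIncl, Linear.smul_comp,
      Category.id_comp]
    have hf : (SubFrom.top k c).indι N c f =
        χ f.1 • (SubFrom.top k c).indι N c ⟨𝟙 c, SubFrom.mem_top _⟩ +
          (SubFrom.top k c).indι N c ⟨_, SubFrom.mem_top (R.proj (R.below c) c c f.1)⟩ := by
      rw [← map_smul, ← map_add]
      exact congr_arg _ (Subtype.ext ((add_comm _ _).trans (hχ f.1)).symm)
    rw [hf, Preadditive.add_comp, Linear.smul_comp]

/-- If `i` is a monomorphism with cokernel in the left class, then `Z ⟶ Z'` has the left lifting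
property: by adjunction, a lifting problem against an epimorphism `q` is reduced to a lifting problem
of `i` against the relative matching map of `q`. -/
lemma llp_attach {A B : ObjectProperty M} (h : IsCompleteCotorsionPair A B) (hi : monoWith A i) :
    (epiWith (R.Psi B)).llp u := fun E X q hq => ⟨fun {f g} sq => by
  have := hq.1
  have hS := shortExact_kernel q
  let w := (SubFrom.top k c).indι N c ⟨𝟙 c, SubFrom.mem_top _⟩ ≫ v.hom.app c
  have hw : ∀ (e : C) (he : R.deg e < R.deg c) (n : R.minus.hom c e),
      w ≫ Z'.obj.map n.1 = p ≫ R.matchingπ Z c he n ≫ u.hom.app e :=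
    fun e he n => R.attach_map_minus hpo he n.2
  have hiw : i ≫ w = u.hom.app c := R.attach_fac hpo
  have hsq : ∀ d, f.hom.app d ≫ q.hom.app d = u.hom.app d ≫ g.hom.app d :=
    fun d => congr_arg (fun z => z.hom.app d) sq.w
  have hb : (p ≫ R.matchingObjMap f c) ≫ R.matchingObjMap q c =
      (w ≫ g.hom.app c) ≫ R.matchingMap X c := R.matching_hom_ext fun e he n => by
    rw [Category.assoc, Category.assoc, Category.assoc, Category.assoc, R.matchingMap_π,
      R.matchingObjMap_π, reassoc_of% R.matchingObjMap_π, ← linFun_naturality, hsq,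
      reassoc_of% hw e he n]
  have hcs : CommSq (f.hom.app c) i (R.relMatchingMap q c) (pullback.lift _ _ hb) := ⟨by
    apply pullback.hom_ext
    · rw [Category.assoc, Category.assoc, R.relMatchingMap_fst, pullback.lift_fst,
        reassoc_of% hip, R.matchingMap_naturality]
    · rw [Category.assoc, Category.assoc, R.relMatchingMap_snd, pullback.lift_snd,
        reassoc_of% hiw, hsq]⟩
  have hrel : epiWith B (R.relMatchingMap q c) := by
    obtain ⟨i', r, hir⟩ := R.exists_retract_kernel_relMatchingMap hS c
    exact ⟨R.epi_relMatchingMap hS c (hq.2 c).1, h.right_of_retract (hq.2 c).2 i' r hir⟩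
  have := h.hasLiftingProperty hi hrel
  let t := hcs.lift
  have ht1 : i ≫ t = f.hom.app c := hcs.fac_left
  have ht2 : t ≫ R.matchingMap E c = p ≫ R.matchingObjMap f c := by
    rw [← R.relMatchingMap_fst q, ← Category.assoc, hcs.fac_right, pullback.lift_fst]
  have ht3 : t ≫ q.hom.app c = w ≫ g.hom.app c := by
    rw [← R.relMatchingMap_snd q, ← Category.assoc, hcs.fac_right, pullback.lift_snd]
  have hd : R.attachLeft p ≫ f = R.attachRight i ≫ topDesc t := by
    apply biprod.hom_ext'
    · rw [attachLeft, attachRight, biprod.inl_desc_assoc, biprod.inl_desc_assoc]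
      refine top_hom_ext ?_
      rw [linFun_comp_app, linFun_comp_app, reassoc_of% ι_id_topDesc,
        reassoc_of% SubFrom.ι_indMap, ι_id_topDesc, ht1, Category.id_comp]
    · rw [attachLeft, attachRight, biprod.inr_desc_assoc, biprod.inr_desc_assoc]
      refine R.lower_ind_hom_ext fun e he n hn => ?_
      rw [linFun_comp_app, linFun_comp_app, reassoc_of% R.ι_lowerDesc p he hn,
        reassoc_of% R.ι_lowerIncl, ι_topDesc, ← R.matchingObjMap_π f he ⟨n, hn⟩,
        ← reassoc_of% ht2, R.matchingMap_π]
  refine ⟨⟨hpo.desc _ _ hd, hpo.inl_desc _ _ _, hpo.hom_ext ?_ (top_hom_ext ?_)⟩⟩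
  · rw [hpo.inl_desc_assoc, sq.w]
  · rw [hpo.inr_desc_assoc, linFun_comp_app, linFun_comp_app, reassoc_of% ι_id_topDesc, ht3,
      Category.assoc]⟩

end Attach

/-- The matching map at `c` can be made an epimorphism with kernel in the right class, without
changing the values at the other objects of degree at most that of `c`. -/
lemma exists_attach {A B : ObjectProperty M} (h : IsCompleteCotorsionPair A B)
    (Z : LinFun k C M) (c : C) : ∃ (Z' : LinFun k C M) (u : Z ⟶ Z'), (epiWith (R.Psi B)).llp u ∧
      (∀ d, R.deg d ≤ R.deg c → d ≠ c → IsIso (u.hom.app d)) ∧ epiWith B (R.matchingMap Z' c) := by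
  obtain ⟨N, i, p, hip, hi, hp⟩ := h.exists_factorization (R.matchingMap Z c)
  have hpo := IsPushout.of_hasPushout (R.attachLeft p) (R.attachRight i)
  have hiso : ∀ d, R.deg d ≤ R.deg c → d ≠ c → IsIso ((pushout.inl (R.attachLeft p)
    (R.attachRight i)).hom.app d) := fun d hd hdc => R.isIso_attach hip hpo hd hdc
  have := R.isIso_matchingObjMap (pushout.inl (R.attachLeft p) (R.attachRight i))
    (c := c) fun e he => hiso e he.le (by rintro rfl; exact lt_irrefl _ he)
  have hw := R.isIso_attach_self hip hpo
  refine ⟨_, _, R.llp_attach hip hpo h hi, hiso, ?_⟩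
  have hm := R.matchingMap_attach hpo
  rw [← h.rlp_monoWith] at hp ⊢
  have h1 : (monoWith A).rlp (p ≫ R.matchingObjMap (pushout.inl (R.attachLeft p)
      (R.attachRight i)) c) :=
    MorphismProperty.comp_mem _ _ _ hp (MorphismProperty.of_isIso _ _)
  rw [← hm] at h1
  exact (MorphismProperty.cancel_left_of_respectsIso _ _ _).1 h1

end ReedyStructure

end AttachmentStep

/-! ### Transfinite iteration -/

section Iteration

universe w u'

variable {D : Type u'} [Category.{w} D] {M : Type u} [Category.{v} M]
  {S : Type v} [LinearOrder S] [WellFoundedLT S]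

/-- If each stage `c` can be made good without changing the values at the previous stages, then
all stages can be made good at once, by a transfinite composition. -/
lemma exists_forall_of_step [HasColimitsOfSize.{v, v} D] (T : MorphismProperty D)
    (ev : S → D ⥤ M) [∀ c, PreservesColimitsOfSize.{v, v} (ev c)] (good : D → S → Prop)
    (hgood : ∀ {Z Z' : D} (u : Z ⟶ Z') (c : S), (∀ d ≤ c, IsIso ((ev d).map u)) → good Z c →
      good Z' c)
    (hstep : ∀ (Z : D) (c : S), ∃ (Z' : D) (u : Z ⟶ Z'), T.llp u ∧
      (∀ d < c, IsIso ((ev d).map u)) ∧ good Z' c) (Z : D) :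
    ∃ (Z' : D) (u : Z ⟶ Z'), T.llp u ∧ ∀ c, good Z' c := by
  have step : ∀ Z : D, ∃ (Z' : D) (u : Z ⟶ Z'), T.llp u ∧ ∀ c, (∀ d < c, good Z d) →
      good Z' c ∧ ∀ d < c, IsIso ((ev d).map u) := fun Z => by
    by_cases hZ : ∀ c, good Z c
    · exact ⟨Z, 𝟙 Z, T.llp.id_mem Z, fun c _ => ⟨hZ c, fun d _ => inferInstance⟩⟩
    · -- attach at the first stage that is not good
      push Not at hZ
      obtain ⟨b, hb, hmin⟩ := WellFounded.has_min (wellFounded_lt (α := S)) {c | ¬ good Z c} hZ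
      obtain ⟨Z', u, hu, hiso, hgb⟩ := hstep Z b
      refine ⟨Z', u, hu, fun c hc => ?_⟩
      have hcb : c ≤ b := le_of_not_gt fun h => hb (hc b h)
      refine ⟨?_, fun d hd => hiso d (hd.trans_le hcb)⟩
      rcases hcb.eq_or_lt with rfl | hlt
      · exact hgb
      · exact hgood u c (fun d hd => hiso d (hd.trans_lt hlt)) (not_not.1 fun h => hmin c h hlt)
  choose nxt toNxt hllp hnxt using step
  -- iterate over the stages with a top element added, so that every stage is passed at the end
  let Φ : SmallObject.SuccStruct D := { X₀ := Z, succ := nxt, toSucc := toNxt }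
  let J := WithTop S
  let : SuccOrder J := SuccOrder.ofLinearWellFoundedLT J
  let : OrderBot J := WellFoundedLT.toOrderBot J
  have : HasIterationOfShape J D :=
    { hasColimitsOfShape_of_isSuccLimit := fun _ _ => inferInstance
      hasColimitsOfShape := inferInstance }
  let F := Φ.iterationFunctor J
  have hprop : ∀ {X Y : D} (f : X ⟶ Y), Φ.prop f → T.llp f ∧ ∀ c, (∀ d < c, good X d) →
      good Y c ∧ ∀ d < c, IsIso ((ev d).map f) := fun {X Y} f hf => by
    cases hf with | mk X => exact ⟨hllp X, hnxt X⟩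
  -- the stages before `j` are good at `j`, and values at a stage are constant once it is passed
  have key : ∀ j : J, (∀ c : S, (c : J) < j → good (F.obj j) c) ∧
      ∀ (i : J) (hij : i ≤ j) (c : S), (c : J) < i →
        IsIso ((ev c).map (F.map (homOfLE hij))) := fun j => by
    induction j using SuccOrder.limitRecOn with
    | isMin j hj =>
      exact ⟨fun c hc => (hj.not_lt hc).elim, fun i hij c hc => (hj.not_lt (hc.trans_le hij)).elim⟩
    | succ j hj ih =>
      obtain ⟨ih₁, ih₂⟩ := ih
      obtain ⟨-, hu⟩ := hprop _ (Φ.prop_iterationFunctor_map_succ j hj)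
      refine ⟨fun c hc => ?_, fun i hij c hc => ?_⟩
      · have hcj : (c : J) ≤ j := Order.le_of_lt_succ hc
        exact (hu c fun d hd => ih₁ d ((WithTop.coe_lt_coe.2 hd).trans_le hcj)).1
      · rcases hij.eq_or_lt with rfl | hlt
        · rw [show homOfLE hij = 𝟙 _ from rfl, F.map_id]
          infer_instance
        · have hij' : i ≤ j := Order.le_of_lt_succ hlt
          obtain ⟨s, rfl⟩ := WithTop.ne_top_iff_exists.1
            fun h : j = ⊤ => hj (h ▸ isMax_top)
          have h1 := ih₂ i hij' c hc
          have h2 := (hu s fun d hd => ih₁ d (WithTop.coe_lt_coe.2 hd)).2 c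
            (WithTop.coe_lt_coe.1 (hc.trans_le hij'))
          have h3 : F.map (homOfLE hij) =
              F.map (homOfLE hij') ≫ F.map (homOfLE (Order.le_succ (s : J))) := by
            rw [← F.map_comp]
            rfl
          rw [h3, Functor.map_comp]
          exact IsIso.comp_isIso
    | isSuccLimit j hj ih =>
      have hiso : ∀ (i : J) (hij : i < j) (c : S), (c : J) < i →
          IsIso ((ev c).map (F.map (homOfLE hij.le))) := fun i hij c hc => by
        have hcol := isColimitOfPreserves (ev c) (F.isColimitOfIsWellOrderContinuous j hj)
        have hev : (((Set.principalSegIio j).monotone.functor ⋙ F) ⋙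
            ev c).IsEventuallyConstantFrom ⟨i, hij⟩ := fun i' f =>
          (ih i'.1 i'.2).2 i (leOfHom f) c hc
        have : Nonempty (Set.Iio j) := ⟨⟨i, hij⟩⟩
        exact hev.isIso_ι_of_isColimit hcol
      refine ⟨fun c hc => ?_, fun i hij c hc => ?_⟩
      · have hs : Order.succ (c : J) < j := hj.succ_lt hc
        have hcs : (c : J) < Order.succ (c : J) := Order.lt_succ_of_not_isMax hc.not_isMax
        exact hgood (F.map (homOfLE hs.le)) c (fun d hd => hiso _ hs d
          ((WithTop.coe_le_coe.2 hd).trans_lt hcs)) ((ih _ hs).1 c hcs)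
      · rcases hij.eq_or_lt with rfl | hlt
        · rw [show homOfLE hij = 𝟙 _ from rfl, F.map_id]
          infer_instance
        · exact hiso i hlt c hc
  refine ⟨F.obj ⊤, (Φ.iterationFunctorObjBotIso J).inv ≫ F.map (homOfLE bot_le),
    (MorphismProperty.cancel_left_of_respectsIso _ _ _).2 ?_,
    fun c => (key ⊤).1 c (WithTop.coe_lt_top c)⟩
  have := T.isStableUnderTransfiniteCompositionOfShape_llp (Set.Iic (⊤ : J))
  exact T.llp.transfiniteCompositionsOfShape_le (Set.Iic (⊤ : J)) _
    (((Φ.transfiniteCompositionOfShapeιIteration J).ofLE fun _ _ f hf => (hprop f hf).1).iic ⊤).mem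

end Iteration

/-! ### Embeddings into the right class -/

section Replacement

variable {k : Type v} [Field k] {C : Type v} [SmallCategory C] [Preadditive C] [Linear k C]
  {M : Type u} [Category.{v} M] [Abelian M] [Linear k M] [HasLimits M] [HasColimits M]

namespace ReedyStructure

variable (R : ReedyStructure k C)

/-- The type of objects, without its category structure. It is well-ordered by degree, ties being
broken by an arbitrary well-order of the objects. -/
def Stages (_R : ReedyStructure k C) : Type v := C

/-- The degree, together with the rank in an arbitrary well-order. -/
def Stages.rank (c : R.Stages) : Ordinal.{v} ×ₗ Ordinal.{v} :=
  toLex (R.deg c, Ordinal.typein (α := C) WellOrderingRel c)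

lemma Stages.rank_injective : Function.Injective (Stages.rank R) := fun _ _ h =>
  Ordinal.typein_injective (α := C) WellOrderingRel (Prod.ext_iff.1 (toLex_inj.1 h)).2

instance : LinearOrder R.Stages := LinearOrder.lift' (Stages.rank R) (Stages.rank_injective R)

instance : WellFoundedLT R.Stages :=
  ⟨InvImage.wf (Stages.rank R) (wellFounded_lt (α := Ordinal.{v} ×ₗ Ordinal.{v}))⟩

variable {R} in
lemma Stages.lt_of_deg_lt {c d : R.Stages} (h : R.deg c < R.deg d) : c < d :=
  show Stages.rank R c < Stages.rank R d from Prod.Lex.toLex_lt_toLex.2 (.inl h)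

variable {R} in
lemma Stages.deg_le_of_lt {c d : R.Stages} (h : c < d) : R.deg c ≤ R.deg d := by
  rcases Prod.Lex.toLex_lt_toLex.1 (show Stages.rank R c < Stages.rank R d from h) with h | h
  exacts [h.le, h.1.le]

/-- The condition on the matching map at `c` is preserved by maps that are isomorphisms at `c` and
in lower degrees. -/
lemma epiWith_matchingMap_of_isIso {A B : ObjectProperty M} (h : IsCompleteCotorsionPair A B)
    {Z Z' : LinFun k C M} (u : Z ⟶ Z') (c : C) (hu : IsIso (u.hom.app c))
    (hlow : ∀ e, R.deg e < R.deg c → IsIso (u.hom.app e)) (hZ : epiWith B (R.matchingMap Z c)) :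
    epiWith B (R.matchingMap Z' c) := by
  have := R.isIso_matchingObjMap u hlow
  rw [← h.rlp_monoWith] at hZ ⊢
  have h4 : (monoWith A).rlp (R.matchingMap Z c ≫ R.matchingObjMap u c) :=
    MorphismProperty.comp_mem _ _ _ hZ (MorphismProperty.of_isIso _ _)
  rw [R.matchingMap_naturality] at h4
  exact (MorphismProperty.cancel_left_of_respectsIso _ _ _).1 h4

/-- Every functor maps, by a map with the left lifting property against the epimorphisms with
kernel in `Ψ(B)`, to a functor in `Ψ(B)`. -/
lemma exists_psi {A B : ObjectProperty M} (h : IsCompleteCotorsionPair A B) (Z : LinFun k C M) :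
    ∃ (Z' : LinFun k C M) (u : Z ⟶ Z'), (epiWith (R.Psi B)).llp u ∧ R.Psi B Z' := by
  have hev (c : C) : PreservesColimitsOfSize.{v, v} (ev k M c) := ⟨inferInstance⟩
  have (c : R.Stages) : PreservesColimitsOfSize.{v, v} (ev (C := C) k M c) := hev c
  refine exists_forall_of_step (epiWith (R.Psi B)) (fun c : R.Stages => ev (C := C) k M c)
    (fun Z c => epiWith B (R.matchingMap Z c)) (fun {Z Z'} u c hu hZ => ?_) (fun Z c => ?_) Z
  · exact R.epiWith_matchingMap_of_isIso h u c (hu c le_rfl)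
      (fun e he => hu e (Stages.lt_of_deg_lt he).le) hZ
  · obtain ⟨Z', u, hu, hiso, hgood⟩ := R.exists_attach h Z c
    exact ⟨Z', u, hu, fun d hd => hiso d (Stages.deg_le_of_lt hd) hd.ne, hgood⟩

end ReedyStructure

end Replacement

/-! ### The cotorsion pair on linear functors -/

section CotorsionPair

variable {k : Type v} [Field k] {C : Type v} [SmallCategory C] [Preadditive C] [Linear k C]
  {M : Type u} [Category.{v} M] [Abelian M] [Linear k M] [HasLimits M] [HasColimits M]

lemma ExtVanishes.coproduct {D : Type*} [Category* D] [Abelian D] {ι : Type*} (X : ι → D)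
    [HasCoproduct X] {Y : D} (h : ∀ i, ExtVanishes (X i) Y 1) : ExtVanishes (∐ X) Y 1 :=
  extVanishes_one_iff.2 fun E i p w hS => by
    choose s hs using fun j => (h j).exists_lift hS (Sigma.ι X j)
    exact ⟨Sigma.desc s, Sigma.hom_ext _ _ fun j => by
      rw [Sigma.ι_desc_assoc, Category.comp_id]; exact hs j⟩

namespace ReedyStructure

variable (R : ReedyStructure k C) {A B : ObjectProperty M} (h : IsCompleteCotorsionPair A B)
include h

lemma phi_iff_extVanishes {X : LinFun k C M} :
    R.Phi A X ↔ ∀ Y, R.Psi B Y → ExtVanishes X Y 1 :=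
  ⟨fun hX _ hY => R.extVanishes_of_phi_of_psi (fun _ N hX hN => (h.left _).1 hX N hN) hX hY,
    R.phi_of_extVanishes h⟩

lemma psi_of_retract {Y Y' : LinFun k C M} (hY : R.Psi B Y') (i : Y ⟶ Y') (r : Y' ⟶ Y)
    (hir : i ≫ r = 𝟙 Y) : R.Psi B Y := fun c => by
  have h1 : epiWith B (R.matchingMap Y' c) := hY c
  change epiWith B (R.matchingMap Y c)
  rw [← h.rlp_monoWith] at h1 ⊢
  refine MorphismProperty.of_retract (P := (monoWith A).rlp) (f := R.matchingMap Y c)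
    (g := R.matchingMap Y' c) ?_ h1
  refine
    { i := Arrow.homMk (i.hom.app c) (R.matchingObjMap i c) (R.matchingMap_naturality i c).symm
      r := Arrow.homMk (r.hom.app c) (R.matchingObjMap r c) (R.matchingMap_naturality r c).symm
      retract := Arrow.hom_ext _ _ ?_ ?_ }
  · exact congr_arg (fun z => z.hom.app c) hir
  · change R.matchingObjMap i c ≫ R.matchingObjMap r c = 𝟙 _
    rw [← R.matchingObjMap_comp, hir, R.matchingObjMap_id]

/-- `Z` embeds at `c` because a map from `Z c` to an object of the right class gives, by adjunction,
a map from `Z` to a functor in `Ψ(B)`. -/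
lemma mono_of_llp {Z Z' : LinFun k C M} {u : Z ⟶ Z'} (hu : (epiWith (R.Psi B)).llp u) :
    Mono u := mono_of_app _ fun c => by
  obtain ⟨N, i, hi, hN⟩ := h.exists_mono (Z.obj.obj c)
  have hq : epiWith (R.Psi B) (0 : (SubTo.top k c).coind N ⟶ (0 : LinFun k C M)) :=
    ⟨⟨fun _ _ _ => (isZero_zero _).eq_of_src _ _⟩,
      R.psi_of_retract h (R.psi_top h hN c) kernelZeroIsoSource.hom kernelZeroIsoSource.inv
        (Iso.hom_inv_id _)⟩
  have := hu _ hq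
  have sq : CommSq (topLift i) u (0 : (SubTo.top k c).coind N ⟶ (0 : LinFun k C M)) 0 := ⟨by simp⟩
  have h1 := congr_arg (fun z => z.hom.app c ≫ (SubTo.top k c).coindπ N c ⟨𝟙 c, SubTo.mem_top _⟩)
    sq.fac_left
  simp only [linFun_comp_app] at h1
  rw [topLift_π_id, Category.assoc] at h1
  exact mono_of_mono_fac h1

/-- Every functor embeds into a functor in `Ψ(B)` with cokernel in `Φ(A)`. -/
lemma exists_right (Z : LinFun k C M) :
    ∃ (Y X : LinFun k C M) (i : Z ⟶ Y) (p : Y ⟶ X) (w : i ≫ p = 0),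
      (ShortComplex.mk i p w).ShortExact ∧ R.Psi B Y ∧ R.Phi A X := by
  obtain ⟨Y, u, hu, hY⟩ := R.exists_psi h Z
  have := R.mono_of_llp h hu
  refine ⟨Y, cokernel u, u, cokernel.π u, cokernel.condition u, shortExact_cokernel u, hY,
    (R.phi_iff_extVanishes h).2 fun N hN => ?_⟩
  refine extVanishes_of_llp (Y := R.Psi B) (isZero_zero _) (f := 0)
    (fun hB e => R.psi_of_retract h hB e.hom e.inv e.hom_inv_id) ?_ hN
  exact MorphismProperty.of_isPushout (isPushout_cokernel u).flip hu

lemma psi_iff_extVanishes {Y : LinFun k C M} :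
    R.Psi B Y ↔ ∀ X, R.Phi A X → ExtVanishes X Y 1 := by
  refine ⟨fun hY X hX => (R.phi_iff_extVanishes h).1 hX Y hY, fun hY => ?_⟩
  obtain ⟨Y', X', i, p, w, hS, hY', hX'⟩ := R.exists_right h Y
  obtain ⟨r, hr⟩ := (hY X' hX').exists_extension hS (𝟙 Y)
  exact R.psi_of_retract h hY' i r hr

/-- Every functor is a quotient of a coproduct of functors `C(c, -) ⊗ N` with `N` in `A`. -/
lemma exists_epi (Z : LinFun k C M) : ∃ (P : LinFun k C M) (q : P ⟶ Z), Epi q ∧ R.Phi A P := by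
  choose K N i p w hS hK hN using fun c => h.exists_left (Z.obj.obj c)
  let F : C → LinFun k C M := fun c => (SubFrom.top k c).ind (N c)
  refine ⟨∐ F, Sigma.desc fun c => topDesc (p c), epi_of_app _ fun c => ?_,
    (R.phi_iff_extVanishes h).2 fun Y hY => .coproduct F fun c =>
      (R.phi_iff_extVanishes h).1 (R.phi_top h (hN c) c) Y hY⟩
  have h1 := congr_arg (fun z => (SubFrom.top k c).indι (N c) c ⟨𝟙 c, SubFrom.mem_top _⟩ ≫
    z.hom.app c) (Sigma.ι_desc (fun c => topDesc (p c)) c : Sigma.ι F c ≫ _ = _)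
  simp only [linFun_comp_app] at h1
  rw [ι_id_topDesc, ← Category.assoc] at h1
  have : Epi (p c) := (hS c).epi_g
  exact epi_of_epi_fac h1

/-- The pair of `Φ(A)` and `Ψ(B)`. The second approximation sequence is obtained from an epimorphism
`P ⟶ Z` with `P` in `Φ(A)` by enlarging the kernel to a functor in `Ψ(B)`. -/
theorem isCompleteCotorsionPair : IsCompleteCotorsionPair (R.Phi A) (R.Psi B) where
  left _ := R.phi_iff_extVanishes h
  right _ := R.psi_iff_extVanishes h
  exists_right := R.exists_right h
  exists_left Z := by
    obtain ⟨P, q, hq, hP⟩ := R.exists_epi h Z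
    obtain ⟨Y, X, i, p, w, hS, hY, hX⟩ := R.exists_right h (kernel q)
    obtain ⟨E, j, p', u, w', hS', hsq, -⟩ := exists_pushout_shortExact (shortExact_kernel q) i
    obtain ⟨E', j', p'', u', w'', hS'', hsq', -⟩ := exists_pushout_shortExact hS (kernel.ι q)
    refine ⟨Y, E, j, p', w', hS', hY, (R.phi_iff_extVanishes h).2 fun N hN => ?_⟩
    let e : E ≅ E' := hsq.isoIsPushout _ _ hsq'.flip
    exact .of_retract_left (.middle_left hS'' ((R.phi_iff_extVanishes h).1 hP N hN)
      ((R.phi_iff_extVanishes h).1 hX N hN)) e.hom e.inv e.hom_inv_id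

/-- The values of a functor in `Φ(A)` lie in `A`. -/
lemma phi_obj {X : LinFun k C M} (hX : R.Phi A X) (c : C) : A (X.obj.obj c) :=
  left_obj_of_extVanishes h fun _ hN =>
    (R.phi_iff_extVanishes h).1 hX _ (R.psi_top h hN c)

/-- The values of a functor in `Ψ(B)` lie in `B`. -/
lemma psi_obj {Y : LinFun k C M} (hY : R.Psi B Y) (c : C) : B (Y.obj.obj c) :=
  right_obj_of_extVanishes h fun _ hN =>
    (R.phi_iff_extVanishes h).1 (R.phi_top h hN c) _ hY

end ReedyStructure

end CotorsionPair

/-! ### The Hovey triple on linear functors -/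

section HoveyTriple

variable {k : Type v} [Field k] {C : Type v} [SmallCategory C] [Preadditive C] [Linear k C]
  {M : Type u} [Category.{v} M] [Abelian M] [Linear k M] [HasLimits M] [HasColimits M]

namespace ReedyStructure

variable (R : ReedyStructure k C) {A W B : ObjectProperty M}

/-- For a hereditary cotorsion pair, `Φ(A)` is closed under kernels of epimorphisms. -/
lemma phi_kernel (h : IsHereditaryCompleteCotorsionPair A B) {S : ShortComplex (LinFun k C M)}
    (hS : S.ShortExact) (h₂ : R.Phi A S.X₂) (h₃ : R.Phi A S.X₃) : R.Phi A S.X₁ := fun c => by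
  have hcp := h.toIsCompleteCotorsionPair
  refine R.phi_of_extends hcp (h.left_kernel (shortExact_ev hS c) (R.phi_obj hcp h₂ c)
    (R.phi_obj hcp h₃ c)) fun N hN φ => ?_
  -- extend the adjoint of `φ` from `S.X₁` to `S.X₂`, and then from the latching object to `S.X₂ c`
  obtain ⟨ψ, hψ⟩ := ((R.phi_iff_extVanishes hcp).1 h₃ _ (R.psi_lower hcp hN c)).exists_extension
    hS (R.lowerLift φ)
  obtain ⟨t, ht⟩ := R.exists_latchingDesc_of_lower ψ
  have := (h₂ c).1
  obtain ⟨a, ha⟩ := ((hcp.left _).1 (h₂ c).2 N hN).exists_extension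
    (shortExact_cokernel (R.latchingMap S.X₂ c)) t
  have ha' : R.latchingMap S.X₂ c ≫ a = t := ha
  refine ⟨S.f.hom.app c ≫ a, R.latching_hom_ext fun e he p => ?_⟩
  rw [reassoc_of% R.latchingι_latchingMap, reassoc_of% linFun_naturality,
    ← R.lowerLift_π φ he p, ← hψ, linFun_comp_app, Category.assoc, ← ht e he p, ← ha',
    reassoc_of% R.latchingι_latchingMap]

theorem isHereditaryCompleteCotorsionPair (h : IsHereditaryCompleteCotorsionPair A B) :
    IsHereditaryCompleteCotorsionPair (R.Phi A) (R.Psi B) :=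
  (R.isCompleteCotorsionPair h.toIsCompleteCotorsionPair).isHereditary
    fun _ hS h₂ h₃ => R.phi_kernel h hS h₂ h₃

section

variable (h₁ : IsCompleteCotorsionPair A (W ⊓ B)) (h₂ : IsCompleteCotorsionPair (A ⊓ W) B)
  (hW : ∀ S : ShortComplex M, S.ShortExact → W S.X₁ → W S.X₂ → A S.X₃ → W S.X₃)
include h₁ h₂ hW

/-- A functor in `Φ(A)` with values in `W` lies in `Φ(A ∩ W)`. By induction on the degree, its
latching objects lie in `A ∩ W`. -/
lemma phi_inf_of_pointwise {X : LinFun k C M} (hX : R.Phi A X) (hXW : pointwise k C W X) :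
    R.Phi (A ⊓ W) X := by
  have key : ∀ (α : Ordinal.{v}) (c : C), R.deg c = α →
      Mono (R.latchingMap X c) ∧ (A ⊓ W) (cokernel (R.latchingMap X c)) := fun α => by
    induction α using WellFoundedLT.induction with
    | ind α ih =>
    rintro c rfl
    have hL : (A ⊓ W) (R.latchingObj X c) := R.left_latchingObj_of_extVanishes h₂ fun N hN => by
      have hΨ := R.psi_lower h₂ hN c
      refine R.extVanishes_of_latching_of_matching (fun d => (hX d).1) (fun d => (hΨ d).1)
        fun d => ?_
      by_cases hd : d ∈ R.below c
      · exact (h₂.left _).1 (ih _ hd d rfl).2 _ (hΨ d).2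
      · have := (R.lowerData c N).mono_matchingMap hd
        have h0 : IsZero (kernel (R.matchingMap ((R.lowerSubTo c).coind N) d)) :=
          (isZero_zero M).of_iso (kernel.ofMono _)
        exact (h₁.right _).1 (h₁.right_of_isZero h0) _ (hX d).2
    have := (hX c).1
    exact ⟨this, (hX c).2, hW _ (shortExact_cokernel (R.latchingMap X c)) hL.2 (hXW c) (hX c).2⟩
  exact fun c => key _ c rfl

lemma phi_inf_eq : R.Phi (A ⊓ W) = R.Phi A ⊓ pointwise k C W := by
  ext X
  exact ⟨fun hX => ⟨fun c => ⟨(hX c).1, (hX c).2.1⟩, fun c => (R.phi_obj h₂ hX c).2⟩,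
    fun hX => R.phi_inf_of_pointwise h₁ h₂ hW hX.1 hX.2⟩

/-- A functor `Y` in `Ψ(B)` with values in `W` is a retract of a functor in `Ψ(W ∩ B)`, because the
cokernel of an embedding of `Y` into such a functor lies in `Φ(A ∩ W)`. -/
lemma psi_inf_of_pointwise {Y : LinFun k C M} (hY : R.Psi B Y) (hYW : pointwise k C W Y) :
    R.Psi (W ⊓ B) Y := by
  obtain ⟨Y', X, i, p, w, hS, hY', hX⟩ := R.exists_right h₁ Y
  have hXW : pointwise k C W X := fun c => hW _ (shortExact_ev hS c) (hYW c)
    (R.psi_obj h₁ hY' c).1 (R.phi_obj h₁ hX c)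
  obtain ⟨r, hr⟩ := ((R.phi_iff_extVanishes h₂).1 (R.phi_inf_of_pointwise h₁ h₂ hW hX hXW) Y
    hY).exists_extension hS (𝟙 Y)
  exact R.psi_of_retract h₁ hY' i r hr

lemma psi_inf_eq : R.Psi (W ⊓ B) = pointwise k C W ⊓ R.Psi B := by
  ext Y
  exact ⟨fun hY => ⟨fun c => (R.psi_obj h₁ hY c).1, fun c => ⟨(hY c).1, (hY c).2.2⟩⟩,
    fun hY => R.psi_inf_of_pointwise h₁ h₂ hW hY.2 hY.1⟩

end

/-- The pointwise weak equivalences. -/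
def pointwiseEquivalences (w : MorphismProperty M) : MorphismProperty (LinFun k C M) :=
  fun _ _ f => ∀ c, w (f.hom.app c)

instance (w : MorphismProperty M) [w.HasTwoOutOfThreeProperty] :
    (pointwiseEquivalences (k := k) (C := C) w).HasTwoOutOfThreeProperty where
  comp_mem _ _ hf hg c := w.comp_mem _ _ (hf c) (hg c)
  of_postcomp f g hg hfg c := w.of_postcomp (f.hom.app c) (g.hom.app c) (hg c) (hfg c)
  of_precomp f g hf hfg c := w.of_precomp (f.hom.app c) (g.hom.app c) (hf c) (hfg c)

theorem isHereditaryHoveyTriple (h : IsHereditaryHoveyTriple A W B) :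
    IsHereditaryHoveyTriple (R.Phi A) (pointwise k C W) (R.Psi B) := by
  have h₁ := h.cofibrant_pair.toIsCompleteCotorsionPair
  have h₂ := h.fibrant_pair.toIsCompleteCotorsionPair
  obtain ⟨w, hw, hwi, hwA, hwB, hW₀⟩ := h.isHoveyTriple.exists_weakEquivalences
  have hWiso : ∀ {X Y : M}, (X ≅ Y) → W X → W Y := fun {X Y} e hX => by
    rw [hW₀] at hX ⊢
    rw [← zero_comp (f := e.hom)]
    exact MorphismProperty.RespectsIso.postcomp w e.hom _ hX
  -- a cofibration between weakly trivial objects is a weak equivalence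
  have hW : ∀ S : ShortComplex M, S.ShortExact → W S.X₁ → W S.X₂ → A S.X₃ → W S.X₃ :=
    fun S hS hS₁ hS₂ hS₃ => by
      have hf : w S.f := by
        rw [hW₀] at hS₁ hS₂
        rw [← zero_comp (f := S.f)] at hS₂
        exact w.of_precomp _ _ hS₁ hS₂
      exact hWiso ((cokernelIsCokernel S.f).coconePointUniqueUpToIso hS.gIsCokernel)
        ((hwA S.f (h₁.monoWith_of_shortExact hS hS₃)).1 hf)
  have e₁ := R.psi_inf_eq h₁ h₂ hW
  have e₂ := R.phi_inf_eq h₁ h₂ hW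
  have H₁ : IsHereditaryCompleteCotorsionPair (R.Phi A) (pointwise k C W ⊓ R.Psi B) := by
    rw [← e₁]
    exact R.isHereditaryCompleteCotorsionPair h.cofibrant_pair
  have H₂ : IsHereditaryCompleteCotorsionPair (R.Phi A ⊓ pointwise k C W) (R.Psi B) := by
    rw [← e₂]
    exact R.isHereditaryCompleteCotorsionPair h.fibrant_pair
  refine ⟨isHoveyTriple_of_weakEquivalences (pointwiseEquivalences w)
    H₁.toIsCompleteCotorsionPair H₂.toIsCompleteCotorsionPair (fun f hf => ?_) (fun f hf => ?_)
    fun X => forall_congr' fun c => ?_, H₁, H₂⟩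
  · have := hf.1
    refine forall_congr' fun c => ?_
    have hS := shortExact_ev (shortExact_cokernel f) c
    refine (hwA _ (h₁.monoWith_of_shortExact hS (R.phi_obj h₁ hf.2 c))).trans ?_
    let e := (cokernelIsCokernel (f.hom.app c)).coconePointUniqueUpToIso hS.gIsCokernel
    exact ⟨hWiso e, hWiso e.symm⟩
  · have := hf.1
    refine forall_congr' fun c => ?_
    have hS := shortExact_ev (shortExact_kernel f) c
    refine (hwB _ (h₂.epiWith_of_shortExact hS (R.psi_obj h₂ hf.2 c))).trans ?_
    let e := (kernelIsKernel (f.hom.app c)).conePointUniqueUpToIso hS.fIsKernel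
    exact ⟨hWiso e, hWiso e.symm⟩
  · have hZ : IsZero ((0 : LinFun k C M).obj.obj c) := (isZero_linFun_iff _).1 (isZero_zero _) c
    rw [hW₀, show ((0 : (0 : LinFun k C M) ⟶ X).hom.app c) = (hZ.iso (isZero_zero M)).hom ≫ 0 from
      hZ.eq_of_src _ _]
    exact (MorphismProperty.cancel_left_of_respectsIso w _ _).symm

end ReedyStructure

end HoveyTriple

end LinearReedy

end

theorem mainTheorem2 {k : Type v} [Field k]
    {C : Type v} [SmallCategory C] [Preadditive C] [Linear k C]
    (R : LinearReedy.ReedyStructure k C)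
    {M : Type u} [Category.{v} M] [Abelian M] [Linear k M] [HasLimits M] [HasColimits M]
    (A W B : ObjectProperty M) (h : LinearReedy.IsHereditaryHoveyTriple A W B) :
    LinearReedy.IsHereditaryHoveyTriple (R.Phi A) (LinearReedy.pointwise k C W) (R.Psi B) :=
  R.isHereditaryHoveyTriple h
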